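/- Let $\rho,r\ge 0$ with $r+\frac{\rho}{2}\ge 1$ and $(\rho,r)\ne(0,1)$, let $p>1$, and put $s_0=\frac r2+\frac\rho2$. Let $L$ and $B$ be the Fourier multiplier operators on $\mathbb R$ with smooth, even, real symbols $l$ and $b$ such that, for some constants $c_1,c_2,c_3,c_4>0$ and all $\xi\in\mathbb R$, $$c_1^2(1+\xi^2)^{\rho/2}\le l(\xi)\le c_2^2(1+\xi^2)^{\rho/2},\qquad c_3^2(1+\xi^2)^{-r/2}\le b(\xi)\le c_4^2(1+\xi^2)^{-r/2}.$$ Consider, for real-valued $u,w$, the Cauchy problem $$u_t=w_x,\qquad w_t=Lu_x+B(g(u))_x,\qquad g(u)=-|u|^{p-1}u,\qquad u(0)=u_0,\quad w(0)=w_0 .$$ A solution on a time interval $J=[0,T)$ or $J=[0,\infty)$ is a pair $(u,w)\in C(J,H^{s_0}(\mathbb R))\times C(J,H^{s_0-\rho/2}(\mathbb R))$ with these initial values that satisfies the two equations for $t>0$ in the sense of distributions. For $(u,w)\in H^{s_0}(\mathbb R)\times H^{s_0-\rho/2}(\mathbb R)$ and $\gamma\in\mathbb R$ let $$\mathcal Q(u)=\int_{\mathbb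 R}|u|^{p+1}dx,\qquad \mathcal I_\gamma(u)=\frac12\int_{\mathbb R}\bigl(B^{-1/2}L^{1/2}u\bigr)^2dx-\frac{\gamma^2}{2}\int_{\mathbb R}\bigl(B^{-1/2}u\bigr)^2dx,$$ $$\mathcal E(u,w)=\frac12\|B^{-1/2}w\|_{L^2}^2+\frac12\|B^{-1/2}L^{1/2}u\|_{L^2}^2-\frac1{p+1}\mathcal Q(u),\qquad \mathcal M(u,w)=\int_{\mathbb R}(B^{-1/2}w)(B^{-1/2}u)\,dx,$$ $$d(\gamma)=\inf\bigl\{\mathcal E(u,w)+\gamma\mathcal M(u,w):\ (u,w)\in H^{s_0}\times H^{s_0-\rho/2},\ u\ne0,\ 2\mathcal I_\gamma(u)-\mathcal Q(u)=0\bigr\},$$ $$\Sigma_+(\gamma)=\bigl\{(u,w)\in H^{s_0}\times H^{s_0-\rho/2}:\ \mathcal E(u,w)+\gamma\mathcal M(u,w)<d(\gamma),\ 2\mathcal I_\gamma(u)-\mathcal Q(u)\ge0\bigr\}.$$ Let $|\gamma|<c_1$ and $(u_0,w_0)\in\Sigma_+(\gamma)$. Then the solution of the Cauchy problem with initial data $(u_0,w_0)$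 is global: there is a solution on $[0,\infty)$, and every solution on an interval $[0,T)$, $0<T<\infty$, with the same data coincides with it on $[0,T)$. Moreover, if $d(\gamma)-\gamma\mathcal M(u_0,w_0)\le d(0)$, then already $(u_0,w_0)\in\Sigma_+(0)$; so the result for $\gamma\neq 0$ goes beyond the case $\gamma=0$ only for data with $d(\gamma)-\gamma\mathcal M(u_0,w_0)>d(0)$. -/

import Mathlib

noncomputable section

namespace NonlocalWave

open MeasureTheory Filter Topology Set
open scoped FourierTransform ENNReal SchwartzMap

/-- Real-valued functions in `L²(ℝ)`. -/
abbrev RealL2 : Type := Lp ℝ 2 (volume : Measure ℝ)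

/-- Complex-valued functions in `L²(ℝ)`. -/
abbrev CplxL2 : Type := Lp ℂ 2 (volume : Measure ℝ)

/-- A real-valued `L²` function regarded as a complex-valued one. -/
def toCplx (f : RealL2) : CplxL2 := Complex.ofRealCLM.compLp f

/-- The Fourier transform `f̂(ξ) = ∫ f(x) e^{-iξx} dx` of a real `L²` function. Mathlib's Fourier
(Plancherel) transform `𝓕` has the kernel `e^{-2πixξ}`, hence the rescaling of the frequency. -/
def fourierHat (f : RealL2) (ξ : ℝ) : ℂ := (𝓕 (toCplx f) : CplxL2) (ξ / (2 * Real.pi))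

/-- The norm `‖f‖_{H^s} = (∫ (1 + ξ²)^s |f̂(ξ)|² dξ)^{1/2}`, with value `∞` if `f ∉ H^s(ℝ)`. -/
def sobolevNorm (s : ℝ) (f : RealL2) : ℝ≥0∞ :=
  eLpNorm (fun ξ : ℝ => (((1 + ξ ^ 2) ^ (s / 2) : ℝ) : ℂ) * fourierHat f ξ) 2 volume

/-- Membership in `H^s(ℝ)`, for orders `s ≥ 0`, where `H^s(ℝ) ⊆ L²(ℝ)`. -/
def MemH (s : ℝ) (f : RealL2) : Prop := sobolevNorm s f < ⊤

/-- `u ∈ C(J, H^s(ℝ))`. -/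
def ContinuousInH (s : ℝ) (J : Set ℝ) (u : ℝ → RealL2) : Prop :=
  (∀ t ∈ J, MemH s (u t)) ∧
    ∀ t ∈ J, Tendsto (fun τ => sobolevNorm s (u τ - u t)) (𝓝[J] t) (𝓝 0)

open Classical in
/-- The operator with symbol `m(ξ)`, i.e. `f ↦ h` with `ĥ(ξ) = m(ξ) f̂(ξ)`, on its natural domain
in `L²(ℝ)` (and `0` off that domain). It is used for even real symbols `m` only; these map real
functions to real functions, so that passing to the real part loses nothing. -/
def multiplier (m : ℝ → ℝ) (f : RealL2) : RealL2 :=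
  if h : MemLp (fun η : ℝ => ((m (2 * Real.pi * η) : ℝ) : ℂ) * (𝓕 (toCplx f) : CplxL2) η) 2
      (volume : Measure ℝ) then
    Complex.reCLM.compLp (𝓕⁻ (h.toLp _) : CplxL2)
  else 0

/-- `B^{-1/2} f`, where `b` is the symbol of `B`. -/
def invSqrtB (b : ℝ → ℝ) (f : RealL2) : RealL2 := multiplier (fun ξ => (√(b ξ))⁻¹) f

/-- `B^{-1/2} L^{1/2} f`, where `l` and `b` are the symbols of `L` and `B`. -/
def invSqrtBSqrtL (l b : ℝ → ℝ) (f : RealL2) : RealL2 :=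
  multiplier (fun ξ => (√(b ξ))⁻¹ * √(l ξ)) f

/-- `s₀ = r/2 + ρ/2`. -/
def s0 (ρ r : ℝ) : ℝ := r / 2 + ρ / 2

/-- The energy space `H^{s₀}(ℝ) × H^{s₀ - ρ/2}(ℝ)` for pairs `(u, w)`. -/
def energySpace (ρ r : ℝ) : Set (RealL2 × RealL2) :=
  {z | MemH (s0 ρ r) z.1 ∧ MemH (s0 ρ r - ρ / 2) z.2}

/-- The nonlinearity `g(u) = -|u|^{p-1} u`. -/
def g (p y : ℝ) : ℝ := -(|y| ^ (p - 1) * y)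

/-- `Q(u) = ∫ |u|^{p+1} dx`. -/
def Q (p : ℝ) (u : RealL2) : ℝ := ∫ x, |u x| ^ (p + 1)

/-- `I_γ(u) = ½ ∫ (B^{-1/2} L^{1/2} u)² dx - (γ²/2) ∫ (B^{-1/2} u)² dx`. -/
def Iaug (l b : ℝ → ℝ) (γ : ℝ) (u : RealL2) : ℝ :=
  1 / 2 * (∫ x, (invSqrtBSqrtL l b u x) ^ 2) - γ ^ 2 / 2 * (∫ x, (invSqrtB b u x) ^ 2)

/-- The energy `E(u, w)`. -/
def energy (l b : ℝ → ℝ) (p : ℝ) (u w : RealL2) : ℝ :=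
  1 / 2 * ‖invSqrtB b w‖ ^ 2 + 1 / 2 * ‖invSqrtBSqrtL l b u‖ ^ 2 - 1 / (p + 1) * Q p u

/-- The momentum `M(u, w) = ∫ (B^{-1/2} w) (B^{-1/2} u) dx`. -/
def momentum (b : ℝ → ℝ) (u w : RealL2) : ℝ := ∫ x, invSqrtB b w x * invSqrtB b u x

/-- The augmented critical energy constant `d(γ)`; `d = d(0)`. -/
def critEnergy (l b : ℝ → ℝ) (ρ r p γ : ℝ) : ℝ :=
  sInf {e : ℝ | ∃ u w : RealL2, (u, w) ∈ energySpace ρ r ∧ u ≠ 0 ∧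
    2 * Iaug l b γ u - Q p u = 0 ∧ e = energy l b p u w + γ * momentum b u w}

/-- The set `Σ₊(γ)`; `Σ₊ = Σ₊(0)`. -/
def SigmaPlus (l b : ℝ → ℝ) (ρ r p γ : ℝ) : Set (RealL2 × RealL2) :=
  {z | z ∈ energySpace ρ r ∧
    energy l b p z.1 z.2 + γ * momentum b z.1 z.2 < critEnergy l b ρ r p γ ∧
    0 ≤ 2 * Iaug l b γ z.1 - Q p z.1}

/-- A Schwartz function as an element of `L²(ℝ)`. -/
def testL2 (ψ : 𝓢(ℝ, ℝ)) : RealL2 := ψ.toLp 2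

/-- The derivative `ψ_x` of a Schwartz function, as an element of `L²(ℝ)`. -/
def testDeriv (ψ : 𝓢(ℝ, ℝ)) : RealL2 := (SchwartzMap.derivCLM ℝ ℝ ψ).toLp 2

/-- `(u, w)` solves the Cauchy problem `u_t = w_x`, `w_t = L u_x + B (g(u))_x` with data
`(u₀, w₀)` on the time interval `J` (used for `J = [0, T)` and `J = [0, ∞)`): it belongs to
`C(J, H^{s₀}) × C(J, H^{s₀ - ρ/2})`, and for `t > 0` the equations hold in the sense of
distributions in `x`. The operators `L`, `B` are symmetric and commute with `∂_x`, so they are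
moved to the test function together with `∂_x`. -/
structure IsSolution (l b : ℝ → ℝ) (ρ r p : ℝ) (u₀ w₀ : RealL2) (J : Set ℝ)
    (u w : ℝ → RealL2) : Prop where
  cont_u : ContinuousInH (s0 ρ r) J u
  cont_w : ContinuousInH (s0 ρ r - ρ / 2) J w
  init_u : u 0 = u₀
  init_w : w 0 = w₀
  eq_u : ∀ ψ : 𝓢(ℝ, ℝ), ∀ t ∈ J, 0 < t →
    HasDerivAt (fun τ => ∫ x, u τ x * testL2 ψ x) (-∫ x, w t x * testDeriv ψ x) t
  eq_w : ∀ ψ : 𝓢(ℝ, ℝ), ∀ t ∈ J, 0 < t →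
    HasDerivAt (fun τ => ∫ x, w τ x * testL2 ψ x)
      (-(∫ x, u t x * multiplier l (testDeriv ψ) x) -
        ∫ x, g p (u t x) * multiplier b (testDeriv ψ) x) t

end NonlocalWave

end

noncomputable section

namespace NonlocalWave

open MeasureTheory Filter Topology Set
open scoped FourierTransform ENNReal NNReal SchwartzMap ComplexConjugate InnerProductSpace ContDiff
  BoundedContinuousFunction

/-! ### The Fourier transform of real square integrable functions -/

/-! Write `u = B^{1/2} L^{-1/2} U` and `w = B^{1/2} W` (`opK`, `opB`). The energy space becomes `L²
× L²`, and completing the square turns `E + γM` into `½‖W + γ L^{-1/2} U‖² + I_γ - Q/(p+1)`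
(`energy_add_momentum`). The lower bound on `l` gives `‖L^{-1/2}‖ ≤ 1/c₁`, so the quadratic part is
coercive for `|γ| < c₁`.

The core is a potential well. On `2 I_γ = Q`, minimizing over `W` leaves `(p-1)/(p+1) I_γ`, which is
therefore at least `d(γ)`. If `Q > 2 I_γ`, scaling `U` down to that set lowers `I_γ`; hence
`(p-1)/(p+1) I_γ < d(γ)` forces `Q ≤ 2 I_γ` (`Q_le_of_quadI_lt`), and then `(p-1)/(p+1) I_γ ≤ E +
γM` (`quadI_le_energy`). If `E + γM = e < d(γ)` is conserved, the times with level `< d(γ)` are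
those with level `≤ e`. This set is clopen, so a trajectory starting in the well stays there
(`level_cut_le`). There the energy norm is bounded, and so is the sup norm, because `s₀ > 1/2`
(`exists_sup_bound`).

The sup bound `R` is known in advance, so the nonlinearity may be truncated at height `R`. The
combinations `u ± L^{-1/2} w` diagonalize the linear part; undoing the groups `exp(±t L^{1/2} ∂_x)`
leaves an ordinary differential equation on `L² × L²` whose right hand side `field` is globally
Lipschitz, since `B L^{-1/2} ∂_x` is bounded. It has global solutions, but their energy is not
controlled a priori. Frequency truncated equations conserve the energy exactly
(`hasDerivAt_energy_cut`) and their solutions converge in `L²` (`tendsto_solution_cut`); weak limits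
yield an energy inequality (`exists_energy_le`). Running time backwards gives the converse
inequality (`exists_energy_eq`), and energy equality upgrades weak to strong continuity
(`tendsto_of_quadH`).

For uniqueness, any solution is bounded on compact subintervals, and its interaction picture
variables solve the same Lipschitz equation at a larger truncation height (`eq_of_weak`). The
comparison with `γ = 0` is a rearrangement together with `I_0 ≥ I_γ`. -/

/-- The Plancherel transform of a real `L²` function. -/
def hat (f : RealL2) : CplxL2 := 𝓕 (toCplx f)

/-- The real part of the inverse Plancherel transform. -/
def unhat (h : CplxL2) : RealL2 := Complex.reCLM.compLp (𝓕⁻ h : CplxL2)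

lemma coeFn_toCplx (f : RealL2) : toCplx f =ᵐ[volume] fun x => ((f x : ℝ) : ℂ) :=
  Complex.ofRealCLM.coeFn_compLp f

lemma coeFn_unhat (h : CplxL2) : unhat h =ᵐ[volume] fun x => ((𝓕⁻ h : CplxL2) x).re :=
  Complex.reCLM.coeFn_compLp _

lemma hat_add (f g : RealL2) : hat (f + g) = hat f + hat g := by
  have : toCplx (f + g) = toCplx f + toCplx g := (Complex.ofRealCLM.compLpₗ 2 volume).map_add f g
  rw [hat, this, FourierTransform.fourier_add]; rfl

lemma hat_smul (c : ℝ) (f : RealL2) : hat (c • f) = (c : ℂ) • hat f := by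
  have : toCplx (c • f) = (c : ℂ) • toCplx f := by
    ext1
    filter_upwards [coeFn_toCplx (c • f), Lp.coeFn_smul c f, Lp.coeFn_smul (c : ℂ) (toCplx f),
      coeFn_toCplx f] with x h1 h2 h3 h4
    rw [h1, h2, h3, Pi.smul_apply, Pi.smul_apply, h4]; simp
  rw [hat, this, FourierTransform.fourier_smul]; rfl

lemma hat_sub (f g : RealL2) : hat (f - g) = hat f - hat g := by
  rw [sub_eq_add_neg, hat_add, ← neg_one_smul ℝ g, hat_smul]
  simp [sub_eq_add_neg]

lemma unhat_hat (f : RealL2) : unhat (hat f) = f := by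
  ext1
  filter_upwards [coeFn_unhat (hat f), coeFn_toCplx f] with x h1 h2
  rw [h1, hat, FourierTransform.fourierInv_fourier_eq, h2, Complex.ofReal_re]

lemma hat_injective : Function.Injective hat := Function.LeftInverse.injective unhat_hat

/-- By Plancherel the inverse transform is the adjoint of the transform; the real part may be taken
inside because `f` is real. -/
lemma inner_unhat (h : CplxL2) (f : RealL2) : ⟪unhat h, f⟫_ℝ = (⟪h, hat f⟫_ℂ).re := by
  have e : ⟪h, hat f⟫_ℂ = ⟪(𝓕⁻ h : CplxL2), toCplx f⟫_ℂ := by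
    rw [← Lp.inner_fourier_eq (𝓕⁻ h : CplxL2), FourierTransform.fourier_fourierInv_eq, hat]
  rw [e, L2.inner_def, L2.inner_def]
  have := integral_re (𝕜 := ℂ) (L2.integrable_inner (𝕜 := ℂ) (𝓕⁻ h : CplxL2) (toCplx f))
  refine Eq.trans ?_ this
  refine integral_congr_ae ?_
  filter_upwards [coeFn_unhat h, coeFn_toCplx f] with x h1 h2
  simp [h1, h2, RCLike.inner_apply, mul_comm]

lemma inner_hat (f g : RealL2) : (⟪hat f, hat g⟫_ℂ).re = ⟪f, g⟫_ℝ := by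
  rw [← inner_unhat, unhat_hat]

lemma norm_hat (f : RealL2) : ‖hat f‖ = ‖f‖ := by
  have h := inner_hat f f
  rw [real_inner_self_eq_norm_sq, inner_self_eq_norm_sq_to_K] at h
  have h2 : ‖hat f‖ ^ 2 = ‖f‖ ^ 2 := by
    rw [← h]; norm_cast
  exact (pow_left_inj₀ (norm_nonneg _) (norm_nonneg _) two_ne_zero).1 h2

lemma continuous_hat : Continuous hat := by
  have : Isometry hat := Isometry.of_dist_eq fun f g => by
    rw [dist_eq_norm, dist_eq_norm, ← hat_sub, norm_hat]
  exact this.continuous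

/-- The involution `h(η) ↦ conj h(-η)`. -/
def reflConj (h : CplxL2) : CplxL2 :=
  (Complex.conjCLE : ℂ →L[ℝ] ℂ).compLp
    (Lp.compMeasurePreserving Neg.neg (Measure.measurePreserving_neg (volume : Measure ℝ)) h)

lemma coeFn_reflConj (h : CplxL2) : reflConj h =ᵐ[volume] fun η => conj (h (-η)) := by
  filter_upwards [(Complex.conjCLE : ℂ →L[ℝ] ℂ).coeFn_compLp (Lp.compMeasurePreserving Neg.neg
    (Measure.measurePreserving_neg (volume : Measure ℝ)) h),
    Lp.coeFn_compMeasurePreserving h (Measure.measurePreserving_neg (volume : Measure ℝ))]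
    with x h1 h2
  rw [reflConj, h1, h2]; simp

lemma continuous_reflConj : Continuous reflConj :=
  ((Complex.conjCLE : ℂ →L[ℝ] ℂ).compLpL 2 volume).continuous.comp
    (Lp.isometry_compMeasurePreserving _).continuous

lemma toCplx_testL2 (ψ : 𝓢(ℝ, ℝ)) :
    toCplx (testL2 ψ) = (ψ.postcompCLM Complex.ofRealCLM).toLp 2 := by
  ext1
  filter_upwards [coeFn_toCplx (testL2 ψ), ψ.coeFn_toLp 2,
    (ψ.postcompCLM Complex.ofRealCLM).coeFn_toLp 2] with x h1 h2 h3
  rw [h1, h3, testL2, h2]; simp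

lemma hat_testL2 (ψ : 𝓢(ℝ, ℝ)) :
    hat (testL2 ψ) = (𝓕 (ψ.postcompCLM Complex.ofRealCLM : 𝓢(ℝ, ℂ))).toLp 2 := by
  rw [hat, toCplx_testL2, SchwartzMap.toLp_fourier_eq]

lemma coeFn_hat_testL2 (ψ : 𝓢(ℝ, ℝ)) : hat (testL2 ψ) =ᵐ[volume]
    (𝓕 (ψ.postcompCLM Complex.ofRealCLM : 𝓢(ℝ, ℂ)) : 𝓢(ℝ, ℂ)) := by
  rw [hat_testL2]
  exact SchwartzMap.coeFn_toLp _ _ (volume : Measure ℝ)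

lemma fourier_ofReal_neg (ψ : 𝓢(ℝ, ℝ)) (η : ℝ) :
    (𝓕 (ψ.postcompCLM Complex.ofRealCLM : 𝓢(ℝ, ℂ)) : 𝓢(ℝ, ℂ)) (-η) =
      conj ((𝓕 (ψ.postcompCLM Complex.ofRealCLM : 𝓢(ℝ, ℂ)) : 𝓢(ℝ, ℂ)) η) := by
  rw [SchwartzMap.fourier_coe, Real.fourier_real_eq_integral_exp_smul,
    Real.fourier_real_eq_integral_exp_smul, ← integral_conj]
  refine integral_congr_ae (Eventually.of_forall fun x => ?_)
  simp [← Complex.exp_conj, Complex.conj_ofNat]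

/-- Both sides are continuous in `f`, so Schwartz functions suffice; there it is conjugation under
the Fourier integral. -/
lemma reflConj_hat (f : RealL2) : reflConj (hat f) = hat f := by
  have hd := SchwartzMap.denseRange_toLpCLM (E := ℝ) (F := ℝ) (p := 2) (μ := volume) (by simp)
  refine hd.induction_on (p := fun f => reflConj (hat f) = hat f) f
    (isClosed_eq (continuous_reflConj.comp continuous_hat) continuous_hat) fun ψ => ?_
  change reflConj (hat (testL2 ψ)) = hat (testL2 ψ)
  ext1
  have h3 := (Measure.measurePreserving_neg (volume : Measure ℝ)).quasiMeasurePreserving.ae_eq_comp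
    (coeFn_hat_testL2 ψ)
  filter_upwards [coeFn_reflConj (hat (testL2 ψ)), coeFn_hat_testL2 ψ, h3] with x h1 h2 h3
  simp only [Function.comp] at h3
  rw [h1, h2, h3, fourier_ofReal_neg, Complex.conj_conj]

lemma hat_neg_ae (f : RealL2) : ∀ᵐ η, hat f (-η) = conj (hat f η) := by
  have h := coeFn_reflConj (hat f)
  rw [reflConj_hat] at h
  filter_upwards [h] with x hx
  rw [hx, Complex.conj_conj]

/-- Split the inverse transform as `a + ic` with `a`, `c` real. Since `h`, `hat a` and `hat c` are
all Hermitian, `i hat c` is Hermitian and anti-Hermitian at once, so `c = 0`. -/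
lemma hat_unhat {h : CplxL2} (hh : ∀ᵐ η, h (-η) = conj (h η)) : hat (unhat h) = h := by
  set F : CplxL2 := 𝓕⁻ h
  set c : RealL2 := Complex.imCLM.compLp F
  have hF : F = toCplx (unhat h) + Complex.I • toCplx c := by
    ext1
    filter_upwards [coeFn_toCplx (unhat h), coeFn_unhat h, coeFn_toCplx c,
      Complex.imCLM.coeFn_compLp F, Lp.coeFn_add (toCplx (unhat h)) (Complex.I • toCplx c),
      Lp.coeFn_smul Complex.I (toCplx c)] with x h1 h2 h3 h4 h5 h6
    rw [h5, Pi.add_apply, h6, Pi.smul_apply, h1, h2, h3, h4, smul_eq_mul, mul_comm]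
    exact (Complex.re_add_im _).symm
  have hh2 : h = hat (unhat h) + Complex.I • hat c := by
    have e : h = 𝓕 F := (FourierTransform.fourier_fourierInv_eq h).symm
    have e2 := congrArg (fun G : CplxL2 => (𝓕 G : CplxL2)) hF
    simp only [FourierTransform.fourier_add, FourierTransform.fourier_smul] at e2
    exact e.trans e2
  have hc : hat c = 0 := by
    ext1
    have e : h =ᵐ[volume] fun η => hat (unhat h) η + Complex.I * hat c η := by
      filter_upwards [Lp.coeFn_add (hat (unhat h)) (Complex.I • hat c),
        Lp.coeFn_smul Complex.I (hat c)] with x h1 h2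
      conv_lhs => rw [hh2]
      rw [h1, Pi.add_apply, h2]; rfl
    have e' := (Measure.measurePreserving_neg
      (volume : Measure ℝ)).quasiMeasurePreserving.ae_eq_comp e
    filter_upwards [hh, e, e', hat_neg_ae (unhat h), hat_neg_ae c,
      Lp.coeFn_zero ℂ 2 (volume : Measure ℝ)] with x h1 h2 h3 h4 h5 h6
    simp only [Function.comp] at h3
    rw [h3, h2, h4, h5, map_add, map_mul, Complex.conj_I] at h1
    have h7 : conj (hat c x) = 0 := by
      have : (2 * Complex.I) * conj (hat c x) = 0 := by linear_combination h1
      simpa using this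
    rw [h6]
    simpa using h7
  rw [hc, smul_zero, add_zero] at hh2
  exact hh2.symm

/-! ### Bounded Fourier multipliers on real functions -/

/-- `m(ξ) f̂(ξ)` is square integrable (in Mathlib's frequency variable). -/
def InDomain (m : ℝ → ℂ) (f : RealL2) : Prop :=
  MemLp (fun η : ℝ => m (2 * Real.pi * η) * hat f η) 2 (volume : Measure ℝ)

open Classical in
/-- The possibly unbounded multiplier operator with complex symbol `m`. -/
def op (m : ℝ → ℂ) (f : RealL2) : RealL2 :=
  if h : InDomain m f then unhat (h.toLp _) else 0

lemma multiplier_eq_op (m : ℝ → ℝ) (f : RealL2) :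
    multiplier m f = op (fun ξ => ((m ξ : ℝ) : ℂ)) f := rfl

lemma quasi_neg : Measure.QuasiMeasurePreserving (Neg.neg : ℝ → ℝ) volume volume :=
  (Measure.measurePreserving_neg (volume : Measure ℝ)).quasiMeasurePreserving

/-- The Hermitian symmetry of `m` passes to `m · hat f`, so the inverse transform is already real
and `unhat` discards nothing. -/
lemma hat_op {m : ℝ → ℂ} (hm : ∀ ξ, m (-ξ) = conj (m ξ)) {f : RealL2} (h : InDomain m f) :
    hat (op m f) =ᵐ[volume] fun η => m (2 * Real.pi * η) * hat f η := by
  rw [op, dif_pos h, hat_unhat]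
  · exact h.coeFn_toLp
  · have e' := quasi_neg.ae_eq_comp h.coeFn_toLp
    filter_upwards [h.coeFn_toLp, e', hat_neg_ae f] with η h1 h2 h3
    simp only [Function.comp] at h2
    rw [h2, h1, h3, mul_neg, hm, map_mul]

/-- Bounded measurable Hermitian symbols: those of bounded translation invariant operators on real
functions. -/
structure IsSymbol (m : ℝ → ℂ) : Prop where
  meas : Measurable m
  herm : ∀ ξ, m (-ξ) = conj (m ξ)
  bdd : ∃ C, ∀ ξ, ‖m ξ‖ ≤ C

namespace IsSymbol

lemma add {m n : ℝ → ℂ} (hm : IsSymbol m) (hn : IsSymbol n) : IsSymbol (fun ξ => m ξ + n ξ) := by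
  obtain ⟨C, hC⟩ := hm.bdd
  obtain ⟨C', hC'⟩ := hn.bdd
  exact ⟨hm.meas.add hn.meas, fun ξ => by simp [hm.herm, hn.herm],
    C + C', fun ξ => (norm_add_le _ _).trans (add_le_add (hC ξ) (hC' ξ))⟩

lemma mul {m n : ℝ → ℂ} (hm : IsSymbol m) (hn : IsSymbol n) : IsSymbol (fun ξ => m ξ * n ξ) := by
  obtain ⟨C, hC⟩ := hm.bdd
  obtain ⟨C', hC'⟩ := hn.bdd
  refine ⟨hm.meas.mul hn.meas, fun ξ => by simp [hm.herm, hn.herm], C * C', fun ξ => ?_⟩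
  rw [norm_mul]
  exact mul_le_mul (hC ξ) (hC' ξ) (norm_nonneg _) ((norm_nonneg _).trans (hC ξ))

lemma const (c : ℝ) : IsSymbol (fun _ => (c : ℂ)) :=
  ⟨measurable_const, fun ξ => by simp, |c|, fun ξ => by simp⟩

lemma neg {m : ℝ → ℂ} (hm : IsSymbol m) : IsSymbol (fun ξ => -m ξ) := by
  simpa using (const (-1)).mul hm

lemma sub {m n : ℝ → ℂ} (hm : IsSymbol m) (hn : IsSymbol n) : IsSymbol (fun ξ => m ξ - n ξ) := by
  simpa [sub_eq_add_neg] using hm.add hn.neg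

lemma conjugate {m : ℝ → ℂ} (hm : IsSymbol m) : IsSymbol (fun ξ => conj (m ξ)) := by
  obtain ⟨C, hC⟩ := hm.bdd
  exact ⟨Complex.continuous_conj.measurable.comp hm.meas, fun ξ => by simp [hm.herm],
    C, fun ξ => by simpa using hC ξ⟩

lemma aesm {m : ℝ → ℂ} (hm : IsSymbol m) :
    AEStronglyMeasurable (fun η => m (2 * Real.pi * η)) volume :=
  (hm.meas.comp (measurable_const_mul _)).aestronglyMeasurable

lemma inDomain {m : ℝ → ℂ} (hm : IsSymbol m) (f : RealL2) : InDomain m f := by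
  obtain ⟨C, hC⟩ := hm.bdd
  exact (Lp.memLp (hat f)).of_le_mul (hm.aesm.mul (Lp.aestronglyMeasurable _))
    (Eventually.of_forall fun η => by
      rw [norm_mul]; exact mul_le_mul_of_nonneg_right (hC _) (norm_nonneg _))

end IsSymbol

lemma ext_hat {f g : RealL2} (h : hat f =ᵐ[volume] hat g) : f = g :=
  hat_injective (Lp.ext h)

lemma coeFn_hat_add (f g : RealL2) :
    hat (f + g) =ᵐ[volume] fun η => hat f η + hat g η := by
  rw [hat_add]; exact Lp.coeFn_add _ _

lemma coeFn_hat_sub (f g : RealL2) :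
    hat (f - g) =ᵐ[volume] fun η => hat f η - hat g η := by
  rw [hat_sub]; exact Lp.coeFn_sub _ _

lemma coeFn_hat_smul (c : ℝ) (f : RealL2) :
    hat (c • f) =ᵐ[volume] fun η => (c : ℂ) * hat f η := by
  rw [hat_smul]; exact Lp.coeFn_smul _ _

lemma norm_le_of_hat_le {f g : RealL2} {C : ℝ} (h : ∀ᵐ η, ‖hat f η‖ ≤ C * ‖hat g η‖) :
    ‖f‖ ≤ C * ‖g‖ := by
  rw [← norm_hat f, ← norm_hat g]
  exact Lp.norm_le_mul_norm_of_ae_le_mul h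

open Classical in
/-- The bounded operator with symbol `m` (zero if `m` is not a bounded Hermitian symbol). -/
def T (m : ℝ → ℂ) : RealL2 →L[ℝ] RealL2 :=
  if hm : IsSymbol m then
    LinearMap.mkContinuous
      { toFun := op m
        map_add' := fun f g => by
          refine ext_hat ?_
          filter_upwards [hat_op hm.herm (hm.inDomain (f + g)), hat_op hm.herm (hm.inDomain f),
            hat_op hm.herm (hm.inDomain g), coeFn_hat_add f g, coeFn_hat_add (op m f) (op m g)]
            with η h1 h2 h3 h4 h5
          rw [h1, h5, h2, h3, h4, mul_add]
        map_smul' := fun c f => by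
          refine ext_hat ?_
          filter_upwards [hat_op hm.herm (hm.inDomain (c • f)), hat_op hm.herm (hm.inDomain f),
            coeFn_hat_smul c f, coeFn_hat_smul c (op m f)] with η h1 h2 h3 h4
          rw [h1, RingHom.id_apply, h4, h2, h3]; ring }
      hm.bdd.choose
      (fun f => by
        refine norm_le_of_hat_le ?_
        filter_upwards [hat_op hm.herm (hm.inDomain f)] with η h1
        change ‖hat (op m f) η‖ ≤ _
        rw [h1, norm_mul]
        exact mul_le_mul_of_nonneg_right (hm.bdd.choose_spec _) (norm_nonneg _))
  else 0

lemma T_eq_op {m : ℝ → ℂ} (hm : IsSymbol m) (f : RealL2) : T m f = op m f := by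
  rw [T, dif_pos hm]; rfl

lemma hat_T {m : ℝ → ℂ} (hm : IsSymbol m) (f : RealL2) :
    hat (T m f) =ᵐ[volume] fun η => m (2 * Real.pi * η) * hat f η := by
  rw [T_eq_op hm]; exact hat_op hm.herm (hm.inDomain f)

lemma T_T {m n : ℝ → ℂ} (hm : IsSymbol m) (hn : IsSymbol n) (f : RealL2) :
    T m (T n f) = T (fun ξ => m ξ * n ξ) f := by
  refine ext_hat ?_
  filter_upwards [hat_T hm (T n f), hat_T hn f, hat_T (hm.mul hn) f] with η h1 h2 h3
  rw [h1, h2, h3]; ring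

lemma T_comm {m n : ℝ → ℂ} (hm : IsSymbol m) (hn : IsSymbol n) (f : RealL2) :
    T m (T n f) = T n (T m f) := by
  rw [T_T hm hn, T_T hn hm]; simp only [mul_comm]

lemma T_sub {m n : ℝ → ℂ} (hm : IsSymbol m) (hn : IsSymbol n) (f : RealL2) :
    T (fun ξ => m ξ - n ξ) f = T m f - T n f := by
  refine ext_hat ?_
  filter_upwards [hat_T hm f, hat_T hn f, hat_T (hm.sub hn) f, coeFn_hat_sub (T m f) (T n f)]
    with η h1 h2 h3 h4
  rw [h3, h4, h1, h2, sub_mul]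

lemma T_const (c : ℝ) (f : RealL2) : T (fun _ => (c : ℂ)) f = c • f := by
  refine ext_hat ?_
  filter_upwards [hat_T (.const c) f, coeFn_hat_smul c f] with η h1 h2
  rw [h1, h2]

lemma T_one (f : RealL2) : T (fun _ => 1) f = f := by
  simpa using T_const 1 f

lemma T_neg {m : ℝ → ℂ} (hm : IsSymbol m) (f : RealL2) : T (fun ξ => -m ξ) f = -T m f := by
  have := T_T (.const (-1)) hm f
  rw [T_const] at this
  simpa using this.symm

lemma T_smul {m : ℝ → ℂ} (c : ℝ) (hm : IsSymbol m) (f : RealL2) :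
    T (fun ξ => (c : ℂ) * m ξ) f = c • T m f := by
  rw [← T_const c (T m f), T_T (.const c) hm]

lemma inner_eq_integral (f g : RealL2) :
    ⟪f, g⟫_ℝ = ∫ η, (conj (hat f η) * hat g η).re := by
  rw [← inner_hat, L2.inner_def]
  have := integral_re (𝕜 := ℂ) (L2.integrable_inner (𝕜 := ℂ) (hat f) (hat g))
  refine this.symm.trans (integral_congr_ae (Eventually.of_forall fun η => ?_))
  simp [RCLike.inner_apply, mul_comm]

lemma inner_T_left {m : ℝ → ℂ} (hm : IsSymbol m) (f g : RealL2) :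
    ⟪T m f, g⟫_ℝ = ⟪f, T (fun ξ => conj (m ξ)) g⟫_ℝ := by
  rw [inner_eq_integral, inner_eq_integral]
  refine integral_congr_ae ?_
  filter_upwards [hat_T hm f, hat_T hm.conjugate g] with η h1 h2
  rw [h1, h2, map_mul]
  congr 1; ring

lemma norm_sq_eq_integral (f : RealL2) : ‖f‖ ^ 2 = ∫ η, ‖hat f η‖ ^ 2 := by
  rw [← real_inner_self_eq_norm_sq, inner_eq_integral]
  refine integral_congr_ae (Eventually.of_forall fun η => ?_)
  simp only
  rw [mul_comm, Complex.mul_conj, Complex.ofReal_re, Complex.normSq_eq_norm_sq]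

lemma integrable_hat_sq (f : RealL2) : Integrable (fun η => ‖hat f η‖ ^ 2) :=
  (Lp.memLp (hat f)).norm.integrable_sq

lemma norm_T_le {m : ℝ → ℂ} (hm : IsSymbol m) {C : ℝ} (hC : ∀ ξ, ‖m ξ‖ ≤ C) (f : RealL2) :
    ‖T m f‖ ≤ C * ‖f‖ := by
  refine norm_le_of_hat_le ?_
  filter_upwards [hat_T hm f] with η h1
  rw [h1, norm_mul]
  exact mul_le_mul_of_nonneg_right (hC _) (norm_nonneg _)

lemma norm_T_eq {m : ℝ → ℂ} (hm : IsSymbol m) (h1 : ∀ ξ, ‖m ξ‖ = 1) (f : RealL2) :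
    ‖T m f‖ = ‖f‖ := by
  have : ‖T m f‖ ^ 2 = ‖f‖ ^ 2 := by
    rw [norm_sq_eq_integral, norm_sq_eq_integral]
    refine integral_congr_ae ?_
    filter_upwards [hat_T hm f] with η h
    rw [h, norm_mul, h1, one_mul]
  exact (pow_left_inj₀ (norm_nonneg _) (norm_nonneg _) two_ne_zero).1 this

/-- By Plancherel this is dominated convergence with majorant `(C + C')² |f̂|²`. It yields the
convergence of frequency cutoffs and the continuity and differentiability of the groups. -/
lemma T_tendsto {ι : Type*} {F : Filter ι} [F.IsCountablyGenerated] {m : ι → ℝ → ℂ} {n : ℝ → ℂ}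
    (hm : ∀ i, IsSymbol (m i)) (hn : IsSymbol n) {C : ℝ} (hC : ∀ᶠ i in F, ∀ ξ, ‖m i ξ‖ ≤ C)
    (h : ∀ ξ, Tendsto (fun i => m i ξ) F (𝓝 (n ξ))) (f : RealL2) :
    Tendsto (fun i => T (m i) f) F (𝓝 (T n f)) := by
  obtain ⟨C', hC'⟩ := hn.bdd
  rw [tendsto_iff_norm_sub_tendsto_zero]
  have key : Tendsto (fun i => ‖T (m i) f - T n f‖ ^ 2) F (𝓝 0) := by
    have e : ∀ i, ‖T (m i) f - T n f‖ ^ 2 =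
        ∫ η, ‖m i (2 * Real.pi * η) - n (2 * Real.pi * η)‖ ^ 2 * ‖hat f η‖ ^ 2 := fun i => by
      rw [← T_sub (hm i) hn, norm_sq_eq_integral]
      refine integral_congr_ae ?_
      filter_upwards [hat_T ((hm i).sub hn) f] with η h1
      rw [h1, norm_mul, mul_pow]
    simp_rw [e]
    have := tendsto_integral_filter_of_dominated_convergence (μ := (volume : Measure ℝ)) (l := F)
      (F := fun i η => ‖m i (2 * Real.pi * η) - n (2 * Real.pi * η)‖ ^ 2 * ‖hat f η‖ ^ 2)
      (f := fun _ => 0) (fun η => (C + C') ^ 2 * ‖hat f η‖ ^ 2)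
      (Eventually.of_forall fun i =>
        (((hm i).aesm.sub hn.aesm).norm.pow 2).mul (integrable_hat_sq f).aestronglyMeasurable)
      (by
        filter_upwards [hC] with i hi
        refine Eventually.of_forall fun η => ?_
        rw [Real.norm_of_nonneg (by positivity)]
        gcongr
        exact (norm_sub_le _ _).trans (add_le_add (hi _) (hC' _)))
      ((integrable_hat_sq f).const_mul _)
      (Eventually.of_forall fun η => by
        have h1 := ((h (2 * Real.pi * η)).sub_const (n (2 * Real.pi * η))).norm
        simpa using (h1.pow 2).mul_const (‖hat f η‖ ^ 2))
    simpa using this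
  have := key.sqrt
  simpa [Real.sqrt_sq (norm_nonneg _)] using this

/-! ### Ordinary differential equations with globally Lipschitz right hand side -/

lemma abs_integral_exp_mul_abs_le {c : ℝ} (hc : 0 < c) (t : ℝ) :
    |∫ s in (0 : ℝ)..t, Real.exp (c * |s|)| ≤ Real.exp (c * |t|) / c := by
  have pos : ∀ t : ℝ, 0 ≤ t → |∫ s in (0 : ℝ)..t, Real.exp (c * |s|)| ≤ Real.exp (c * |t|) / c := by
    intro t ht
    have e : ∫ s in (0 : ℝ)..t, Real.exp (c * |s|) = (Real.exp (c * t) - 1) / c := by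
      have : ∫ s in (0 : ℝ)..t, Real.exp (c * |s|) = ∫ s in (0 : ℝ)..t, Real.exp (c * s) := by
        refine intervalIntegral.integral_congr fun s hs => ?_
        rw [uIcc_of_le ht] at hs
        simp only [abs_of_nonneg hs.1]
      rw [this, intervalIntegral.integral_comp_mul_left (fun x => Real.exp x) hc.ne', integral_exp]
      simp [div_eq_inv_mul]
    rw [e, abs_of_nonneg ht, abs_of_nonneg
      (div_nonneg (sub_nonneg.2 (Real.one_le_exp (by positivity))) hc.le)]
    gcongr
    linarith
  rcases le_total 0 t with ht | ht
  · exact pos t ht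
  · have h := pos (-t) (by linarith)
    rw [abs_neg t] at h
    have e : ∫ s in (0 : ℝ)..t, Real.exp (c * |s|) = -∫ s in (0 : ℝ)..(-t), Real.exp (c * |s|) := by
      have := intervalIntegral.integral_comp_neg (a := t) (b := 0) (fun s => Real.exp (c * |s|))
      simp only [abs_neg, neg_zero] at this
      rw [← this, intervalIntegral.integral_symm]
    rwa [e, abs_neg]

lemma continuous_comp_of_lipschitz {E : Type*} [PseudoEMetricSpace E]
    {f : ℝ → E → E} {K : ℝ≥0} (hL : ∀ t, LipschitzWith K (f t))
    (hc : ∀ x, Continuous fun t => f t x) {y : ℝ → E} (hy : Continuous y) :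
    Continuous fun t => f t (y t) := by
  have := continuous_prod_of_continuous_lipschitzWith' (fun q : ℝ × E => f q.1 q.2) K hL hc
  exact this.comp (continuous_id.prodMk hy)

section ODE

variable {E : Type*} [NormedAddCommGroup E] [NormedSpace ℝ E]

/-- Global existence for an ordinary differential equation whose right hand side is globally
Lipschitz and vanishes at the origin. -/
lemma exists_global_solution [CompleteSpace E] {f : ℝ → E → E} {K : ℝ≥0}
    (hL : ∀ t, LipschitzWith K (f t)) (hc : ∀ x, Continuous fun t => f t x)
    (h0 : ∀ t, f t 0 = 0) (x₀ : E) :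
    ∃ y : ℝ → E, y 0 = x₀ ∧ ∀ t, HasDerivAt y (f t (y t)) t := by
  -- Picard iteration in the weighted sup norm `sup e^{-c|t|} ‖·‖`: integrating the weight costs a
  -- factor `1/c`, so the contraction constant is `K/c ≤ 1/2` on the whole line.
  set c : ℝ := 2 * K + 1 with hcdef
  have hcpos : 0 < c := by positivity
  have hKc : (K : ℝ) / c ≤ 1 / 2 := by
    rw [div_le_iff₀ hcpos, hcdef]; linarith
  let Y : (ℝ →ᵇ E) → ℝ → E := fun x s => Real.exp (c * |s|) • x s
  have hYc : ∀ x, Continuous (Y x) := fun x => by fun_prop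
  let φ : (ℝ →ᵇ E) → ℝ → E := fun x s => f s (Y x s)
  have hφc : ∀ x, Continuous (φ x) := fun x => continuous_comp_of_lipschitz hL hc (hYc x)
  let G : (ℝ →ᵇ E) → ℝ → E := fun x t => x₀ + ∫ s in (0 : ℝ)..t, φ x s
  have hGd : ∀ x t, HasDerivAt (G x) (φ x t) t := fun x t =>
    ((hφc x).integral_hasStrictDerivAt 0 t).hasDerivAt.const_add x₀
  have hGc : ∀ x, Continuous (G x) := fun x =>
    continuous_iff_continuousAt.2 fun t => (hGd x t).continuousAt
  have hexp : ∀ t, Real.exp (-(c * |t|)) * (Real.exp (c * |t|) / c) = 1 / c := fun t => by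
    rw [← mul_div_assoc, ← Real.exp_add]; simp
  have int_le : ∀ (h : ℝ → E) (M : ℝ), 0 ≤ M → (∀ s, ‖h s‖ ≤ (K * M) * Real.exp (c * |s|)) →
      ∀ t, ‖Real.exp (-(c * |t|)) • ∫ s in (0 : ℝ)..t, h s‖ ≤ 1 / 2 * M := by
    intro h M hM hh t
    have h1 := intervalIntegral.norm_integral_le_abs_of_norm_le (μ := volume) (a := 0) (b := t)
      (f := h) (g := fun s => (K * M) * Real.exp (c * |s|)) (Eventually.of_forall hh)
      (by apply Continuous.intervalIntegrable; fun_prop)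
    rw [intervalIntegral.integral_const_mul, abs_mul, abs_of_nonneg (by positivity)] at h1
    rw [norm_smul, Real.norm_of_nonneg (Real.exp_pos _).le]
    calc _ ≤ Real.exp (-(c * |t|)) * ((K * M) * (Real.exp (c * |t|) / c)) := by
          gcongr
          exact h1.trans (mul_le_mul_of_nonneg_left (abs_integral_exp_mul_abs_le hcpos t)
            (by positivity))
      _ = (K / c) * M * (Real.exp (-(c * |t|)) * (Real.exp (c * |t|) / c) * c) := by
          field_simp
      _ ≤ 1 / 2 * M := by
          rw [hexp, one_div_mul_cancel hcpos.ne', mul_one]; gcongr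
  have hYn : ∀ x x' s, ‖Y x s - Y x' s‖ ≤ Real.exp (c * |s|) * ‖x - x'‖ := by
    intro x x' s
    rw [← smul_sub, norm_smul, Real.norm_of_nonneg (Real.exp_pos _).le]
    gcongr
    exact (x - x').norm_coe_le_norm s
  have hφn : ∀ x x' s, ‖φ x s - φ x' s‖ ≤ (K * ‖x - x'‖) * Real.exp (c * |s|) := by
    intro x x' s
    have := (hL s).norm_sub_le (Y x s) (Y x' s)
    refine this.trans ?_
    rw [mul_assoc, mul_comm ‖x - x'‖]
    gcongr
    exact hYn x x' s
  have hφ0 : ∀ s, φ 0 s = 0 := fun s => by simp [φ, Y, h0]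
  -- Because `f` vanishes at the origin, the integrand grows no faster than the weight, and the
  -- rescaled iterate is bounded.
  have hbd : ∀ x t, ‖Real.exp (-(c * |t|)) • G x t‖ ≤ ‖x₀‖ + 1 / 2 * ‖x‖ := by
    intro x t
    rw [smul_add]
    refine (norm_add_le _ _).trans (add_le_add ?_ ?_)
    · rw [norm_smul, Real.norm_of_nonneg (Real.exp_pos _).le]
      exact mul_le_of_le_one_left (norm_nonneg _) (Real.exp_le_one_iff.2 (by
        have := abs_nonneg t; nlinarith))
    · refine int_le (φ x) ‖x‖ (norm_nonneg _) (fun s => ?_) t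
      simpa [hφ0] using hφn x 0 s
  let Ψ : (ℝ →ᵇ E) → (ℝ →ᵇ E) := fun x =>
    BoundedContinuousFunction.ofNormedAddCommGroup (fun t => Real.exp (-(c * |t|)) • G x t)
      (by have := hGc x; fun_prop) _ (hbd x)
  have hΨ : ContractingWith (1 / 2 : ℝ≥0) Ψ := by
    refine ⟨by norm_num, LipschitzWith.of_dist_le_mul fun x x' => ?_⟩
    rw [BoundedContinuousFunction.dist_le (by positivity)]
    intro t
    change dist (Real.exp (-(c * |t|)) • G x t) (Real.exp (-(c * |t|)) • G x' t) ≤ _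
    rw [dist_eq_norm, ← smul_sub, dist_eq_norm]
    have e : G x t - G x' t = ∫ s in (0 : ℝ)..t, (φ x s - φ x' s) := by
      rw [intervalIntegral.integral_sub ((hφc x).intervalIntegrable _ _)
        ((hφc x').intervalIntegrable _ _)]
      simp [G]
    rw [e]
    simpa using int_le _ ‖x - x'‖ (norm_nonneg _) (hφn x x') t
  obtain ⟨x, hx⟩ : ∃ x, Ψ x = x := ⟨_, hΨ.fixedPoint_isFixedPt⟩
  have hYG : Y x = G x := by
    funext t
    have : Real.exp (-(c * |t|)) • G x t = x t := congrArg (fun z : ℝ →ᵇ E => z t) hx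
    simp only [Y]
    rw [← this, smul_smul, ← Real.exp_add]
    simp
  refine ⟨G x, by simp [G], fun t => ?_⟩
  have := hGd x t
  simp only [φ, hYG] at this
  exact this

lemma exists_global_solution_at [CompleteSpace E] {f : ℝ → E → E} {K : ℝ≥0}
    (hL : ∀ t, LipschitzWith K (f t)) (hc : ∀ x, Continuous fun t => f t x)
    (h0 : ∀ t, f t 0 = 0) (t₀ : ℝ) (x₀ : E) :
    ∃ y : ℝ → E, y t₀ = x₀ ∧ ∀ t, HasDerivAt y (f t (y t)) t := by
  obtain ⟨y, hy0, hy⟩ := exists_global_solution (f := fun t x => f (t + t₀) x)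
    (fun t => hL _) (fun x => (hc x).comp (continuous_add_const t₀)) (fun t => h0 _) x₀
  refine ⟨fun t => y (t - t₀), by simpa using hy0, fun t => ?_⟩
  simpa using (hy (t - t₀)).comp_sub_const t t₀

/-- Gronwall's inequality in both time directions. -/
lemma dist_le_gronwallBound_abs {f : ℝ → E → E} {K : ℝ≥0} (hL : ∀ t, LipschitzWith K (f t))
    {t₀ r ε : ℝ} {y z y' : ℝ → E} (hz : ∀ t, HasDerivAt z (f t (z t)) t)
    (hy : ∀ t, HasDerivAt y (y' t) t) (h0 : z t₀ = y t₀)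
    (hε : ∀ t, |t - t₀| ≤ r → dist (y' t) (f t (y t)) ≤ ε) (t : ℝ) (ht : |t - t₀| ≤ r) :
    dist (z t) (y t) ≤ gronwallBound 0 K ε |t - t₀| := by
  have cz : Continuous z := continuous_iff_continuousAt.2 fun t => (hz t).continuousAt
  have cy : Continuous y := continuous_iff_continuousAt.2 fun t => (hy t).continuousAt
  have hr : 0 ≤ r := (abs_nonneg _).trans ht
  rcases le_total t₀ t with h | h
  · have := dist_le_of_approx_trajectories_ODE (v := f) (f := z) (g := y) (f' := fun t => f t (z t))
      (g' := y') (εf := 0) (εg := ε) (δ := 0) (a := t₀) (b := t₀ + r) hL cz.continuousOn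
      (fun t _ => (hz t).hasDerivWithinAt) (fun t _ => by simp) cy.continuousOn
      (fun t _ => (hy t).hasDerivWithinAt)
      (fun t ht => hε t (by rw [abs_of_nonneg] <;> linarith [ht.1, ht.2])) (by simp [h0]) t
      ⟨h, by rw [abs_of_nonneg (by linarith)] at ht; linarith⟩
    rw [abs_of_nonneg (by linarith)]
    simpa using this
  -- For times before `t₀`, reverse time: the field `-f(-s, ·)` has the same Lipschitz constant.
  · have := dist_le_of_approx_trajectories_ODE (K := K) (v := fun s x => -f (-s) x)
      (f := fun s => z (-s))
      (g := fun s => y (-s)) (f' := fun t => -f (-t) (z (-t)))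
      (g' := fun s => -y' (-s)) (εf := 0) (εg := ε) (δ := 0) (a := -t₀) (b := -t₀ + r)
      (fun s => by
        refine LipschitzWith.of_dist_le_mul fun a b => ?_
        rw [dist_neg_neg]; exact (hL _).dist_le_mul a b)
      (cz.comp continuous_neg).continuousOn
      (fun s _ => by
        simpa [Function.comp_def] using ((hz (-s)).scomp s (hasDerivAt_neg s)).hasDerivWithinAt)
      (fun t _ => by simp) (cy.comp continuous_neg).continuousOn
      (fun s _ => by
        simpa [Function.comp_def] using ((hy (-s)).scomp s (hasDerivAt_neg s)).hasDerivWithinAt)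
      (fun s hs => by
        rw [dist_neg_neg]
        refine hε (-s) ?_
        rw [abs_le]; constructor <;> linarith [hs.1, hs.2]) (by simp [h0]) (-t)
      ⟨by linarith, by rw [abs_of_nonpos (by linarith)] at ht; linarith⟩
    rw [abs_of_nonpos (by linarith)]
    simp only [neg_neg, zero_add] at this
    convert this using 2
    ring

/-- Strong convergence of uniformly bounded operators is uniform along a continuous curve. -/
lemma eventually_forall_dist_le_of_strong {P : ℕ → E →L[ℝ] E} (hP : ∀ n, ‖P n‖ ≤ 1)
    (hs : ∀ x, Tendsto (fun n => P n x) atTop (𝓝 x)) {y : ℝ → E} (hy : Continuous y) {s : Set ℝ}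
    (hcs : IsCompact s) {ε : ℝ} (hε : 0 < ε) :
    ∀ᶠ n in atTop, ∀ t ∈ s, ‖P n (y t) - y t‖ ≤ ε := by
  have hbound : ∀ n x, ‖P n x‖ ≤ ‖x‖ := fun n x =>
    ((P n).le_opNorm x).trans (mul_le_of_le_one_left (norm_nonneg _) (hP n))
  -- Since `‖P n‖ ≤ 1`, the curves `P n ∘ y` inherit the modulus of continuity of `y`, which makes
  -- pointwise convergence locally uniform.
  have loc : TendstoLocallyUniformlyOn (fun n t => P n (y t)) y atTop s := by
    rw [Metric.tendstoLocallyUniformlyOn_iff]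
    intro δ hδ t _
    refine ⟨_, mem_nhdsWithin_of_mem_nhds (Metric.continuous_iff'.1 hy t (δ / 4) (by positivity)),
      ?_⟩
    filter_upwards [Metric.tendsto_nhds.1 (hs (y t)) (δ / 4) (by positivity)] with n hn u hu
    have hu' : dist (y u) (y t) < δ / 4 := hu
    have h1 : dist (P n (y t)) (P n (y u)) ≤ dist (y t) (y u) := by
      rw [dist_eq_norm, ← map_sub, dist_eq_norm]; exact hbound n _
    calc dist (y u) (P n (y u)) ≤ dist (y u) (y t) + dist (y t) (P n (y t))
          + dist (P n (y t)) (P n (y u)) := dist_triangle4 _ _ _ _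
      _ < δ := by rw [dist_comm (y t) (P n (y t))]; rw [dist_comm (y t) (y u)] at h1; linarith
  have := (tendstoLocallyUniformlyOn_iff_tendstoUniformlyOn_of_compact hcs).1 loc
  filter_upwards [Metric.tendstoUniformlyOn_iff.1 this ε hε] with n hn t ht
  rw [← dist_eq_norm, dist_comm]
  exact (hn t ht).le

end ODE

/-! ### Weak limits in Hilbert spaces -/

section Weak

variable {H : Type*} [NormedAddCommGroup H] [InnerProductSpace ℝ H] [CompleteSpace H]

/-- Banach–Alaoglu through the Riesz isomorphism; an ultrafilter replaces the extraction of
subsequences. -/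
lemma exists_weak_limit {ι : Type*} (G : Ultrafilter ι) {V : ι → H} {R : ℝ}
    (hV : ∀ᶠ i in G, ‖V i‖ ≤ R) :
    ∃ W : H, ∀ ψ, Tendsto (fun i => ⟪V i, ψ⟫_ℝ) G (𝓝 ⟪W, ψ⟫_ℝ) := by
  let J : H → WeakDual ℝ H := fun v => StrongDual.toWeakDual (InnerProductSpace.toDual ℝ H v)
  have hc := WeakDual.isCompact_closedBall (𝕜 := ℝ) (E := H) 0 R
  obtain ⟨x, -, hx⟩ := hc.ultrafilter_le_nhds (G.map fun i => J (V i)) (by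
    rw [le_principal_iff]
    change ∀ᶠ i in G, J (V i) ∈ _
    filter_upwards [hV] with i hi
    simpa [J] using hi)
  refine ⟨(InnerProductSpace.toDual ℝ H).symm (WeakDual.toStrongDual x), fun ψ => ?_⟩
  have hx' : Tendsto (fun i => J (V i)) G (𝓝 x) := hx
  have h2 := ((WeakDual.eval_continuous ψ).tendsto x).comp hx'
  rw [InnerProductSpace.toDual_symm_apply]
  exact h2

end Weak

/-- A uniform bound carries convergence from a dense set of test vectors to all of them. With `K =
opK`, self-adjoint of dense range, convergence of `opK (V i)` becomes weak convergence of `V i`. -/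
lemma weak_limit_of_dense {H : Type*} [NormedAddCommGroup H] [InnerProductSpace ℝ H] {ι : Type*}
    {F : Filter ι} {V : ι → H} {W : H} {R : ℝ} {K : H → H}
    (hd : DenseRange K) (hV : ∀ᶠ i in F, ‖V i‖ ≤ R)
    (h : ∀ φ, Tendsto (fun i => ⟪V i, K φ⟫_ℝ) F (𝓝 ⟪W, K φ⟫_ℝ)) (ψ : H) :
    Tendsto (fun i => ⟪V i, ψ⟫_ℝ) F (𝓝 ⟪W, ψ⟫_ℝ) := by
  rw [Metric.tendsto_nhds]
  intro ε hε
  set M := |R| + ‖W‖ + 1 with hM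
  have hMpos : 0 < M := by positivity
  obtain ⟨φ, hφ⟩ := hd.exists_dist_lt ψ (show 0 < ε / (2 * M) by positivity)
  filter_upwards [hV, Metric.tendsto_nhds.1 (h φ) (ε / 2) (by positivity)] with i h1 h2
  rw [Real.dist_eq] at h2 ⊢
  have e : ⟪V i, ψ⟫_ℝ - ⟪W, ψ⟫_ℝ = ⟪V i - W, ψ - K φ⟫_ℝ + (⟪V i, K φ⟫_ℝ - ⟪W, K φ⟫_ℝ) := by
    rw [inner_sub_left, inner_sub_right, inner_sub_right]; ring
  rw [e]
  have h3 : |⟪V i - W, ψ - K φ⟫_ℝ| ≤ M * (ε / (2 * M)) := by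
    refine (abs_real_inner_le_norm _ _).trans (mul_le_mul ?_ ?_ (norm_nonneg _) hMpos.le)
    · have := norm_sub_le (V i) W
      have := le_abs_self R
      linarith
    · rw [← dist_eq_norm]; exact hφ.le
  have h4 : M * (ε / (2 * M)) = ε / 2 := by field_simp
  have := abs_add_le ⟪V i - W, ψ - K φ⟫_ℝ (⟪V i, K φ⟫_ℝ - ⟪W, K φ⟫_ℝ)
  linarith

/-! ### The nonlinearity, truncated at height `R` -/

/-- Projection of the real line to `[-R, R]`. -/
def clamp (R y : ℝ) : ℝ := max (-R) (min R y)

lemma clamp_of_abs_le {R y : ℝ} (h : |y| ≤ R) : clamp R y = y := by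
  rw [abs_le] at h
  rw [clamp, min_eq_right h.2, max_eq_right h.1]

lemma abs_clamp_le {R : ℝ} (hR : 0 ≤ R) (y : ℝ) : |clamp R y| ≤ R :=
  abs_le.2 ⟨le_max_left _ _, max_le (by linarith) (min_le_left _ _)⟩

lemma abs_clamp_sub_le (R x y : ℝ) : |clamp R x - clamp R y| ≤ |x - y| := by
  have h1 : |clamp R x - clamp R y| ≤ |min R x - min R y| := by
    have := abs_max_sub_max_le_max (-R) (min R x) (-R) (min R y)
    simpa [clamp] using this
  have h2 := abs_min_sub_min_le_max R x R y
  exact h1.trans (by simpa using h2)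

lemma abs_rpow_sub_rpow_le {p R : ℝ} (hp : 1 < p) {x y : ℝ} (hx : x ∈ Icc 0 R) (hy : y ∈ Icc 0 R) :
    |x ^ p - y ^ p| ≤ p * R ^ (p - 1) * |x - y| := by
  have := Convex.norm_image_sub_le_of_norm_hasDerivWithin_le (f := fun x : ℝ => x ^ p)
    (f' := fun x => p * x ^ (p - 1)) (s := Icc 0 R) (C := p * R ^ (p - 1))
    (fun z _ => (Real.hasDerivAt_rpow_const (Or.inr hp.le)).hasDerivWithinAt)
    (fun z hz => by
      rw [Real.norm_of_nonneg (mul_nonneg (by linarith) (Real.rpow_nonneg hz.1 _))]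
      exact mul_le_mul_of_nonneg_left (Real.rpow_le_rpow hz.1 hz.2 (by linarith)) (by linarith))
    (convex_Icc 0 R) hy hx
  simpa using this

lemma g_of_nonneg {p y : ℝ} (hp : 1 < p) (hy : 0 ≤ y) : g p y = -y ^ p := by
  rw [g, abs_of_nonneg hy]
  rcases hy.eq_or_lt with rfl | h
  · rw [Real.zero_rpow (by linarith), Real.zero_rpow (by linarith)]; simp
  · nth_rewrite 2 [← Real.rpow_one y]
    rw [← Real.rpow_add h]; simp

lemma g_neg (p y : ℝ) : g p (-y) = -g p y := by
  simp [g]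

/-- For arguments of equal sign this is the mean value bound on powers. For opposite signs compare
each with `0` and add, since then `|x - y| = |x| + |y|`. -/
lemma abs_g_sub_le {p R : ℝ} (hp : 1 < p) {x y : ℝ} (hx : |x| ≤ R) (hy : |y| ≤ R) :
    |g p x - g p y| ≤ p * R ^ (p - 1) * |x - y| := by
  have hR : 0 ≤ R := (abs_nonneg x).trans hx
  have pos : ∀ {x y : ℝ}, 0 ≤ x → 0 ≤ y → x ≤ R → y ≤ R →
      |g p x - g p y| ≤ p * R ^ (p - 1) * |x - y| := by
    intro x y hx hy hx' hy'
    rw [g_of_nonneg hp hx, g_of_nonneg hp hy, abs_sub_comm]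
    have := abs_rpow_sub_rpow_le hp ⟨hx, hx'⟩ ⟨hy, hy'⟩
    convert this using 2; ring
  have mix : ∀ {x y : ℝ}, 0 ≤ x → 0 ≤ y → x ≤ R → y ≤ R →
      |g p x - g p (-y)| ≤ p * R ^ (p - 1) * |x - -y| := by
    intro x y hx hy hx' hy'
    have h1 := pos hx le_rfl hx' hR
    have h2 := pos hy le_rfl hy' hR
    have g0 : g p 0 = 0 := by simp [g]
    rw [g0, sub_zero, sub_zero, abs_of_nonneg hx] at h1
    rw [g0, sub_zero, sub_zero, abs_of_nonneg hy] at h2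
    rw [g_neg, sub_neg_eq_add, sub_neg_eq_add, abs_of_nonneg (add_nonneg hx hy), mul_add]
    exact (abs_add_le _ _).trans (add_le_add h1 h2)
  rw [abs_le] at hx hy
  rcases le_total 0 x with h1 | h1 <;> rcases le_total 0 y with h2 | h2
  · exact pos h1 h2 hx.2 hy.2
  · simpa using mix h1 (neg_nonneg.2 h2) hx.2 (by linarith)
  · rw [abs_sub_comm, abs_sub_comm x]
    simpa using mix h2 (neg_nonneg.2 h1) hy.2 (by linarith)
  · have := pos (neg_nonneg.2 h1) (neg_nonneg.2 h2) (by linarith) (by linarith)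
    rw [g_neg, g_neg, neg_sub_neg, neg_sub_neg, abs_sub_comm, abs_sub_comm y] at this
    exact this

/-- The nonlinearity truncated at height `R`. -/
def gc (p R y : ℝ) : ℝ := g p (clamp R y)

lemma gc_of_abs_le {p R y : ℝ} (h : |y| ≤ R) : gc p R y = g p y := by
  rw [gc, clamp_of_abs_le h]

/-- The Lipschitz constant of the truncated nonlinearity. -/
def lipConst (p R : ℝ) : ℝ≥0 := (p * R ^ (p - 1)).toNNReal

lemma coe_lipConst {p R : ℝ} (hp : 1 < p) (hR : 0 ≤ R) : (lipConst p R : ℝ) = p * R ^ (p - 1) :=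
  Real.coe_toNNReal _ (mul_nonneg (by linarith) (Real.rpow_nonneg hR _))

lemma lipschitz_gc {p R : ℝ} (hp : 1 < p) (hR : 0 ≤ R) : LipschitzWith (lipConst p R) (gc p R) := by
  refine LipschitzWith.of_dist_le_mul fun x y => ?_
  rw [Real.dist_eq, Real.dist_eq, coe_lipConst hp hR]
  refine (abs_g_sub_le hp (abs_clamp_le hR x) (abs_clamp_le hR y)).trans ?_
  exact mul_le_mul_of_nonneg_left (abs_clamp_sub_le R x y)
    (mul_nonneg (by linarith) (Real.rpow_nonneg hR _))

lemma gc_zero (p : ℝ) {R : ℝ} (hR : 0 ≤ R) : gc p R 0 = 0 := by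
  rw [gc_of_abs_le (by simpa)]; simp [g]

open Classical in
/-- The superposition operator `u ↦ g(u)` with truncated nonlinearity. -/
def nl (p R : ℝ) (u : RealL2) : RealL2 :=
  if h : 1 < p ∧ 0 ≤ R then (lipschitz_gc h.1 h.2).compLp (gc_zero p h.2) u else 0

lemma coeFn_nl {p R : ℝ} (hp : 1 < p) (hR : 0 ≤ R) (u : RealL2) :
    nl p R u =ᵐ[volume] fun x => gc p R (u x) := by
  rw [nl, dif_pos ⟨hp, hR⟩]; exact LipschitzWith.coeFn_compLp _ _ _

lemma lipschitz_nl {p R : ℝ} (hp : 1 < p) (hR : 0 ≤ R) : LipschitzWith (lipConst p R) (nl p R) := by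
  have : nl p R = (lipschitz_gc hp hR).compLp (gc_zero p hR) := by
    funext u; rw [nl, dif_pos ⟨hp, hR⟩]
  rw [this]; exact LipschitzWith.lipschitzWith_compLp _ _

lemma nl_zero {p R : ℝ} (hp : 1 < p) (hR : 0 ≤ R) : nl p R 0 = 0 := by
  rw [nl, dif_pos ⟨hp, hR⟩]; exact LipschitzWith.compLp_zero _ _

lemma coeFn_nl_of_bounded {p R : ℝ} (hp : 1 < p) (hR : 0 ≤ R) {u : RealL2}
    (hu : ∀ᵐ x, |u x| ≤ R) : nl p R u =ᵐ[volume] fun x => g p (u x) := by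
  filter_upwards [coeFn_nl hp hR u, hu] with x h1 h2
  rw [h1, gc_of_abs_le h2]

lemma nl_eq_nl {p R R' : ℝ} (hp : 1 < p) (hR : 0 ≤ R) (hR' : R ≤ R') {u : RealL2}
    (hu : ∀ᵐ x, |u x| ≤ R) : nl p R u = nl p R' u := by
  ext1
  exact (coeFn_nl_of_bounded hp hR hu).trans
    (coeFn_nl_of_bounded hp (hR.trans hR') (hu.mono fun x hx => hx.trans hR')).symm

/-- The primitive of the truncated nonlinearity. -/
def primitive (p R y : ℝ) : ℝ := ∫ s in (0 : ℝ)..y, gc p R s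

section Primitive

variable {p R : ℝ}

lemma hasDerivAt_primitive (hp : 1 < p) (hR : 0 ≤ R) (y : ℝ) :
    HasDerivAt (primitive p R) (gc p R y) y :=
  ((lipschitz_gc hp hR).continuous.integral_hasStrictDerivAt 0 y).hasDerivAt

lemma primitive_zero : primitive p R 0 = 0 := by simp [primitive]

lemma abs_primitive_taylor_le (hp : 1 < p) (hR : 0 ≤ R) (y h : ℝ) :
    |primitive p R (y + h) - primitive p R y - gc p R y * h| ≤ lipConst p R * h ^ 2 := by
  have hc := (lipschitz_gc hp hR).continuous
  have e : primitive p R (y + h) - primitive p R y - gc p R y * h =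
      ∫ s in y..(y + h), (gc p R s - gc p R y) := by
    rw [intervalIntegral.integral_sub (hc.intervalIntegrable _ _)
      (by simp), primitive, primitive,
      intervalIntegral.integral_interval_sub_left (hc.intervalIntegrable _ _)
      (hc.intervalIntegrable _ _)]
    simp [mul_comm]
  rw [e, ← Real.norm_eq_abs]
  have := intervalIntegral.norm_integral_le_of_norm_le_const (a := y) (b := y + h)
    (f := fun s => gc p R s - gc p R y) (C := lipConst p R * |h|) (fun s hs => by
      refine ((lipschitz_gc hp hR).norm_sub_le s y).trans ?_
      refine mul_le_mul_of_nonneg_left ?_ (NNReal.coe_nonneg _)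
      rw [Real.norm_eq_abs]
      have := abs_sub_left_of_mem_uIcc (uIoc_subset_uIcc hs)
      simpa using this)
  refine this.trans (le_of_eq ?_)
  rw [add_sub_cancel_left, mul_assoc, ← abs_mul, ← sq, abs_of_nonneg (sq_nonneg h)]

lemma abs_primitive_le (hp : 1 < p) (hR : 0 ≤ R) (y : ℝ) :
    |primitive p R y| ≤ lipConst p R * y ^ 2 := by
  simpa [primitive_zero, gc_zero p hR] using abs_primitive_taylor_le hp hR 0 y

lemma primitive_of_abs_le (hp : 1 < p) {y : ℝ} (hy : |y| ≤ R) :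
    primitive p R y = -(1 / (p + 1) * |y| ^ (p + 1)) := by
  have hd : ∀ s, HasDerivAt (fun s : ℝ => -(1 / (p + 1) * |s| ^ (p + 1))) (g p s) s := by
    intro s
    have := ((hasDerivAt_abs_rpow s (show 1 < p + 1 by linarith)).const_mul (1 / (p + 1))).neg
    have e : -(1 / (p + 1) * ((p + 1) * |s| ^ (p + 1 - 2) * s)) = g p s := by
      have : p + 1 ≠ 0 := by linarith
      rw [show p + 1 - 2 = p - 1 by ring, g]
      field_simp
    rw [e] at this
    exact this
  have hgc : ContinuousOn (g p) (uIcc 0 y) := by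
    have : Continuous (g p) := by
      unfold g
      have : Continuous fun y : ℝ => |y| ^ (p - 1) :=
        continuous_abs.rpow_const fun _ => Or.inr (by linarith)
      fun_prop
    exact this.continuousOn
  have e : primitive p R y = ∫ s in (0 : ℝ)..y, g p s := by
    refine intervalIntegral.integral_congr fun s hs => gc_of_abs_le ?_
    have := abs_sub_left_of_mem_uIcc hs
    simp only [sub_zero] at this
    exact this.trans hy
  rw [e, intervalIntegral.integral_eq_sub_of_hasDerivAt (fun s _ => hd s)
    hgc.intervalIntegrable]
  simp [Real.zero_rpow (show p + 1 ≠ 0 by linarith)]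

/-- The potential energy `∫ G(u)`, with `G` the primitive of the truncated nonlinearity. -/
def potential (p R : ℝ) (u : RealL2) : ℝ := ∫ x, primitive p R (u x)

lemma continuous_primitive (hp : 1 < p) (hR : 0 ≤ R) : Continuous (primitive p R) :=
  continuous_iff_continuousAt.2 fun y => (hasDerivAt_primitive hp hR y).continuousAt

lemma integrable_primitive (hp : 1 < p) (hR : 0 ≤ R) {u : ℝ → ℝ} (hu : MemLp u 2) :
    Integrable fun x => primitive p R (u x) :=
  (hu.integrable_sq.const_mul (lipConst p R : ℝ)).mono'
    ((continuous_primitive hp hR).comp_aestronglyMeasurable hu.1)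
    (Eventually.of_forall fun _ => abs_primitive_le hp hR _)

lemma real_inner_eq_integral (u v : RealL2) : ⟪u, v⟫_ℝ = ∫ x, u x * v x := by
  rw [L2.inner_def]
  exact integral_congr_ae (Eventually.of_forall fun x => by simp [mul_comm])

lemma real_inner_integrable (u v : RealL2) : Integrable fun x => u x * v x :=
  (L2.integrable_inner (𝕜 := ℝ) u v).congr (Eventually.of_forall fun x => by simp [mul_comm])

/-- The truncated nonlinearity is globally Lipschitz, so the pointwise Taylor remainder is quadratic
and integrates. The potential is thus differentiable on `L²` itself, with no Sobolev regularity. -/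
lemma abs_potential_taylor_le (hp : 1 < p) (hR : 0 ≤ R) (u h : RealL2) :
    |potential p R (u + h) - potential p R u - ⟪nl p R u, h⟫_ℝ| ≤ lipConst p R * ‖h‖ ^ 2 := by
  have hsq : ‖h‖ ^ 2 = ∫ x, (h x) ^ 2 := by
    rw [← real_inner_self_eq_norm_sq, real_inner_eq_integral]; simp_rw [sq]
  have i1 := integrable_primitive hp hR (Lp.memLp (u + h))
  have i2 := integrable_primitive hp hR (Lp.memLp u)
  have i3 := real_inner_integrable (nl p R u) h
  rw [potential, potential, real_inner_eq_integral, ← integral_sub i1 i2,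
    ← integral_sub (by exact i1.sub i2) i3, hsq, ← integral_const_mul, ← Real.norm_eq_abs]
  refine norm_integral_le_of_norm_le ((Lp.memLp h).integrable_sq.const_mul _) ?_
  filter_upwards [Lp.coeFn_add u h, coeFn_nl hp hR u] with x h1 h2
  rw [h1, h2]
  exact abs_primitive_taylor_le hp hR (u x) (h x)

lemma hasFDerivAt_potential (hp : 1 < p) (hR : 0 ≤ R) (u : RealL2) :
    HasFDerivAt (potential p R) (innerSL ℝ (nl p R u)) u := by
  rw [hasFDerivAt_iff_isLittleO_nhds_zero]
  refine (Asymptotics.IsBigO.of_bound (lipConst p R : ℝ) (g := fun h : RealL2 => ‖h‖ ^ 2)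
    (Eventually.of_forall fun h => ?_)).trans_isLittleO ?_
  · rw [innerSL_apply_apply, norm_pow, norm_norm]
    exact abs_potential_taylor_le hp hR u h
  · exact (Asymptotics.isLittleO_norm_pow_id one_lt_two)

lemma continuous_potential (hp : 1 < p) (hR : 0 ≤ R) : Continuous (potential p R) :=
  continuous_iff_continuousAt.2 fun u => (hasFDerivAt_potential hp hR u).continuousAt

lemma potential_of_bounded (hp : 1 < p) {u : RealL2} (hu : ∀ᵐ x, |u x| ≤ R) :
    potential p R u = -(1 / (p + 1) * Q p u) := by
  rw [potential, Q, ← integral_const_mul, ← integral_neg]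
  refine integral_congr_ae ?_
  filter_upwards [hu] with x hx
  exact primitive_of_abs_le hp hx

lemma coeFn_testL2 (ψ : 𝓢(ℝ, ℝ)) : testL2 ψ =ᵐ[volume] ψ := SchwartzMap.coeFn_toLp ψ 2 volume

/-- The integrand is the derivative of `primitive p R ∘ ψ`, which is integrable because it is
dominated by a multiple of `ψ²`. -/
lemma inner_nl_testDeriv (hp : 1 < p) (hR : 0 ≤ R) (ψ : 𝓢(ℝ, ℝ)) :
    ⟪nl p R (testL2 ψ), testDeriv ψ⟫_ℝ = 0 := by
  have e : ∀ᵐ x, nl p R (testL2 ψ) x * testDeriv ψ x = gc p R (ψ x) * deriv ψ x := by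
    filter_upwards [coeFn_nl hp hR (testL2 ψ), coeFn_testL2 ψ,
      SchwartzMap.coeFn_toLp (SchwartzMap.derivCLM ℝ ℝ ψ) 2 volume] with x h1 h2 h3
    rw [h1, h2, testDeriv, h3, SchwartzMap.derivCLM_apply]
  rw [real_inner_eq_integral, integral_congr_ae e]
  exact integral_eq_zero_of_hasDerivAt_of_integrable
    (fun x => (hasDerivAt_primitive hp hR (ψ x)).comp x (ψ.hasDerivAt x))
    ((real_inner_integrable _ _).congr e) (integrable_primitive hp hR (ψ.memLp 2))

end Primitive

/-! ### Construction of symbols -/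

namespace IsSymbol

lemma ofReal {m : ℝ → ℝ} (hm : Measurable m) (he : ∀ ξ, m (-ξ) = m ξ) {C : ℝ}
    (hC : ∀ ξ, |m ξ| ≤ C) : IsSymbol fun ξ => (m ξ : ℂ) :=
  ⟨Complex.measurable_ofReal.comp hm, fun ξ => by simp [he], C, fun ξ => by simpa using hC ξ⟩

lemma ofReal_I {m : ℝ → ℝ} (hm : Measurable m) (ho : ∀ ξ, m (-ξ) = -m ξ) {C : ℝ}
    (hC : ∀ ξ, |m ξ| ≤ C) : IsSymbol fun ξ => Complex.I * (m ξ : ℂ) :=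
  ⟨(Complex.measurable_ofReal.comp hm).const_mul _, fun ξ => by simp [ho], C,
    fun ξ => by simpa using hC ξ⟩

end IsSymbol

/-- Sharp restriction of a symbol to the frequencies `|ξ| ≤ N`. -/
def cut (N : ℝ) (m : ℝ → ℂ) (ξ : ℝ) : ℂ := if |ξ| ≤ N then m ξ else 0

lemma isSymbol_cut {m : ℝ → ℂ} (hm : Continuous m) (hh : ∀ ξ, m (-ξ) = conj (m ξ)) (N : ℝ) :
    IsSymbol (cut N m) := by
  refine ⟨Measurable.ite (measurableSet_le measurable_abs measurable_const) hm.measurable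
    measurable_const, fun ξ => ?_, ?_⟩
  · simp only [cut, abs_neg]
    split_ifs <;> simp [hh]
  · obtain ⟨C, hC⟩ := (isCompact_Icc (a := -N) (b := N)).exists_bound_of_continuousOn
      hm.continuousOn
    refine ⟨max C 0, fun ξ => ?_⟩
    simp only [cut]
    split_ifs with h
    · exact (hC ξ (abs_le.1 h)).trans (le_max_left _ _)
    · simp

/-- The sharp frequency projection. -/
def proj (N : ℝ) : ℝ → ℂ := cut N fun _ => 1

lemma isSymbol_proj (N : ℝ) : IsSymbol (proj N) := isSymbol_cut continuous_const (by simp) N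

lemma norm_proj_le (N ξ : ℝ) : ‖proj N ξ‖ ≤ 1 := by
  simp only [proj, cut]; split_ifs <;> simp

lemma tendsto_proj (f : RealL2) : Tendsto (fun n : ℕ => T (proj n) f) atTop (𝓝 f) := by
  have := T_tendsto (F := atTop) (m := fun n : ℕ => proj n) (n := fun _ => 1)
    (fun n => isSymbol_proj n) (by simpa using IsSymbol.const 1) (C := 1)
    (Eventually.of_forall fun n => norm_proj_le n) (fun ξ => by
      refine tendsto_const_nhds.congr' ?_
      filter_upwards [eventually_ge_atTop ⌈|ξ|⌉₊] with n hn
      have : |ξ| ≤ n := (Nat.le_ceil _).trans (by exact_mod_cast hn)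
      simp [proj, cut, this]) f
  rwa [T_one] at this

/-! ### Oscillatory symbols -/

/-- The symbol `exp(i t om(ξ))`. -/
def osc (om : ℝ → ℝ) (t ξ : ℝ) : ℂ := Complex.exp (Complex.I * ((t * om ξ : ℝ) : ℂ))

/-- Phase functions: odd and measurable. -/
structure IsPhase (om : ℝ → ℝ) : Prop where
  meas : Measurable om
  odd : ∀ ξ, om (-ξ) = -om ξ

lemma norm_osc (om : ℝ → ℝ) (t ξ : ℝ) : ‖osc om t ξ‖ = 1 := by
  rw [osc, mul_comm, Complex.norm_exp_ofReal_mul_I]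

lemma osc_add (om : ℝ → ℝ) (s t ξ : ℝ) : osc om s ξ * osc om t ξ = osc om (s + t) ξ := by
  simp only [osc]
  rw [← Complex.exp_add]; congr 1; push_cast; ring

lemma osc_zero (om : ℝ → ℝ) (ξ : ℝ) : osc om 0 ξ = 1 := by simp [osc]

lemma conj_osc (om : ℝ → ℝ) (t ξ : ℝ) : conj (osc om t ξ) = osc om (-t) ξ := by
  simp [osc, ← Complex.exp_conj]

lemma hasDerivAt_osc (om : ℝ → ℝ) (t ξ : ℝ) :
    HasDerivAt (fun t => osc om t ξ) (Complex.I * (om ξ : ℂ) * osc om t ξ) t := by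
  have h1 : HasDerivAt (fun t : ℝ => Complex.I * ((t * om ξ : ℝ) : ℂ))
      (Complex.I * (om ξ : ℂ)) t := by
    have := ((hasDerivAt_id t).mul_const (om ξ)).ofReal_comp.const_mul Complex.I
    simpa using this
  have := h1.cexp
  rw [mul_comm] at this
  exact this

lemma norm_osc_sub_le (om : ℝ → ℝ) (s t ξ : ℝ) :
    ‖osc om s ξ - osc om t ξ‖ ≤ |om ξ| * |s - t| := by
  have := Convex.norm_image_sub_le_of_norm_hasDerivWithin_le (f := fun t => osc om t ξ)
    (f' := fun t => Complex.I * (om ξ : ℂ) * osc om t ξ) (s := univ) (C := |om ξ|)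
    (fun t _ => (hasDerivAt_osc om t ξ).hasDerivWithinAt)
    (fun t _ => by rw [norm_mul, norm_osc]; simp) convex_univ (mem_univ t) (mem_univ s)
  simpa using this

section Group

variable {om : ℝ → ℝ}

lemma IsPhase.isSymbol (hom : IsPhase om) (t : ℝ) : IsSymbol (osc om t) := by
  refine ⟨Complex.measurable_exp.comp ((Complex.measurable_ofReal.comp
    (hom.meas.const_mul t)).const_mul _), fun ξ => ?_, 1, fun ξ => (norm_osc om t ξ).le⟩
  rw [conj_osc]; simp [osc, hom.odd]

/-- The unitary group with phase `om`. -/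
def grp (om : ℝ → ℝ) (t : ℝ) : RealL2 →L[ℝ] RealL2 := T (osc om t)

lemma grp_grp (hom : IsPhase om) (s t : ℝ) (f : RealL2) :
    grp om s (grp om t f) = grp om (s + t) f := by
  rw [grp, grp, T_T (hom.isSymbol s) (hom.isSymbol t), grp]
  simp_rw [osc_add]

lemma grp_zero (f : RealL2) : grp om 0 f = f := by
  have : osc om 0 = fun _ => 1 := funext (osc_zero om)
  rw [grp, this, T_one]

lemma grp_neg_grp (hom : IsPhase om) (t : ℝ) (f : RealL2) : grp om (-t) (grp om t f) = f := by
  rw [grp_grp hom, neg_add_cancel, grp_zero]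

lemma grp_grp_neg (hom : IsPhase om) (t : ℝ) (f : RealL2) : grp om t (grp om (-t) f) = f := by
  rw [grp_grp hom, add_neg_cancel, grp_zero]

lemma norm_grp (hom : IsPhase om) (t : ℝ) (f : RealL2) : ‖grp om t f‖ = ‖f‖ :=
  norm_T_eq (hom.isSymbol t) (norm_osc om t) f

lemma inner_grp_left (hom : IsPhase om) (t : ℝ) (f g : RealL2) :
    ⟪grp om t f, g⟫_ℝ = ⟪f, grp om (-t) g⟫_ℝ := by
  rw [grp, inner_T_left (hom.isSymbol t), grp]
  simp_rw [conj_osc]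

lemma grp_comm (hom : IsPhase om) {m : ℝ → ℂ} (hm : IsSymbol m) (t : ℝ) (f : RealL2) :
    grp om t (T m f) = T m (grp om t f) := T_comm (hom.isSymbol t) hm f

lemma continuous_grp (hom : IsPhase om) (f : RealL2) : Continuous fun t => grp om t f := by
  refine continuous_iff_continuousAt.2 fun t => ?_
  exact T_tendsto (F := 𝓝 t) (m := fun s => osc om s) (fun s => hom.isSymbol s) (hom.isSymbol t)
    (C := 1) (Eventually.of_forall fun s ξ => (norm_osc om s ξ).le)
    (fun ξ => (hasDerivAt_osc om t ξ).continuousAt) f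

lemma continuous_grp_comp (hom : IsPhase om) {y : ℝ → RealL2} (hy : Continuous y) :
    Continuous fun t => grp om t (y t) :=
  continuous_comp_of_lipschitz (K := 1) (fun t => LipschitzWith.of_dist_le_mul fun a b => by
    rw [dist_eq_norm, ← map_sub, norm_grp hom, dist_eq_norm]; simp)
    (fun f => continuous_grp hom f) hy

/-- Differentiability of the group on a vector in the domain of its generator. -/
lemma hasDerivAt_grp_T (hom : IsPhase om) {m : ℝ → ℂ} (hm : IsSymbol m)
    (homm : IsSymbol fun ξ => Complex.I * (om ξ : ℂ) * m ξ) (f : RealL2) (t : ℝ) :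
    HasDerivAt (fun s => grp om s (T m f))
      (grp om t (T (fun ξ => Complex.I * (om ξ : ℂ) * m ξ) f)) t := by
  obtain ⟨C, hC⟩ := homm.bdd
  rw [hasDerivAt_iff_tendsto_slope]
  have hs : ∀ s, IsSymbol fun ξ => ((s - t)⁻¹ : ℝ) * ((osc om s ξ - osc om t ξ) * m ξ) := fun s =>
    (IsSymbol.const _).mul (((hom.isSymbol s).sub (hom.isSymbol t)).mul hm)
  have hn : IsSymbol fun ξ => osc om t ξ * (Complex.I * (om ξ : ℂ) * m ξ) :=
      (hom.isSymbol t).mul homm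
  -- The difference quotients are themselves multipliers, bounded by `|om · m|` uniformly in `s`.
  have key := T_tendsto (F := 𝓝[≠] t) hs hn (C := C) (eventually_nhdsWithin_of_forall ?_) ?_ f
  · rw [grp, T_T (hom.isSymbol t) homm]
    refine key.congr fun s => ?_
    rw [T_smul _ (((hom.isSymbol s).sub (hom.isSymbol t)).mul hm), slope_def_module, grp, grp,
      T_T (hom.isSymbol s) hm, T_T (hom.isSymbol t) hm,
      ← T_sub ((hom.isSymbol s).mul hm) ((hom.isSymbol t).mul hm)]
    simp only [sub_mul]
  · intro s hs ξ
    have hpos : 0 < |s - t| := abs_pos.2 (sub_ne_zero.2 hs)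
    rw [norm_mul, norm_mul, Complex.norm_real, norm_inv, Real.norm_eq_abs]
    calc |s - t|⁻¹ * (‖osc om s ξ - osc om t ξ‖ * ‖m ξ‖)
        ≤ |s - t|⁻¹ * ((|om ξ| * |s - t|) * ‖m ξ‖) := by
          gcongr; exact norm_osc_sub_le om s t ξ
      _ = ‖Complex.I * (om ξ : ℂ) * m ξ‖ := by
          rw [norm_mul, norm_mul]; simp; field_simp
      _ ≤ C := hC ξ
  · intro ξ
    have h1 := (hasDerivAt_iff_tendsto_slope.1 (hasDerivAt_osc om t ξ)).mul_const (m ξ)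
    refine (h1.congr fun s => ?_).trans_eq (by ring_nf)
    rw [slope_def_module]; simp [mul_assoc]

/-- Product rule for a strongly differentiable, uniformly bounded family of operators. -/
lemma hasDerivAt_strong {H : Type*} [NormedAddCommGroup H] [NormedSpace ℝ H]
    {A : ℝ → H →L[ℝ] H} {C t₀ : ℝ} (hC : ∀ t, ‖A t‖ ≤ C)
        (hA : ∀ x, ContinuousAt (fun t => A t x) t₀)
    {y : ℝ → H} {y' a : H} (hy : HasDerivAt y y' t₀)
    (ha : HasDerivAt (fun t => A t (y t₀)) a t₀) :
    HasDerivAt (fun t => A t (y t)) (a + A t₀ y') t₀ := by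
  -- Split `A t (y t) = A t (y t₀) + A t (y t - y t₀)`; the second term needs only strong continuity
  -- and the uniform bound.
  have h2 : HasDerivAt (fun t => A t (y t - y t₀)) (A t₀ y') t₀ := by
    rw [hasDerivAt_iff_tendsto_slope]
    have hs := hasDerivAt_iff_tendsto_slope.1 hy
    have hA' : Tendsto (fun t => A t y') (𝓝[≠] t₀) (𝓝 (A t₀ y')) := (hA y').mono_left inf_le_left
    have h0 : Tendsto (fun t => A t (slope y t₀ t - y')) (𝓝[≠] t₀) (𝓝 0) := by
      refine squeeze_zero_norm (a := fun t => C * ‖slope y t₀ t - y'‖) (fun t =>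
        ((A t).le_opNorm _).trans (mul_le_mul_of_nonneg_right (hC t) (norm_nonneg _))) ?_
      have := (hs.sub_const y').norm.const_mul C
      simpa using this
    have := h0.add hA'
    rw [zero_add] at this
    refine this.congr fun t => ?_
    rw [← map_add, sub_add_cancel, slope_def_module, slope_def_module]
    simp
  have := ha.add h2
  refine this.congr_of_eventuallyEq (Eventually.of_forall fun t => ?_)
  simp

end Group

/-! ### Schwartz functions -/

lemma coeFn_hat_testDeriv (ψ : 𝓢(ℝ, ℝ)) : hat (testDeriv ψ) =ᵐ[volume]
    fun η => Complex.I * ((2 * Real.pi * η : ℝ) : ℂ) * hat (testL2 ψ) η := by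
  have e : testDeriv ψ = testL2 (SchwartzMap.derivCLM ℝ ℝ ψ) := rfl
  rw [e]
  filter_upwards [coeFn_hat_testL2 (SchwartzMap.derivCLM ℝ ℝ ψ), coeFn_hat_testL2 ψ] with η h1 h2
  rw [h1, h2]
  set φ : 𝓢(ℝ, ℂ) := ψ.postcompCLM Complex.ofRealCLM with hφ
  have hd : ((SchwartzMap.derivCLM ℝ ℝ ψ).postcompCLM Complex.ofRealCLM : 𝓢(ℝ, ℂ)) =
      SchwartzMap.derivCLM ℂ ℂ φ := by
    ext x
    have h3 : HasDerivAt φ ((deriv ψ x : ℝ) : ℂ) x := by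
      have := (ψ.hasDerivAt x).ofReal_comp
      exact this
    rw [SchwartzMap.derivCLM_apply, h3.deriv]
    simp
  rw [hd, SchwartzMap.fourier_coe, SchwartzMap.fourier_coe]
  have h4 := Real.fourier_deriv (f := φ) φ.integrable φ.differentiable
    (by have := (SchwartzMap.derivCLM ℂ ℂ φ).integrable (μ := volume); exact this)
  have h5 := congrFun h4 η
  have h6 : (SchwartzMap.derivCLM ℂ ℂ φ : ℝ → ℂ) = deriv φ := rfl
  rw [h6, h5, smul_eq_mul]
  push_cast; ring

/-- Multipliers with smooth compactly supported symbols preserve real Schwartz functions. -/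
lemma exists_schwartz_T {m : ℝ → ℂ} (hm : IsSymbol m) (hs : ContDiff ℝ ∞ m)
    (hc : HasCompactSupport m) (ψ : 𝓢(ℝ, ℝ)) : ∃ ψ' : 𝓢(ℝ, ℝ), testL2 ψ' = T m (testL2 ψ) := by
  set φ : 𝓢(ℝ, ℂ) := 𝓕 (ψ.postcompCLM Complex.ofRealCLM : 𝓢(ℝ, ℂ)) with hφ
  have hpi : (2 * Real.pi) ≠ 0 := by positivity
  have h1 : HasCompactSupport fun η : ℝ => m (2 * Real.pi * η) * φ η :=
    (hc.comp_homeomorph (Homeomorph.mulLeft₀ (2 * Real.pi) hpi)).mul_right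
  have h2 : ContDiff ℝ ∞ fun η : ℝ => m (2 * Real.pi * η) * φ η :=
    (hs.comp (contDiff_const.mul contDiff_id)).mul (φ.smooth ⊤)
  set h : 𝓢(ℝ, ℂ) := h1.toSchwartzMap h2 with hh
  refine ⟨(𝓕⁻ h : 𝓢(ℝ, ℂ)).postcompCLM Complex.reCLM, ?_⟩
  have e1 : testL2 ((𝓕⁻ h : 𝓢(ℝ, ℂ)).postcompCLM Complex.reCLM) = unhat (h.toLp 2) := by
    ext1
    filter_upwards [coeFn_testL2 ((𝓕⁻ h : 𝓢(ℝ, ℂ)).postcompCLM Complex.reCLM),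
      coeFn_unhat (h.toLp 2), SchwartzMap.coeFn_toLp (𝓕⁻ h : 𝓢(ℝ, ℂ)) 2 volume] with x h3 h4 h5
    rw [h3, h4, SchwartzMap.toLp_fourierInv_eq, h5]; simp
  rw [e1, T_eq_op hm, op, dif_pos (hm.inDomain _)]
  congr 1
  ext1
  filter_upwards [SchwartzMap.coeFn_toLp h 2 volume, (hm.inDomain (testL2 ψ)).coeFn_toLp,
    coeFn_hat_testL2 ψ] with η h3 h4 h5
  rw [h3, h4, h5]; rfl

/-- A smooth even cutoff, equal to `1` on `[-(n+1), n+1]`. -/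
def bump (n : ℕ) : ContDiffBump (0 : ℝ) := ⟨n + 1, n + 2, by positivity, by linarith⟩

/-- The smooth cutoff as a symbol. -/
def chi (n : ℕ) (ξ : ℝ) : ℂ := ((bump n ξ : ℝ) : ℂ)

lemma contDiff_chi (n : ℕ) : ContDiff ℝ ∞ (chi n) :=
  Complex.ofRealCLM.contDiff.comp (bump n).contDiff

lemma hasCompactSupport_chi (n : ℕ) : HasCompactSupport (chi n) :=
  (bump n).hasCompactSupport.comp_left (g := Complex.ofReal) Complex.ofReal_zero

lemma chi_neg (n : ℕ) (ξ : ℝ) : chi n (-ξ) = chi n ξ := by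
  rw [chi, (bump n).neg]; rfl

lemma conj_chi (n : ℕ) (ξ : ℝ) : conj (chi n ξ) = chi n ξ := Complex.conj_ofReal _

lemma norm_chi_le (n : ℕ) (ξ : ℝ) : ‖chi n ξ‖ ≤ 1 := by
  rw [chi, Complex.norm_real, Real.norm_of_nonneg (bump n).nonneg]; exact (bump n).le_one

lemma chi_eq_one {n : ℕ} {ξ : ℝ} (h : |ξ| ≤ n + 1) : chi n ξ = 1 := by
  rw [chi, (bump n).one_of_mem_closedBall (by simpa [bump] using h)]; simp

lemma isSymbol_mul_chi {m : ℝ → ℂ} (hm : Continuous m) (hh : ∀ ξ, m (-ξ) = conj (m ξ)) (n : ℕ) :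
    IsSymbol fun ξ => m ξ * chi n ξ := by
  have hc : Continuous fun ξ => m ξ * chi n ξ := hm.mul (contDiff_chi n).continuous
  refine ⟨hc.measurable, fun ξ => by rw [hh, chi_neg, map_mul, conj_chi], ?_⟩
  exact (hasCompactSupport_chi n).mul_left.exists_bound_of_continuous hc

lemma isSymbol_chi (n : ℕ) : IsSymbol (chi n) := by
  simpa using isSymbol_mul_chi (m := fun _ => 1) continuous_const (by simp) n

lemma tendsto_chi (f : RealL2) : Tendsto (fun n : ℕ => T (chi n) f) atTop (𝓝 f) := by
  have := T_tendsto (F := atTop) (m := fun n : ℕ => chi n) (n := fun _ => 1)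
    (fun n => isSymbol_chi n) (by simpa using IsSymbol.const 1) (C := 1)
    (Eventually.of_forall fun n => norm_chi_le n) (fun ξ => by
      refine tendsto_const_nhds.congr' ?_
      filter_upwards [eventually_ge_atTop ⌈|ξ|⌉₊] with n hn
      have h1 : (⌈|ξ|⌉₊ : ℝ) ≤ n := by exact_mod_cast hn
      rw [chi_eq_one (by linarith [Nat.le_ceil |ξ|])]) f
  rwa [T_one] at this

lemma denseRange_testL2 : DenseRange testL2 :=
  SchwartzMap.denseRange_toLpCLM (E := ℝ) (F := ℝ) (p := 2) (μ := volume) (by simp)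

/-- Schwartz functions with smooth compactly supported Fourier transform are dense. -/
lemma eq_zero_of_inner_chi {f : RealL2} (h : ∀ n ψ, ⟪f, T (chi n) (testL2 ψ)⟫_ℝ = 0) : f = 0 := by
  have h1 : ∀ ψ, ⟪f, testL2 ψ⟫_ℝ = 0 := fun ψ => by
    have := (tendsto_const_nhds (x := f)).inner (𝕜 := ℝ) (tendsto_chi (testL2 ψ))
    simp only [h] at this
    exact (tendsto_nhds_unique this tendsto_const_nhds)
  have h2 : ∀ g, ⟪f, g⟫_ℝ = 0 := fun g =>
    denseRange_testL2.induction_on (p := fun g => ⟪f, g⟫_ℝ = 0) g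
      (isClosed_eq (by fun_prop) continuous_const) h1
  exact inner_self_eq_zero.1 (h2 f)

/-- The symbol `i ξ` of the derivative. -/
def dx (ξ : ℝ) : ℂ := Complex.I * (ξ : ℂ)

lemma continuous_dx : Continuous dx := by unfold dx; fun_prop

lemma dx_neg (ξ : ℝ) : dx (-ξ) = conj (dx ξ) := by simp [dx]

/-- Translation invariance of the potential: `∫ g(u) u_x = 0` for band-limited `u`. -/
lemma inner_nl_deriv {p R : ℝ} (hp : 1 < p) (hR : 0 ≤ R) (n : ℕ) {u : RealL2}
    (hu : T (proj n) u = u) : ⟪nl p R u, T (cut n dx) u⟫_ℝ = 0 := by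
  have hS := isSymbol_mul_chi continuous_dx dx_neg n
  have h1 : ∀ f, ⟪nl p R (T (chi n) f), T (fun ξ => dx ξ * chi n ξ) f⟫_ℝ = 0 := by
    intro f
    refine denseRange_testL2.induction_on
      (p := fun f => ⟪nl p R (T (chi n) f), T (fun ξ => dx ξ * chi n ξ) f⟫_ℝ = 0) f
      (isClosed_eq ?_ continuous_const) fun ψ => ?_
    · exact ((lipschitz_nl hp hR).continuous.comp (T (chi n)).continuous).inner
        (T fun ξ => dx ξ * chi n ξ).continuous
    · obtain ⟨ψ', h⟩ := exists_schwartz_T (isSymbol_chi n) (contDiff_chi n)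
        (hasCompactSupport_chi n) ψ
      have e : T (fun ξ => dx ξ * chi n ξ) (testL2 ψ) = testDeriv ψ' := by
        refine ext_hat ?_
        filter_upwards [hat_T hS (testL2 ψ), coeFn_hat_testDeriv ψ',
          hat_T (isSymbol_chi n) (testL2 ψ)] with η h3 h4 h5
        rw [h3, h4, h, h5, dx]; ring
      rw [e, ← h]
      exact inner_nl_testDeriv hp hR ψ'
  have h2 := h1 u
  -- `chi n` equals `1` for `|ξ| ≤ n + 1`, which covers the band of `u`, so the smooth cutoff used
  -- for the density argument is invisible here.
  have e1 : T (chi n) u = u := by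
    conv_lhs => rw [← hu]
    rw [T_T (isSymbol_chi n) (isSymbol_proj n)]
    conv_rhs => rw [← hu]
    congr 2; funext ξ
    simp only [proj, cut]
    split_ifs with h
    · rw [chi_eq_one (by linarith)]; simp
    · simp
  have e2 : T (fun ξ => dx ξ * chi n ξ) u = T (cut n dx) u := by
    conv_lhs => rw [← hu]
    rw [T_T hS (isSymbol_proj n)]
    congr 2; funext ξ
    simp only [proj, cut]
    split_ifs with h
    · rw [chi_eq_one (by linarith)]; simp
    · simp
  rwa [e1, e2] at h2

/-! ### Sobolev norms and representation by multipliers -/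

/-- The weight `(1 + ξ²)^{s/2}`. -/
def weight (s ξ : ℝ) : ℝ := (1 + ξ ^ 2) ^ (s / 2)

lemma one_le_weight {s : ℝ} (hs : 0 ≤ s) (ξ : ℝ) : 1 ≤ weight s ξ :=
  Real.one_le_rpow (by nlinarith [sq_nonneg ξ]) (by positivity)

lemma weight_pos (s ξ : ℝ) : 0 < weight s ξ := by unfold weight; positivity

/-- The scaling factor between the two normalizations of the Fourier transform. -/
def scale : ℝ≥0∞ := ENNReal.ofReal (2 * Real.pi) ^ (1 / 2 : ℝ)

lemma scale_ne_zero : scale ≠ 0 := by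
  rw [scale, Ne, ENNReal.rpow_eq_zero_iff_of_pos (by norm_num), ENNReal.ofReal_eq_zero, not_le]
  positivity

lemma scale_ne_top : scale ≠ ⊤ := ENNReal.rpow_ne_top_of_nonneg (by norm_num) ENNReal.ofReal_ne_top

/-- The substitution `ξ = 2πη`. Of `scale`, only that it is neither zero nor infinite matters later.
-/
lemma sobolevNorm_eq (s : ℝ) (f : RealL2) : sobolevNorm s f =
    scale * eLpNorm (fun η : ℝ => ((weight s (2 * Real.pi * η) : ℝ) : ℂ) * hat f η) 2 volume := by
  have hpi : (2 * Real.pi) ≠ 0 := by positivity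
  set G : ℝ → ℂ := fun η => ((weight s (2 * Real.pi * η) : ℝ) : ℂ) * hat f η with hG
  have e1 : sobolevNorm s f = eLpNorm (G ∘ fun ξ => ξ * (2 * Real.pi)⁻¹) 2 volume := by
    rw [sobolevNorm]
    congr 1
    funext ξ
    simp only [hG, Function.comp, fourierHat, weight, hat, div_eq_mul_inv]
    rw [show 2 * Real.pi * (ξ * (2 * Real.pi)⁻¹) = ξ by field_simp]
  have hme : MeasurableEmbedding fun ξ : ℝ => ξ * (2 * Real.pi)⁻¹ :=
    (Homeomorph.mulRight₀ _ (inv_ne_zero hpi)).measurableEmbedding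
  rw [e1, ← hme.eLpNorm_map_measure, Real.map_volume_mul_right (inv_ne_zero hpi),
    eLpNorm_smul_measure_of_ne_top (by simp), inv_inv, abs_of_pos (by positivity), scale]
  simp

/-- `k` is comparable with `(1 + ξ²)^{-s/2}`. -/
structure Comparable (s : ℝ) (k : ℝ → ℝ) (c C : ℝ) : Prop where
  order_nonneg : 0 ≤ s
  meas : Measurable k
  even : ∀ ξ, k (-ξ) = k ξ
  pos : 0 < c
  lower : ∀ ξ, c ≤ weight s ξ * k ξ
  upper : ∀ ξ, weight s ξ * k ξ ≤ C

lemma enorm_eq_eLpNorm_hat (f : RealL2) : ‖f‖ₑ = eLpNorm (hat f) 2 volume := by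
  rw [← Lp.enorm_def, enorm_eq_iff_norm_eq, norm_hat]

lemma op_T {m n : ℝ → ℂ} (hm : ∀ ξ, m (-ξ) = conj (m ξ)) (hn : IsSymbol n)
    (hmn : IsSymbol fun ξ => m ξ * n ξ) (f : RealL2) :
    op m (T n f) = T (fun ξ => m ξ * n ξ) f := by
  have e : (fun η : ℝ => m (2 * Real.pi * η) * n (2 * Real.pi * η) * hat f η) =ᵐ[volume]
      fun η : ℝ => m (2 * Real.pi * η) * hat (T n f) η := by
    filter_upwards [hat_T hn f] with η h1
    rw [h1, mul_assoc]
  have hd : InDomain m (T n f) := (memLp_congr_ae e).1 (hmn.inDomain f)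
  refine ext_hat ?_
  filter_upwards [hat_op hm hd, hat_T hn f, hat_T hmn f] with η h1 h2 h3
  rw [h1, h2, h3]; ring

namespace Comparable

variable {s c C : ℝ} {k : ℝ → ℝ}

lemma k_pos (h : Comparable s k c C) (ξ : ℝ) : 0 < k ξ :=
  (mul_pos_iff_of_pos_left (weight_pos s ξ)).1 (h.pos.trans_le (h.lower ξ))

lemma k_le (h : Comparable s k c C) (ξ : ℝ) : k ξ ≤ C :=
  (le_mul_of_one_le_left (h.k_pos ξ).le (one_le_weight h.order_nonneg ξ)).trans (h.upper ξ)

lemma isSymbol (h : Comparable s k c C) : IsSymbol fun ξ => (k ξ : ℂ) :=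
  .ofReal h.meas h.even fun ξ => by rw [abs_of_pos (h.k_pos ξ)]; exact h.k_le ξ

lemma sobolevNorm_le (h : Comparable s k c C) (U : RealL2) :
    sobolevNorm s (T (fun ξ => (k ξ : ℂ)) U) ≤ scale * (ENNReal.ofReal C * ‖U‖ₑ) := by
  rw [sobolevNorm_eq, enorm_eq_eLpNorm_hat]
  gcongr
  refine eLpNorm_le_mul_eLpNorm_of_ae_le_mul ?_ 2
  filter_upwards [hat_T h.isSymbol U] with η h1
  rw [h1, ← mul_assoc, norm_mul, ← Complex.ofReal_mul, Complex.norm_real,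
    Real.norm_of_nonneg (mul_pos (weight_pos _ _) (h.k_pos _)).le]
  exact mul_le_mul_of_nonneg_right (h.upper _) (norm_nonneg _)

lemma le_sobolevNorm (h : Comparable s k c C) (U : RealL2) :
    scale * ‖U‖ₑ ≤ ENNReal.ofReal c⁻¹ * sobolevNorm s (T (fun ξ => (k ξ : ℂ)) U) := by
  rw [sobolevNorm_eq, enorm_eq_eLpNorm_hat, mul_left_comm]
  gcongr
  refine eLpNorm_le_mul_eLpNorm_of_ae_le_mul ?_ 2
  filter_upwards [hat_T h.isSymbol U] with η h1
  rw [h1, ← mul_assoc, norm_mul, ← Complex.ofReal_mul, Complex.norm_real,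
    Real.norm_of_nonneg (mul_pos (weight_pos _ _) (h.k_pos _)).le, ← mul_assoc]
  refine le_mul_of_one_le_left (norm_nonneg _) ?_
  rw [inv_mul_eq_div, one_le_div h.pos]
  exact h.lower _

lemma T_injective (h : Comparable s k c C) {U V : RealL2}
    (e : T (fun ξ => (k ξ : ℂ)) U = T (fun ξ => (k ξ : ℂ)) V) : U = V := by
  refine ext_hat ?_
  filter_upwards [hat_T h.isSymbol U, hat_T h.isSymbol V] with η h1 h2
  rw [e, h2] at h1
  exact (mul_left_cancel₀ (by exact_mod_cast (h.k_pos _).ne') h1).symm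

lemma memH_T (h : Comparable s k c C) (U : RealL2) : MemH s (T (fun ξ => (k ξ : ℂ)) U) :=
  (h.sobolevNorm_le U).trans_lt (ENNReal.mul_lt_top scale_ne_top.lt_top
    (ENNReal.mul_lt_top ENNReal.ofReal_lt_top enorm_lt_top))

/-- The preimage has symbol `1/k`, bounded by `weight s / c`, so membership in `H^s` puts `f` in the
domain of that operator. -/
lemma exists_eq_T (h : Comparable s k c C) {f : RealL2} (hf : MemH s f) :
    ∃ U, T (fun ξ => (k ξ : ℂ)) U = f := by
  have hm : AEStronglyMeasurable (fun η : ℝ => (((k (2 * Real.pi * η))⁻¹ : ℝ) : ℂ)) volume :=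
    (Complex.measurable_ofReal.comp (h.meas.inv.comp (measurable_const_mul _))).aestronglyMeasurable
  have hw : AEStronglyMeasurable (fun η : ℝ => ((weight s (2 * Real.pi * η) : ℝ) : ℂ)) volume := by
    refine (Complex.measurable_ofReal.comp (?_ : Measurable
        fun η : ℝ => weight s _)).aestronglyMeasurable
    unfold weight; fun_prop
  have h1 : MemLp (fun η : ℝ => ((weight s (2 * Real.pi * η) : ℝ) : ℂ) * hat f η) 2 volume := by
    refine ⟨hw.mul (Lp.aestronglyMeasurable _), ?_⟩
    rw [MemH, sobolevNorm_eq] at hf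
    exact ENNReal.lt_top_of_mul_ne_top_right hf.ne scale_ne_zero
  have hd : InDomain (fun ξ => (((k ξ)⁻¹ : ℝ) : ℂ)) f := by
    refine h1.of_le_mul (c := c⁻¹) (hm.mul (Lp.aestronglyMeasurable _))
      (Eventually.of_forall fun η => ?_)
    rw [norm_mul, norm_mul, ← mul_assoc, Complex.norm_real, Complex.norm_real,
      Real.norm_of_nonneg (inv_pos.2 (h.k_pos _)).le, Real.norm_of_nonneg (weight_pos _ _).le]
    refine mul_le_mul_of_nonneg_right ?_ (norm_nonneg _)
    rw [inv_mul_eq_div, inv_eq_one_div, div_le_div_iff₀ (h.k_pos _) h.pos, one_mul]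
    exact h.lower _
  refine ⟨op (fun ξ => (((k ξ)⁻¹ : ℝ) : ℂ)) f, ext_hat ?_⟩
  filter_upwards [hat_T h.isSymbol (op (fun ξ => (((k ξ)⁻¹ : ℝ) : ℂ)) f),
    hat_op (by simp [h.even]) hd] with η h2 h3
  rw [h2, h3, ← mul_assoc, ← Complex.ofReal_mul, mul_inv_cancel₀ (h.k_pos _).ne']
  simp

/-- The operator with symbol `k` identifies `L²` with `H^s` up to constants in the norms, so
continuity into `H^s` can be read off the preimage in `L²`. -/
lemma continuousInH_iff (h : Comparable s k c C) {J : Set ℝ} {u : ℝ → RealL2} :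
    ContinuousInH s J u ↔
      ∃ U : ℝ → RealL2, ContinuousOn U J ∧ ∀ t ∈ J, T (fun ξ => (k ξ : ℂ)) (U t) = u t := by
  constructor
  · rintro ⟨h1, h2⟩
    choose! U hU using fun t ht => h.exists_eq_T (h1 t ht)
    refine ⟨U, fun t ht => ?_, hU⟩
    rw [ContinuousWithinAt, tendsto_iff_edist_tendsto_0]
    have h3 := ENNReal.Tendsto.const_mul (a := scale⁻¹ * ENNReal.ofReal c⁻¹) (h2 t ht)
      (Or.inr (ENNReal.mul_ne_top (ENNReal.inv_ne_top.2 scale_ne_zero) ENNReal.ofReal_ne_top))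
    rw [mul_zero] at h3
    refine tendsto_of_tendsto_of_tendsto_of_le_of_le' tendsto_const_nhds h3
      (Eventually.of_forall fun _ => zero_le) (eventually_nhdsWithin_of_forall fun τ hτ => ?_)
    have h4 := h.le_sobolevNorm (U τ - U t)
    rw [map_sub, hU τ hτ, hU t ht] at h4
    rw [edist_eq_enorm_sub, mul_assoc]
    calc _ = scale⁻¹ * (scale * ‖U τ - U t‖ₑ) := by
          rw [← mul_assoc, ENNReal.inv_mul_cancel scale_ne_zero scale_ne_top, one_mul]
      _ ≤ _ := by gcongr
  · rintro ⟨U, h1, h2⟩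
    refine ⟨fun t ht => h2 t ht ▸ h.memH_T _, fun t ht => ?_⟩
    have h3 := tendsto_iff_edist_tendsto_0.1 (h1 t ht)
    have h4 := ENNReal.Tendsto.const_mul (a := scale * ENNReal.ofReal C) h3
      (Or.inr (ENNReal.mul_ne_top scale_ne_top ENNReal.ofReal_ne_top))
    rw [mul_zero] at h4
    refine tendsto_of_tendsto_of_tendsto_of_le_of_le' tendsto_const_nhds h4
      (Eventually.of_forall fun _ => zero_le) (eventually_nhdsWithin_of_forall fun τ hτ => ?_)
    rw [← h2 τ hτ, ← h2 t ht, ← map_sub, edist_eq_enorm_sub, mul_assoc]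
    exact h.sobolevNorm_le _

end Comparable

/-! ### A Sobolev embedding -/

lemma exists_test_tendsto (U : RealL2) :
    ∃ ψ : ℕ → 𝓢(ℝ, ℝ), Tendsto (fun n => T (chi n) (testL2 (ψ n))) atTop (𝓝 U) := by
  have h := fun n : ℕ => denseRange_testL2.exists_dist_lt U
      (show (0 : ℝ) < 1 / (n + 1) by positivity)
  choose ψ hψ using h
  refine ⟨ψ, ?_⟩
  rw [tendsto_iff_dist_tendsto_zero]
  have h1 := (tendsto_iff_dist_tendsto_zero.1 (tendsto_chi U)).add
    (tendsto_one_div_add_atTop_nhds_zero_nat (𝕜 := ℝ))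
  rw [add_zero] at h1
  refine squeeze_zero (fun _ => dist_nonneg) (fun n => ?_) h1
  refine (dist_triangle _ (T (chi n) U) _).trans ?_
  rw [add_comm]
  gcongr
  rw [dist_eq_norm, ← map_sub]
  refine (norm_T_le (isSymbol_chi n) (norm_chi_le n) _).trans ?_
  rw [one_mul, ← dist_eq_norm, dist_comm]
  exact (hψ n).le

/-- Multipliers with smooth square integrable symbols map `L²` to `L^∞`. -/
lemma ae_abs_T_le {k : ℝ → ℝ} (hk : IsSymbol fun ξ => (k ξ : ℂ)) (hs : ContDiff ℝ ∞ k)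
    (hk2 : Integrable fun η => (k (2 * Real.pi * η)) ^ 2) (U : RealL2) :
    ∀ᵐ x, |T (fun ξ => (k ξ : ℂ)) U x| ≤ √(∫ η, (k (2 * Real.pi * η)) ^ 2) * ‖U‖ := by
  set M := √(∫ η, (k (2 * Real.pi * η)) ^ 2) with hM
  have main : ∀ n ψ, ∀ᵐ x, |T (fun ξ => (k ξ : ℂ)) (T (chi n) (testL2 ψ)) x| ≤
      M * ‖T (chi n) (testL2 ψ)‖ := by
    intro n ψ
    have hkc : IsSymbol fun ξ => (k ξ : ℂ) * chi n ξ := hk.mul (isSymbol_chi n)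
    obtain ⟨φ, hφ⟩ := exists_schwartz_T hkc
      ((Complex.ofRealCLM.contDiff.comp hs).mul (contDiff_chi n))
      (hasCompactSupport_chi n).mul_left ψ
    rw [T_T hk (isSymbol_chi n), ← hφ]
    set Φ : 𝓢(ℝ, ℂ) := φ.postcompCLM Complex.ofRealCLM with hΦ
    have h1 : ∀ x, |φ x| ≤ ∫ η, ‖(𝓕 Φ : 𝓢(ℝ, ℂ)) η‖ := by
      intro x
      have e1 : Φ x = (𝓕⁻ (𝓕 Φ) : 𝓢(ℝ, ℂ)) x := by
        rw [FourierTransform.fourierInv_fourier_eq]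
      have e2 : ‖Φ x‖ = |φ x| := by simp [hΦ]
      rw [← e2, e1, SchwartzMap.fourierInv_coe, Real.fourierInv_eq_fourier_neg]
      exact VectorFourier.norm_fourierIntegral_le_integral_norm _ _ _ _ _
    -- Cauchy–Schwarz in frequency, between the symbol and the transform of the argument.
    have h2 : ∫ η, ‖(𝓕 Φ : 𝓢(ℝ, ℂ)) η‖ ≤ M * ‖T (chi n) (testL2 ψ)‖ := by
      have e3 : ∫ η, ‖(𝓕 Φ : 𝓢(ℝ, ℂ)) η‖ =
          ∫ η, |k (2 * Real.pi * η)| * ‖hat (T (chi n) (testL2 ψ)) η‖ := by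
        refine integral_congr_ae ?_
        filter_upwards [coeFn_hat_testL2 φ, hat_T hkc (testL2 ψ),
          hat_T (isSymbol_chi n) (testL2 ψ)] with η h3 h4 h5
        rw [← h3, hφ, h4, h5, mul_assoc, norm_mul, Complex.norm_real, Real.norm_eq_abs]
      have hkm : MemLp (fun η => |k (2 * Real.pi * η)|) 2 volume := by
        refine (memLp_two_iff_integrable_sq ?_).2 (by simpa using hk2)
        have : Continuous k := hs.continuous
        exact Continuous.aestronglyMeasurable (by fun_prop)
      have e4 := integral_mul_le_Lp_mul_Lq_of_nonneg (μ := (volume : Measure ℝ)) (p := 2) (q := 2)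
        (Real.HolderConjugate.two_two) (f := fun η => |k (2 * Real.pi * η)|)
        (g := fun η => ‖hat (T (chi n) (testL2 ψ)) η‖) (Eventually.of_forall fun _ => abs_nonneg _)
        (Eventually.of_forall fun _ => norm_nonneg _) (by simpa using hkm)
        (by simpa using (Lp.memLp (hat (T (chi n) (testL2 ψ)))).norm)
      rw [e3]
      refine e4.trans (le_of_eq ?_)
      simp only [Real.rpow_two, sq_abs]
      rw [← norm_sq_eq_integral, ← Real.sqrt_eq_rpow, ← Real.sqrt_eq_rpow,
        Real.sqrt_sq (norm_nonneg _)]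
    filter_upwards [coeFn_testL2 φ] with x hx
    rw [hx]
    exact (h1 x).trans h2
  obtain ⟨ψ, hψ⟩ := exists_test_tendsto U
  have h1 := ((T fun ξ => (k ξ : ℂ)).continuous.tendsto U).comp hψ
  -- Convergence in `L²` gives an almost everywhere convergent subsequence, along which the
  -- pointwise bounds pass to the limit.
  obtain ⟨ns, hns, hae⟩ := (tendstoInMeasure_of_tendsto_Lp h1).exists_seq_tendsto_ae
  have hb : ∀ᵐ x, ∀ n, |T (fun ξ => (k ξ : ℂ)) (T (chi n) (testL2 (ψ n))) x| ≤
      M * ‖T (chi n) (testL2 (ψ n))‖ := ae_all_iff.2 fun n => main n (ψ n)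
  filter_upwards [hae, hb] with x hx hbx
  exact le_of_tendsto_of_tendsto' hx.abs
    ((hψ.norm.comp hns.tendsto_atTop).const_mul M) fun n => hbx (ns n)

/-! ### The operators of the problem -/

/-- The standing assumptions on the orders and the symbols. -/
structure Admissible (ρ r c₁ c₂ c₃ c₄ : ℝ) (l b : ℝ → ℝ) : Prop where
  hρ : 0 ≤ ρ
  hr : 0 ≤ r
  hrρ : 1 ≤ r + ρ / 2
  hne : (ρ, r) ≠ (0, 1)
  hc₁ : 0 < c₁
  hc₂ : 0 < c₂
  hc₃ : 0 < c₃
  hc₄ : 0 < c₄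
  l_smooth : ContDiff ℝ ∞ l
  b_smooth : ContDiff ℝ ∞ b
  l_even : ∀ ξ, l (-ξ) = l ξ
  b_even : ∀ ξ, b (-ξ) = b ξ
  hl : ∀ ξ, c₁ ^ 2 * (1 + ξ ^ 2) ^ (ρ / 2) ≤ l ξ ∧ l ξ ≤ c₂ ^ 2 * (1 + ξ ^ 2) ^ (ρ / 2)
  hb : ∀ ξ, c₃ ^ 2 * (1 + ξ ^ 2) ^ (-(r / 2)) ≤ b ξ ∧ b ξ ≤ c₄ ^ 2 * (1 + ξ ^ 2) ^ (-(r / 2))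

/-- The symbol of `B^{1/2} L^{-1/2}`. -/
def kf (l b : ℝ → ℝ) (ξ : ℝ) : ℝ := √(b ξ / l ξ)

/-- The symbol of `L^{-1/2}`. -/
def df (l : ℝ → ℝ) (ξ : ℝ) : ℝ := (√(l ξ))⁻¹

/-- The symbol of `B^{1/2}`. -/
def bf (b : ℝ → ℝ) (ξ : ℝ) : ℝ := √(b ξ)

/-- `-i` times the symbol of `B L^{-1/2} ∂_x`. -/
def sf (l b : ℝ → ℝ) (ξ : ℝ) : ℝ := ξ * (b ξ / √(l ξ))

/-- `-i` times the symbol of `L^{1/2} ∂_x`. -/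
def phase (l : ℝ → ℝ) (ξ : ℝ) : ℝ := ξ * √(l ξ)

/-- `B^{1/2} L^{-1/2}`. -/
def opK (l b : ℝ → ℝ) : RealL2 →L[ℝ] RealL2 := T fun ξ => (kf l b ξ : ℂ)

/-- `L^{-1/2}`. -/
def opD (l : ℝ → ℝ) : RealL2 →L[ℝ] RealL2 := T fun ξ => (df l ξ : ℂ)

/-- `B^{1/2}`. -/
def opB (b : ℝ → ℝ) : RealL2 →L[ℝ] RealL2 := T fun ξ => (bf b ξ : ℂ)

/-- `B L^{-1/2} ∂_x`. -/
def opS (l b : ℝ → ℝ) : RealL2 →L[ℝ] RealL2 := T fun ξ => Complex.I * (sf l b ξ : ℂ)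

namespace Admissible

variable {ρ r c₁ c₂ c₃ c₄ : ℝ} {l b : ℝ → ℝ}

lemma l_pos (h : Admissible ρ r c₁ c₂ c₃ c₄ l b) (ξ : ℝ) : 0 < l ξ :=
  lt_of_lt_of_le (mul_pos (pow_pos h.hc₁ 2) (Real.rpow_pos_of_pos (by positivity) _)) (h.hl ξ).1

lemma b_pos (h : Admissible ρ r c₁ c₂ c₃ c₄ l b) (ξ : ℝ) : 0 < b ξ :=
  lt_of_lt_of_le (mul_pos (pow_pos h.hc₃ 2) (Real.rpow_pos_of_pos (by positivity) _)) (h.hb ξ).1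

lemma sqrt_l_smooth (h : Admissible ρ r c₁ c₂ c₃ c₄ l b) : ContDiff ℝ ∞ fun ξ => √(l ξ) :=
  h.l_smooth.sqrt fun ξ => (h.l_pos ξ).ne'

lemma kf_smooth (h : Admissible ρ r c₁ c₂ c₃ c₄ l b) : ContDiff ℝ ∞ (kf l b) :=
  (h.b_smooth.div h.l_smooth fun ξ => (h.l_pos ξ).ne').sqrt
    fun ξ => (div_pos (h.b_pos ξ) (h.l_pos ξ)).ne'

lemma df_smooth (h : Admissible ρ r c₁ c₂ c₃ c₄ l b) : ContDiff ℝ ∞ (df l) :=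
  h.sqrt_l_smooth.inv fun ξ => (Real.sqrt_pos.2 (h.l_pos ξ)).ne'

lemma bf_smooth (h : Admissible ρ r c₁ c₂ c₃ c₄ l b) : ContDiff ℝ ∞ (bf b) :=
  h.b_smooth.sqrt fun ξ => (h.b_pos ξ).ne'

lemma sf_smooth (h : Admissible ρ r c₁ c₂ c₃ c₄ l b) : ContDiff ℝ ∞ (sf l b) :=
  contDiff_id.mul (h.b_smooth.div h.sqrt_l_smooth fun ξ => (Real.sqrt_pos.2 (h.l_pos ξ)).ne')

lemma phase_smooth (h : Admissible ρ r c₁ c₂ c₃ c₄ l b) : ContDiff ℝ ∞ (phase l) :=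
  contDiff_id.mul h.sqrt_l_smooth

lemma isPhase (h : Admissible ρ r c₁ c₂ c₃ c₄ l b) : IsPhase (phase l) :=
  ⟨h.phase_smooth.continuous.measurable, fun ξ => by simp [phase, h.l_even]⟩

lemma comparable_k (h : Admissible ρ r c₁ c₂ c₃ c₄ l b) :
    Comparable (s0 ρ r) (kf l b) (c₃ / c₂) (c₄ / c₁) := by
  have key : ∀ ξ, weight (s0 ρ r) ξ * kf l b ξ =
      √(((1 + ξ ^ 2) ^ (r / 2) * b ξ) * ((1 + ξ ^ 2) ^ (ρ / 2) / l ξ)) := by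
    intro ξ
    have hJ : (0 : ℝ) < 1 + ξ ^ 2 := by positivity
    have e : weight (s0 ρ r) ξ = √((1 + ξ ^ 2) ^ (r / 2) * (1 + ξ ^ 2) ^ (ρ / 2)) := by
      rw [← Real.rpow_add hJ, Real.sqrt_eq_rpow, ← Real.rpow_mul hJ.le, weight, s0]
      congr 1; ring
    rw [e, kf, ← Real.sqrt_mul (by positivity)]
    congr 1; ring
  have hA : ∀ ξ, c₃ ^ 2 ≤ (1 + ξ ^ 2) ^ (r / 2) * b ξ ∧ (1 + ξ ^ 2) ^ (r / 2) * b ξ ≤ c₄ ^ 2 := by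
    intro ξ
    have hJ : (0 : ℝ) < 1 + ξ ^ 2 := by positivity
    have hA : (0 : ℝ) < (1 + ξ ^ 2) ^ (r / 2) := by positivity
    have h1 := h.hb ξ
    rw [Real.rpow_neg hJ.le, ← div_eq_mul_inv, ← div_eq_mul_inv, div_le_iff₀ hA,
        le_div_iff₀ hA] at h1
    constructor <;> linarith [h1.1, h1.2]
  have hB : ∀ ξ, 1 / c₂ ^ 2 ≤ (1 + ξ ^ 2) ^ (ρ / 2) / l ξ ∧
      (1 + ξ ^ 2) ^ (ρ / 2) / l ξ ≤ 1 / c₁ ^ 2 := by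
    intro ξ
    have h1 := h.hl ξ
    have := h.hc₁
    have := h.hc₂
    rw [div_le_div_iff₀ (by positivity) (h.l_pos ξ), div_le_div_iff₀ (h.l_pos ξ) (by positivity)]
    constructor <;> linarith [h1.1, h1.2]
  refine ⟨?_, h.kf_smooth.continuous.measurable, fun ξ => by simp [kf, h.l_even, h.b_even],
    div_pos h.hc₃ h.hc₂, fun ξ => ?_, fun ξ => ?_⟩
  · have := h.hρ
    have := h.hr
    unfold s0; positivity
  · rw [key]
    refine Real.le_sqrt_of_sq_le ?_
    rw [div_pow, div_eq_mul_one_div]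
    have := h.hc₂
    exact mul_le_mul (hA ξ).1 (hB ξ).1 (by positivity)
      (mul_nonneg (by positivity) (h.b_pos ξ).le)
  · rw [key]
    refine Real.sqrt_le_iff.2 ⟨(div_pos h.hc₄ h.hc₁).le, ?_⟩
    rw [div_pow, div_eq_mul_one_div (c₄ ^ 2)]
    exact mul_le_mul (hA ξ).2 (hB ξ).2 (div_nonneg (by positivity) (h.l_pos ξ).le) (by positivity)

lemma comparable_b (h : Admissible ρ r c₁ c₂ c₃ c₄ l b) :
    Comparable (s0 ρ r - ρ / 2) (bf b) c₃ c₄ := by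
  have key : ∀ ξ, weight (s0 ρ r - ρ / 2) ξ * bf b ξ = √((1 + ξ ^ 2) ^ (r / 2) * b ξ) := by
    intro ξ
    have hJ : (0 : ℝ) < 1 + ξ ^ 2 := by positivity
    have e : weight (s0 ρ r - ρ / 2) ξ = √((1 + ξ ^ 2) ^ (r / 2)) := by
      rw [Real.sqrt_eq_rpow, ← Real.rpow_mul hJ.le, weight, s0]
      congr 1; ring
    rw [e, bf, ← Real.sqrt_mul (by positivity)]
  have hA : ∀ ξ, c₃ ^ 2 ≤ (1 + ξ ^ 2) ^ (r / 2) * b ξ ∧ (1 + ξ ^ 2) ^ (r / 2) * b ξ ≤ c₄ ^ 2 := by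
    intro ξ
    have hJ : (0 : ℝ) < 1 + ξ ^ 2 := by positivity
    have hA : (0 : ℝ) < (1 + ξ ^ 2) ^ (r / 2) := by positivity
    have h1 := h.hb ξ
    rw [Real.rpow_neg hJ.le, ← div_eq_mul_inv, ← div_eq_mul_inv, div_le_iff₀ hA,
        le_div_iff₀ hA] at h1
    constructor <;> linarith [h1.1, h1.2]
  refine ⟨?_, h.bf_smooth.continuous.measurable, fun ξ => by simp [bf, h.b_even],
    h.hc₃, fun ξ => ?_, fun ξ => ?_⟩
  · have := h.hr
    unfold s0; linarith
  · rw [key]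
    exact Real.le_sqrt_of_sq_le (hA ξ).1
  · rw [key]
    exact Real.sqrt_le_iff.2 ⟨h.hc₄.le, (hA ξ).2⟩

lemma sqrt_l_ge (h : Admissible ρ r c₁ c₂ c₃ c₄ l b) (ξ : ℝ) :
    c₁ * (1 + ξ ^ 2) ^ (ρ / 4) ≤ √(l ξ) := by
  have hJ : (0 : ℝ) < 1 + ξ ^ 2 := by positivity
  refine Real.le_sqrt_of_sq_le ?_
  rw [mul_pow, ← Real.rpow_natCast _ 2, ← Real.rpow_natCast _ 2, ← Real.rpow_mul hJ.le]
  have := (h.hl ξ).1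
  convert this using 2
  · norm_num
  · congr 1; push_cast; ring

lemma df_pos (h : Admissible ρ r c₁ c₂ c₃ c₄ l b) (ξ : ℝ) : 0 < df l ξ :=
  inv_pos.2 (Real.sqrt_pos.2 (h.l_pos ξ))

lemma df_le (h : Admissible ρ r c₁ c₂ c₃ c₄ l b) (ξ : ℝ) : df l ξ ≤ c₁⁻¹ := by
  refine inv_anti₀ h.hc₁ (le_trans ?_ (h.sqrt_l_ge ξ))
  exact le_mul_of_one_le_right h.hc₁.le
    (Real.one_le_rpow (by nlinarith [sq_nonneg ξ]) (by have := h.hρ; positivity))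

lemma isSymbol_d (h : Admissible ρ r c₁ c₂ c₃ c₄ l b) : IsSymbol fun ξ => (df l ξ : ℂ) :=
  .ofReal h.df_smooth.continuous.measurable (fun ξ => by simp [df, h.l_even])
    fun ξ => by rw [abs_of_pos (h.df_pos ξ)]; exact h.df_le ξ

lemma isSymbol_k (h : Admissible ρ r c₁ c₂ c₃ c₄ l b) : IsSymbol fun ξ => (kf l b ξ : ℂ) :=
  h.comparable_k.isSymbol

lemma isSymbol_b (h : Admissible ρ r c₁ c₂ c₃ c₄ l b) : IsSymbol fun ξ => (bf b ξ : ℂ) :=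
  h.comparable_b.isSymbol

/-- This is where `r + ρ/2 ≥ 1` enters: `|ξ| ≤ (1 + ξ²)^{r/2 + ρ/4}`, so the decay of `b/√l` absorbs
the derivative and the forcing is bounded on `L²`. -/
lemma isSymbol_s (h : Admissible ρ r c₁ c₂ c₃ c₄ l b) :
    IsSymbol fun ξ => Complex.I * (sf l b ξ : ℂ) := by
  refine .ofReal_I (C := c₄ ^ 2 / c₁) h.sf_smooth.continuous.measurable
    (fun ξ => by simp [sf, h.l_even, h.b_even]) fun ξ => ?_
  have hJ : (0 : ℝ) < 1 + ξ ^ 2 := by positivity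
  have hJ1 : (1 : ℝ) ≤ 1 + ξ ^ 2 := by nlinarith [sq_nonneg ξ]
  have hs : 0 < √(l ξ) := Real.sqrt_pos.2 (h.l_pos ξ)
  have h1 : |ξ| ≤ (1 + ξ ^ 2) ^ (r / 2) * (1 + ξ ^ 2) ^ (ρ / 4) := by
    calc |ξ| ≤ (1 + ξ ^ 2) ^ (1 / 2 : ℝ) := by
          rw [← Real.sqrt_eq_rpow]
          exact Real.abs_le_sqrt (by linarith)
      _ ≤ (1 + ξ ^ 2) ^ (r / 2 + ρ / 4) :=
          Real.rpow_le_rpow_of_exponent_le hJ1 (by linarith [h.hrρ])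
      _ = _ := Real.rpow_add hJ _ _
  have h2 : |ξ| * b ξ ≤ c₄ ^ 2 * (1 + ξ ^ 2) ^ (ρ / 4) := by
    have hA : (0 : ℝ) < (1 + ξ ^ 2) ^ (r / 2) := by positivity
    have h3 := (h.hb ξ).2
    rw [Real.rpow_neg hJ.le, ← div_eq_mul_inv, le_div_iff₀ hA] at h3
    calc |ξ| * b ξ ≤ (1 + ξ ^ 2) ^ (r / 2) * (1 + ξ ^ 2) ^ (ρ / 4) * b ξ :=
          mul_le_mul_of_nonneg_right h1 (h.b_pos ξ).le
      _ = (b ξ * (1 + ξ ^ 2) ^ (r / 2)) * (1 + ξ ^ 2) ^ (ρ / 4) := by ring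
      _ ≤ _ := mul_le_mul_of_nonneg_right h3 (by positivity)
  rw [sf, abs_mul, abs_of_pos (div_pos (h.b_pos ξ) hs), ← mul_div_assoc,
    div_le_div_iff₀ hs h.hc₁]
  calc |ξ| * b ξ * c₁ ≤ c₄ ^ 2 * (1 + ξ ^ 2) ^ (ρ / 4) * c₁ :=
        mul_le_mul_of_nonneg_right h2 h.hc₁.le
    _ = c₄ ^ 2 * (c₁ * (1 + ξ ^ 2) ^ (ρ / 4)) := by ring
    _ ≤ _ := mul_le_mul_of_nonneg_left (h.sqrt_l_ge ξ) (by positivity)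

/-- The squared symbol is of size `(1 + ξ²)^{-s₀}`, so `2 s₀ = r + ρ > 1` is needed. For `ρ > 0`
this follows from `r + ρ/2 ≥ 1`; for `ρ = 0` it is the exclusion of `r = 1`. -/
lemma integrable_kf_sq (h : Admissible ρ r c₁ c₂ c₃ c₄ l b) :
    Integrable fun η => (kf l b (2 * Real.pi * η)) ^ 2 := by
  have hs : 1 < 2 * s0 ρ r := by
    have h1 := h.hρ
    have h2 := h.hrρ
    rw [s0]
    rcases h1.eq_or_lt with h3 | h3
    · have : r ≠ 1 := fun h4 => h.hne (by rw [← h3, h4])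
      have : 1 < r := lt_of_le_of_ne (by linarith) (Ne.symm this)
      linarith
    · linarith
  have hi : Integrable (fun ξ => (kf l b ξ) ^ 2) := by
    have h1 := integrable_rpow_neg_one_add_norm_sq (E := ℝ) (μ := volume) (r := 2 * s0 ρ r)
      (by simpa using hs)
    refine (h1.const_mul ((c₄ / c₁) ^ 2)).mono'
      (h.kf_smooth.continuous.pow 2).aestronglyMeasurable (Eventually.of_forall fun ξ => ?_)
    have hJ : (0 : ℝ) < 1 + ξ ^ 2 := by positivity
    have h2 := h.comparable_k.upper ξ
    have h3 : (weight (s0 ρ r) ξ * kf l b ξ) ^ 2 ≤ (c₄ / c₁) ^ 2 :=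
      pow_le_pow_left₀ (mul_pos (weight_pos _ _) (h.comparable_k.k_pos ξ)).le h2 2
    have h4 : (weight (s0 ρ r) ξ) ^ 2 * (1 + ξ ^ 2) ^ (-(2 * s0 ρ r) / 2) = 1 := by
      rw [weight, ← Real.rpow_natCast _ 2, ← Real.rpow_mul hJ.le, ← Real.rpow_add hJ,
        show s0 ρ r / 2 * ((2 : ℕ) : ℝ) + -(2 * s0 ρ r) / 2 = 0 by push_cast; ring, Real.rpow_zero]
    rw [Real.norm_of_nonneg (sq_nonneg _), Real.norm_eq_abs, sq_abs]
    calc (kf l b ξ) ^ 2 =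
        (weight (s0 ρ r) ξ * kf l b ξ) ^ 2 * (1 + ξ ^ 2) ^ (-(2 * s0 ρ r) / 2) := by
          rw [mul_pow, mul_right_comm, h4, one_mul]
      _ ≤ _ := mul_le_mul_of_nonneg_right h3 (by positivity)
  exact (integrable_comp_mul_left_iff (fun ξ => (kf l b ξ) ^ 2) (by positivity)).2 hi

/-- The constant of the embedding `H^{s₀} ⊆ L^∞`. -/
lemma exists_sup_bound (h : Admissible ρ r c₁ c₂ c₃ c₄ l b) :
    ∃ C, 0 ≤ C ∧ ∀ U, ∀ᵐ x, |opK l b U x| ≤ C * ‖U‖ :=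
  ⟨_, Real.sqrt_nonneg _, ae_abs_T_le h.isSymbol_k h.kf_smooth h.integrable_kf_sq⟩

lemma norm_opD_le (h : Admissible ρ r c₁ c₂ c₃ c₄ l b) (f : RealL2) : ‖opD l f‖ ≤ c₁⁻¹ * ‖f‖ :=
  norm_T_le h.isSymbol_d (fun ξ => by
    rw [Complex.norm_real, Real.norm_of_nonneg (h.df_pos ξ).le]; exact h.df_le ξ) f

lemma inner_T_ofReal {m : ℝ → ℝ} (hm : IsSymbol fun ξ => (m ξ : ℂ)) (f g : RealL2) :
    ⟪T (fun ξ => (m ξ : ℂ)) f, g⟫_ℝ = ⟪f, T (fun ξ => (m ξ : ℂ)) g⟫_ℝ := by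
  rw [inner_T_left hm]; simp

lemma inner_opD (h : Admissible ρ r c₁ c₂ c₃ c₄ l b) (f g : RealL2) :
    ⟪opD l f, g⟫_ℝ = ⟪f, opD l g⟫_ℝ := inner_T_ofReal h.isSymbol_d f g

lemma inner_opK (h : Admissible ρ r c₁ c₂ c₃ c₄ l b) (f g : RealL2) :
    ⟪opK l b f, g⟫_ℝ = ⟪f, opK l b g⟫_ℝ := inner_T_ofReal h.isSymbol_k f g

lemma df_mul_bf (h : Admissible ρ r c₁ c₂ c₃ c₄ l b) (ξ : ℝ) : df l ξ * bf b ξ = kf l b ξ := by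
  rw [df, bf, kf, Real.sqrt_div (h.b_pos ξ).le]; ring

lemma opD_opB (h : Admissible ρ r c₁ c₂ c₃ c₄ l b) (f : RealL2) :
    opD l (opB b f) = opK l b f := by
  rw [opD, opB, T_T h.isSymbol_d h.isSymbol_b, opK]
  congr 2; funext ξ
  exact_mod_cast h.df_mul_bf ξ

/-! ### The functionals in terms of `U = B^{-1/2} L^{1/2} u` and `W = B^{-1/2} w` -/

lemma mem_energySpace (h : Admissible ρ r c₁ c₂ c₃ c₄ l b) {u w : RealL2} :
    (u, w) ∈ energySpace ρ r ↔ ∃ U W, opK l b U = u ∧ opB b W = w := by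
  constructor
  · rintro ⟨h1, h2⟩
    obtain ⟨U, hU⟩ := h.comparable_k.exists_eq_T h1
    obtain ⟨W, hW⟩ := h.comparable_b.exists_eq_T h2
    exact ⟨U, W, hU, hW⟩
  · rintro ⟨U, W, rfl, rfl⟩
    exact ⟨h.comparable_k.memH_T U, h.comparable_b.memH_T W⟩

lemma invSqrtB_opB (h : Admissible ρ r c₁ c₂ c₃ c₄ l b) (W : RealL2) :
    invSqrtB b (opB b W) = W := by
  have e : ∀ ξ, (((√(b ξ))⁻¹ : ℝ) : ℂ) * (bf b ξ : ℂ) = 1 := fun ξ => by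
    rw [← Complex.ofReal_mul, bf, inv_mul_cancel₀ (Real.sqrt_pos.2 (h.b_pos ξ)).ne']; simp
  rw [invSqrtB, multiplier_eq_op, opB, op_T (fun ξ => by simp [h.b_even]) h.isSymbol_b]
  · simp_rw [e]; exact T_one W
  · simp_rw [e]; simpa using IsSymbol.const 1

lemma invSqrtB_opK (h : Admissible ρ r c₁ c₂ c₃ c₄ l b) (U : RealL2) :
    invSqrtB b (opK l b U) = opD l U := by
  have e : ∀ ξ, (((√(b ξ))⁻¹ : ℝ) : ℂ) * (kf l b ξ : ℂ) = (df l ξ : ℂ) := fun ξ => by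
    rw [← Complex.ofReal_mul, ← h.df_mul_bf, bf, mul_left_comm,
      inv_mul_cancel₀ (Real.sqrt_pos.2 (h.b_pos ξ)).ne', mul_one]
  rw [invSqrtB, multiplier_eq_op, opK, op_T (fun ξ => by simp [h.b_even]) h.isSymbol_k]
  · simp_rw [e]; rfl
  · simp_rw [e]; exact h.isSymbol_d

lemma invSqrtBSqrtL_opK (h : Admissible ρ r c₁ c₂ c₃ c₄ l b) (U : RealL2) :
    invSqrtBSqrtL l b (opK l b U) = U := by
  have e : ∀ ξ, (((√(b ξ))⁻¹ * √(l ξ) : ℝ) : ℂ) * (kf l b ξ : ℂ) = 1 := fun ξ => by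
    rw [← Complex.ofReal_mul, ← h.df_mul_bf, bf, df]
    have h1 := (Real.sqrt_pos.2 (h.b_pos ξ)).ne'
    have h2 := (Real.sqrt_pos.2 (h.l_pos ξ)).ne'
    field_simp
    simp
  rw [invSqrtBSqrtL, multiplier_eq_op, opK,
    op_T (fun ξ => by simp [h.b_even, h.l_even]) h.isSymbol_k]
  · simp_rw [e]; exact T_one U
  · simp_rw [e]; simpa using IsSymbol.const 1

end Admissible

lemma integral_sq_eq (f : RealL2) : ∫ x, (f x) ^ 2 = ‖f‖ ^ 2 := by
  rw [← real_inner_self_eq_norm_sq, real_inner_eq_integral]; simp_rw [sq]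

/-- The quadratic functional `I_γ` in terms of `U = B^{-1/2} L^{1/2} u`. -/
def quadI (l : ℝ → ℝ) (γ : ℝ) (U : RealL2) : ℝ := 1 / 2 * ‖U‖ ^ 2 - γ ^ 2 / 2 * ‖opD l U‖ ^ 2

lemma Q_smul (p c : ℝ) (u : RealL2) : Q p (c • u) = |c| ^ (p + 1) * Q p u := by
  rw [Q, Q, ← integral_const_mul]
  refine integral_congr_ae ?_
  filter_upwards [Lp.coeFn_smul c u] with x hx
  rw [hx, Pi.smul_apply, smul_eq_mul, abs_mul, Real.mul_rpow (abs_nonneg _) (abs_nonneg _)]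

lemma quadI_smul (l : ℝ → ℝ) (γ c : ℝ) (U : RealL2) :
    quadI l γ (c • U) = c ^ 2 * quadI l γ U := by
  rw [quadI, quadI, map_smul, norm_smul, norm_smul, mul_pow, mul_pow, Real.norm_eq_abs,
      sq_abs]; ring

namespace Admissible

variable {ρ r c₁ c₂ c₃ c₄ : ℝ} {l b : ℝ → ℝ} {p γ : ℝ}

lemma Iaug_opK (h : Admissible ρ r c₁ c₂ c₃ c₄ l b) (U : RealL2) :
    Iaug l b γ (opK l b U) = quadI l γ U := by
  rw [Iaug, h.invSqrtBSqrtL_opK, h.invSqrtB_opK, integral_sq_eq, integral_sq_eq, quadI]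

/-- The momentum is `⟪W, L^{-1/2} U⟫`; completing the square in `W` leaves the term `-γ²/2 ‖L^{-1/2}
U‖²` that distinguishes `I_γ` from `I_0`. -/
lemma energy_add_momentum (h : Admissible ρ r c₁ c₂ c₃ c₄ l b) (U W : RealL2) :
    energy l b p (opK l b U) (opB b W) + γ * momentum b (opK l b U) (opB b W) =
      1 / 2 * ‖W + γ • opD l U‖ ^ 2 + quadI l γ U - 1 / (p + 1) * Q p (opK l b U) := by
  rw [energy, momentum, h.invSqrtBSqrtL_opK, h.invSqrtB_opK, h.invSqrtB_opB,
    ← real_inner_eq_integral, quadI, norm_add_sq_real, inner_smul_right, norm_smul, mul_pow,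
    Real.norm_eq_abs, sq_abs]
  ring

lemma quadI_ge (h : Admissible ρ r c₁ c₂ c₃ c₄ l b) (U : RealL2) :
    1 / 2 * (1 - (γ / c₁) ^ 2) * ‖U‖ ^ 2 ≤ quadI l γ U := by
  have h1 := pow_le_pow_left₀ (norm_nonneg _) (h.norm_opD_le U) 2
  rw [quadI]
  have h2 := mul_le_mul_of_nonneg_left h1 (show 0 ≤ γ ^ 2 / 2 by positivity)
  have e : γ ^ 2 / 2 * (c₁⁻¹ * ‖U‖) ^ 2 = 1 / 2 * (γ / c₁) ^ 2 * ‖U‖ ^ 2 := by ring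
  rw [e] at h2
  linarith

lemma one_sub_sq_pos (h : Admissible ρ r c₁ c₂ c₃ c₄ l b) (hγ : |γ| < c₁) :
    0 < 1 - (γ / c₁) ^ 2 := by
  have : |γ / c₁| < 1 := by
    rw [abs_div, abs_of_pos h.hc₁, div_lt_one h.hc₁]; exact hγ
  have := (sq_lt_one_iff_abs_lt_one _).2 this
  linarith

lemma quadI_nonneg (h : Admissible ρ r c₁ c₂ c₃ c₄ l b) (hγ : |γ| < c₁) (U : RealL2) :
    0 ≤ quadI l γ U :=
  (mul_nonneg (mul_nonneg (by norm_num) (h.one_sub_sq_pos hγ).le) (sq_nonneg _)).trans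
    (h.quadI_ge U)

/-- On `{2 I_γ ≥ Q}` the augmented energy controls `I_γ`. -/
lemma quadI_le_energy (hp : 1 < p) {U W : RealL2}
    (hQ : Q p (opK l b U) ≤ 2 * quadI l γ U) :
    (p - 1) / (p + 1) * quadI l γ U ≤
      1 / 2 * ‖W + γ • opD l U‖ ^ 2 + quadI l γ U - 1 / (p + 1) * Q p (opK l b U) := by
  have h1 : 1 / (p + 1) * Q p (opK l b U) ≤ 1 / (p + 1) * (2 * quadI l γ U) :=
    mul_le_mul_of_nonneg_left hQ (by positivity)
  have e : (p - 1) / (p + 1) * quadI l γ U = quadI l γ U - 1 / (p + 1) * (2 * quadI l γ U) := by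
    have : p + 1 ≠ 0 := by linarith
    field_simp; ring
  rw [e]
  nlinarith [sq_nonneg ‖W + γ • opD l U‖]

/-- The choice `W = -γ L^{-1/2} U` annihilates the square. That the infimum is over a set bounded
below, by `0`, rests on `|γ| < c₁`. -/
lemma critEnergy_le (h : Admissible ρ r c₁ c₂ c₃ c₄ l b) (hp : 1 < p) (hγ : |γ| < c₁)
    {U : RealL2} (hU : U ≠ 0) (hN : 2 * quadI l γ U - Q p (opK l b U) = 0) :
    critEnergy l b ρ r p γ ≤ (p - 1) / (p + 1) * quadI l γ U := by
  refine csInf_le ⟨0, ?_⟩ ⟨opK l b U, opB b (-(γ • opD l U)),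
    h.mem_energySpace.2 ⟨_, _, rfl, rfl⟩, fun e => hU (h.comparable_k.T_injective
      (e.trans (map_zero (opK l b)).symm)), by rwa [h.Iaug_opK], ?_⟩
  · rintro e ⟨u, w, h1, -, h2, rfl⟩
    obtain ⟨U, W, rfl, rfl⟩ := h.mem_energySpace.1 h1
    rw [h.Iaug_opK] at h2
    rw [h.energy_add_momentum]
    exact (mul_nonneg (div_nonneg (by linarith) (by linarith)) (h.quadI_nonneg hγ U)).trans
      (quadI_le_energy hp (by linarith))
  · rw [h.energy_add_momentum, neg_add_cancel, norm_zero,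
      show Q p (opK l b U) = 2 * quadI l γ U by linarith]
    have : p + 1 ≠ 0 := by linarith
    field_simp; ring

/-- Below the critical level, `Q ≤ 2 I_γ`. -/
lemma Q_le_of_quadI_lt (h : Admissible ρ r c₁ c₂ c₃ c₄ l b) (hp : 1 < p) (hγ : |γ| < c₁)
    {U : RealL2} (hU : (p - 1) / (p + 1) * quadI l γ U < critEnergy l b ρ r p γ) :
    Q p (opK l b U) ≤ 2 * quadI l γ U := by
  by_contra! hQ
  have hI := h.quadI_nonneg hγ U
  have hU0 : U ≠ 0 := by
    rintro rfl
    have h1 := Q_smul p 0 (opK l b 0)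
    rw [abs_zero, Real.zero_rpow (by linarith), zero_mul, zero_smul] at h1
    rw [map_zero, h1] at hQ
    linarith
  have hIpos : 0 < quadI l γ U :=
    (mul_pos (mul_pos (by norm_num) (h.one_sub_sq_pos hγ)) (by positivity)).trans_le (h.quadI_ge U)
  set q := Q p (opK l b U) with hq
  have hqpos : 0 < q := by linarith
  -- The factor that puts `c • U` on `2 I_γ = Q`: it solves `c^{p+1} q = 2 c² I_γ`. Since `q > 2
  -- I_γ`, it is at most `1`, so the level does not rise and stays below the infimum, a
  -- contradiction.
  set c := (2 * quadI l γ U / q) ^ (1 / (p - 1)) with hc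
  have hcpos : 0 < c := by positivity
  have hc1 : c ≤ 1 := Real.rpow_le_one (by positivity)
    (by rw [div_le_one hqpos]; linarith) (by have : 0 < p - 1 := by linarith
                                             positivity)
  have hcp : c ^ (p + 1) * q = 2 * (c ^ 2 * quadI l γ U) := by
    have e : c ^ (p + 1) = c ^ (p - 1) * c ^ 2 := by
      rw [← Real.rpow_natCast c 2, ← Real.rpow_add hcpos]; congr 1; push_cast; ring
    have e2 : c ^ (p - 1) = 2 * quadI l γ U / q := by
      rw [hc, ← Real.rpow_mul (by positivity), one_div_mul_cancel (by linarith), Real.rpow_one]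
    rw [e, e2]; field_simp
  have h1 := h.critEnergy_le hp hγ (U := c • U) (smul_ne_zero hcpos.ne' hU0) (by
    rw [map_smul, Q_smul, quadI_smul, abs_of_pos hcpos, hcp]; ring)
  rw [quadI_smul] at h1
  have h2 : c ^ 2 * quadI l γ U ≤ quadI l γ U := mul_le_of_le_one_left hI (pow_le_one₀ hcpos.le hc1)
  have h3 := mul_le_mul_of_nonneg_left h2 (show 0 ≤ (p - 1) / (p + 1) from
    div_nonneg (by linarith) (by linarith))
  linarith

end Admissible

/-! ### The equation in the interaction picture -/

section Flow

variable (l b : ℝ → ℝ) (p R : ℝ)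

/-- The displacement `u` in terms of the interaction picture variables. -/
def disp (t : ℝ) (y : RealL2 × RealL2) : RealL2 :=
  (1 / 2 : ℝ) • (grp (phase l) t y.1 + grp (phase l) (-t) y.2)

/-- The forcing `B L^{-1/2} ∂_x g(u)`. -/
def force (t : ℝ) (y : RealL2 × RealL2) : RealL2 := opS l b (nl p R (disp l t y))

/-- The right hand side of the equation in the interaction picture. -/
def field (t : ℝ) (y : RealL2 × RealL2) : RealL2 × RealL2 :=
  (grp (phase l) (-t) (force l b p R t y), -grp (phase l) t (force l b p R t y))

/-- The sharp frequency projection on pairs. -/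
def projPair (n : ℕ) : RealL2 × RealL2 →L[ℝ] RealL2 × RealL2 :=
  (T (proj n)).prodMap (T (proj n))

/-- The frequency truncated right hand side. -/
def fieldCut (n : ℕ) (t : ℝ) (y : RealL2 × RealL2) : RealL2 × RealL2 :=
  projPair n (field l b p R t (projPair n y))

/-- A Lipschitz constant of the right hand side. -/
def fieldLip : ℝ≥0 := ‖opS l b‖₊ * lipConst p R

end Flow

lemma proj_proj (n : ℕ) (f : RealL2) : T (proj n) (T (proj n) f) = T (proj n) f := by
  rw [T_T (isSymbol_proj n) (isSymbol_proj n)]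
  congr 2; funext ξ
  simp only [proj, cut]; split_ifs <;> simp

lemma norm_projPair_apply_le (n : ℕ) (y : RealL2 × RealL2) : ‖projPair n y‖ ≤ ‖y‖ := by
  have h : ∀ f, ‖T (proj n) f‖ ≤ ‖f‖ := fun f => by
    simpa using norm_T_le (isSymbol_proj n) (norm_proj_le n) f
  exact max_le_max (h _) (h _)

lemma norm_projPair_le (n : ℕ) : ‖projPair n‖ ≤ 1 :=
  (projPair n).opNorm_le_bound zero_le_one fun y => by
    rw [one_mul]; exact norm_projPair_apply_le n y

lemma tendsto_projPair (y : RealL2 × RealL2) : Tendsto (fun n => projPair n y) atTop (𝓝 y) :=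
  (tendsto_proj y.1).prodMk_nhds (tendsto_proj y.2)

namespace Admissible

variable {ρ r c₁ c₂ c₃ c₄ : ℝ} {l b : ℝ → ℝ} {p R γ : ℝ}

lemma norm_disp_sub_le (h : Admissible ρ r c₁ c₂ c₃ c₄ l b) (t : ℝ) (y z : RealL2 × RealL2) :
    ‖disp l t y - disp l t z‖ ≤ ‖y - z‖ := by
  have e : disp l t y - disp l t z =
      (1 / 2 : ℝ) • (grp (phase l) t (y - z).1 + grp (phase l) (-t) (y - z).2) := by
    simp only [disp, Prod.fst_sub, Prod.snd_sub, map_sub]; module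
  rw [e, norm_smul]
  have h1 := norm_add_le (grp (phase l) t (y - z).1) (grp (phase l) (-t) (y - z).2)
  rw [norm_grp h.isPhase, norm_grp h.isPhase] at h1
  have h2 := norm_fst_le (y - z)
  have h3 := norm_snd_le (y - z)
  rw [Real.norm_of_nonneg (by norm_num)]
  linarith

lemma lipschitz_force (h : Admissible ρ r c₁ c₂ c₃ c₄ l b) (hp : 1 < p) (hR : 0 ≤ R) (t : ℝ) :
    LipschitzWith (fieldLip l b p R) (force l b p R t) := by
  have h1 : LipschitzWith 1 (disp l t) := LipschitzWith.of_dist_le_mul fun y z => by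
    simpa [dist_eq_norm] using h.norm_disp_sub_le t y z
  have := (opS l b).lipschitz.comp ((lipschitz_nl hp hR).comp h1)
  rwa [mul_one] at this

lemma lipschitz_field (h : Admissible ρ r c₁ c₂ c₃ c₄ l b) (hp : 1 < p) (hR : 0 ≤ R) (t : ℝ) :
    LipschitzWith (fieldLip l b p R) (field l b p R t) := by
  refine LipschitzWith.of_dist_le_mul fun y z => ?_
  have h1 := (h.lipschitz_force hp hR t).dist_le_mul y z
  rw [Prod.dist_eq]
  refine max_le ?_ ?_
  · simp only [field]
    rwa [dist_eq_norm, ← map_sub, norm_grp h.isPhase, ← dist_eq_norm]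
  · simp only [field]
    rwa [dist_neg_neg, dist_eq_norm, ← map_sub, norm_grp h.isPhase, ← dist_eq_norm]

lemma continuous_disp_comp (h : Admissible ρ r c₁ c₂ c₃ c₄ l b) {y : ℝ → RealL2 × RealL2}
    (hy : Continuous y) : Continuous fun t => disp l t (y t) := by
  have h1 := continuous_grp_comp h.isPhase hy.fst
  have h2 : Continuous fun t => grp (phase l) (-t) (y t).2 := by
    have := (continuous_grp_comp h.isPhase (hy.snd.comp continuous_neg)).comp continuous_neg
    simpa [Function.comp_def] using this
  exact (h1.add h2).const_smul (1 / 2 : ℝ)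

lemma continuous_force_comp (h : Admissible ρ r c₁ c₂ c₃ c₄ l b) (hp : 1 < p) (hR : 0 ≤ R)
    {y : ℝ → RealL2 × RealL2} (hy : Continuous y) : Continuous fun t => force l b p R t (y t) :=
  (opS l b).continuous.comp ((lipschitz_nl hp hR).continuous.comp (h.continuous_disp_comp hy))

lemma continuous_field_comp (h : Admissible ρ r c₁ c₂ c₃ c₄ l b) (hp : 1 < p) (hR : 0 ≤ R)
    {y : ℝ → RealL2 × RealL2} (hy : Continuous y) : Continuous fun t => field l b p R t (y t) := by
  have h0 := h.continuous_force_comp hp hR hy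
  have h1 : Continuous fun t => grp (phase l) (-t) (force l b p R t (y t)) := by
    have := (continuous_grp_comp h.isPhase (h0.comp continuous_neg)).comp continuous_neg
    simpa [Function.comp_def] using this
  exact h1.prodMk (continuous_grp_comp h.isPhase h0).neg

lemma force_zero (hp : 1 < p) (hR : 0 ≤ R) (t : ℝ) : force l b p R t 0 = 0 := by
  simp [force, disp, nl_zero hp hR]

lemma field_zero (hp : 1 < p) (hR : 0 ≤ R) (t : ℝ) : field l b p R t 0 = 0 := by
  simp [field, force_zero hp hR]

lemma lipschitz_fieldCut (h : Admissible ρ r c₁ c₂ c₃ c₄ l b) (hp : 1 < p) (hR : 0 ≤ R) (n : ℕ)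
    (t : ℝ) : LipschitzWith (fieldLip l b p R) (fieldCut l b p R n t) := by
  have h1 : LipschitzWith 1 (projPair n) := LipschitzWith.of_dist_le_mul fun y z => by
    simpa [dist_eq_norm, ← map_sub] using norm_projPair_apply_le n (y - z)
  have := h1.comp ((h.lipschitz_field hp hR t).comp h1)
  rwa [mul_one, one_mul] at this

lemma exists_solution (h : Admissible ρ r c₁ c₂ c₃ c₄ l b) (hp : 1 < p) (hR : 0 ≤ R)
    (t₀ : ℝ) (y₀ : RealL2 × RealL2) :
    ∃ y : ℝ → RealL2 × RealL2, y t₀ = y₀ ∧ ∀ t, HasDerivAt y (field l b p R t (y t)) t :=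
  exists_global_solution_at (h.lipschitz_field hp hR)
    (fun _ => h.continuous_field_comp hp hR continuous_const) (field_zero hp hR) t₀ y₀

lemma exists_solution_cut (h : Admissible ρ r c₁ c₂ c₃ c₄ l b) (hp : 1 < p) (hR : 0 ≤ R) (n : ℕ)
    (t₀ : ℝ) (y₀ : RealL2 × RealL2) :
    ∃ y : ℝ → RealL2 × RealL2, y t₀ = y₀ ∧ ∀ t, HasDerivAt y (fieldCut l b p R n t (y t)) t :=
  exists_global_solution_at (h.lipschitz_fieldCut hp hR n)
    (fun _ => (projPair n).continuous.comp (h.continuous_field_comp hp hR continuous_const))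
    (fun t => by simp [fieldCut, field_zero hp hR]) t₀ y₀

/-- The truncated solutions converge to the solution. -/
lemma tendsto_solution_cut (h : Admissible ρ r c₁ c₂ c₃ c₄ l b) (hp : 1 < p) (hR : 0 ≤ R)
    {t₀ : ℝ} {y : ℝ → RealL2 × RealL2} (hy : ∀ t, HasDerivAt y (field l b p R t (y t)) t)
    {z : ℕ → ℝ → RealL2 × RealL2} (hz0 : ∀ n, z n t₀ = y t₀)
    (hz : ∀ n t, HasDerivAt (z n) (fieldCut l b p R n t (z n t)) t) (t : ℝ) :
    Tendsto (fun n => z n t) atTop (𝓝 (y t)) := by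
  set K := fieldLip l b p R with hK
  have cy : Continuous y := continuous_iff_continuousAt.2 fun t => (hy t).continuousAt
  have hg : Tendsto (fun ε => gronwallBound 0 K ε |t - t₀|) (𝓝 0) (𝓝 0) := by
    have := (gronwallBound_continuous_ε 0 K |t - t₀|).tendsto 0
    rwa [gronwallBound_ε0_δ0] at this
  rw [Metric.tendsto_nhds]
  intro δ hδ
  obtain ⟨ε, hεpos, hε⟩ : ∃ ε, 0 < ε ∧ gronwallBound 0 K ε |t - t₀| < δ := by
    have := ((hg.eventually (gt_mem_nhds hδ)).filter_mono (nhdsWithin_le_nhds (s := Ioi 0))).and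
      self_mem_nhdsWithin
    obtain ⟨ε, h1, h2⟩ := this.exists
    exact ⟨ε, h2, h1⟩
  have hs : IsCompact (Icc (t₀ - |t - t₀|) (t₀ + |t - t₀|)) := isCompact_Icc
  -- The full solution is an approximate trajectory of the truncated equation. With `P` the
  -- projection, its defect is `(1 - P) field(y)` plus `P (field(y) - field(P y))`, each at most
  -- `ε/2` on the compact time interval.
  have ev1 := eventually_forall_dist_le_of_strong norm_projPair_le tendsto_projPair cy hs
    (show 0 < ε / (2 * (K + 1)) by positivity)
  have ev2 := eventually_forall_dist_le_of_strong norm_projPair_le tendsto_projPair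
    (h.continuous_field_comp hp hR cy) hs (show 0 < ε / 2 by positivity)
  filter_upwards [ev1, ev2] with n h1 h2
  refine (dist_le_gronwallBound_abs (h.lipschitz_fieldCut hp hR n) (hz n) hy (hz0 n)
    (r := |t - t₀|) (ε := ε) (fun s hs => ?_) t le_rfl).trans_lt hε
  have hs' : s ∈ Icc (t₀ - |t - t₀|) (t₀ + |t - t₀|) := by
    rw [abs_le] at hs; constructor <;> linarith [hs.1, hs.2]
  have e1 : dist (field l b p R s (y s)) (projPair n (field l b p R s (y s))) ≤ ε / 2 := by
    rw [dist_comm, dist_eq_norm]; exact h2 s hs'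
  have e2 : dist (projPair n (field l b p R s (y s))) (fieldCut l b p R n s (y s)) ≤ ε / 2 := by
    rw [fieldCut, dist_eq_norm, ← map_sub]
    refine (norm_projPair_apply_le n _).trans ?_
    have h3 := (h.lipschitz_field hp hR s).norm_sub_le (y s) (projPair n (y s))
    rw [norm_sub_rev (y s)] at h3
    have h4 : (K : ℝ) * ‖projPair n (y s) - y s‖ ≤ K * (ε / (2 * (K + 1))) :=
      mul_le_mul_of_nonneg_left (h1 s hs') K.coe_nonneg
    have h5 : (K : ℝ) * (ε / (2 * (K + 1))) ≤ ε / 2 := by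
      rw [mul_div_assoc', div_le_div_iff₀ (by positivity) (by norm_num)]
      nlinarith [K.coe_nonneg]
    exact h3.trans (h4.trans h5)
  linarith [dist_triangle (field l b p R s (y s)) (projPair n (field l b p R s (y s)))
    (fieldCut l b p R n s (y s))]

end Admissible

/-! ### Conservation of the augmented energy for the truncated equation -/

/-- The inverse of `B^{1/2} L^{-1/2}` on low frequencies. -/
def kappa (l b : ℝ → ℝ) (n : ℕ) : ℝ → ℂ := cut n fun ξ => (((kf l b ξ)⁻¹ : ℝ) : ℂ)

/-- The operator `B^{1/2} ∂_x` on low frequencies. -/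
def xb (b : ℝ → ℝ) (n : ℕ) : ℝ → ℂ := cut n fun ξ => dx ξ * (bf b ξ : ℂ)

/-- The quadratic part of the augmented energy in terms of `V_± = U ± W`. -/
def quadH (l : ℝ → ℝ) (γ : ℝ) (V V' : RealL2) : ℝ :=
  1 / 4 * ((‖V‖ ^ 2 + γ * ⟪V, opD l V⟫_ℝ) + (‖V'‖ ^ 2 - γ * ⟪V', opD l V'⟫_ℝ))

namespace Admissible

variable {ρ r c₁ c₂ c₃ c₄ : ℝ} {l b : ℝ → ℝ} {p R γ : ℝ}

lemma isSymbol_kappa (h : Admissible ρ r c₁ c₂ c₃ c₄ l b) (n : ℕ) : IsSymbol (kappa l b n) :=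
  isSymbol_cut (Complex.continuous_ofReal.comp
    (h.kf_smooth.continuous.inv₀ fun ξ => (h.comparable_k.k_pos ξ).ne'))
    (fun ξ => by simp [kf, h.l_even, h.b_even]) n

lemma isSymbol_xb (h : Admissible ρ r c₁ c₂ c₃ c₄ l b) (n : ℕ) : IsSymbol (xb b n) :=
  isSymbol_cut (continuous_dx.mul (Complex.continuous_ofReal.comp h.bf_smooth.continuous))
    (fun ξ => by simp [dx, bf, h.b_even]) n

lemma kappa_proj (h : Admissible ρ r c₁ c₂ c₃ c₄ l b) (n : ℕ) (f : RealL2) :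
    T (kappa l b n) (T (proj n) f) = T (kappa l b n) f := by
  rw [T_T (h.isSymbol_kappa n) (isSymbol_proj n)]
  congr 2; funext ξ
  simp only [kappa, proj, cut]; split_ifs <;> simp

lemma opK_kappa (h : Admissible ρ r c₁ c₂ c₃ c₄ l b) (n : ℕ) (f : RealL2) :
    opK l b (T (kappa l b n) f) = T (proj n) f := by
  rw [opK, T_T h.isSymbol_k (h.isSymbol_kappa n)]
  congr 2; funext ξ
  simp only [kappa, proj, cut]
  split_ifs
  · rw [← Complex.ofReal_mul, mul_inv_cancel₀ (h.comparable_k.k_pos ξ).ne']; simp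
  · simp

lemma kappa_opK (h : Admissible ρ r c₁ c₂ c₃ c₄ l b) (n : ℕ) (f : RealL2) :
    T (kappa l b n) (opK l b f) = T (proj n) f := by
  rw [opK, T_comm (h.isSymbol_kappa n) h.isSymbol_k]
  exact h.opK_kappa n f

/-- On low frequencies `L^{1/2} B^{-1/2}` composed with `B L^{-1/2} ∂_x` is `B^{1/2} ∂_x`, and `∂_x`
is skew-adjoint. -/
lemma inner_kappa_opS (h : Admissible ρ r c₁ c₂ c₃ c₄ l b) (n : ℕ) (f g : RealL2) :
    ⟪f, T (kappa l b n) (opS l b g)⟫_ℝ = -⟪T (xb b n) f, g⟫_ℝ := by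
  rw [inner_T_left (h.isSymbol_xb n), opS, T_T (h.isSymbol_kappa n) h.isSymbol_s,
    ← inner_neg_right, ← T_neg (h.isSymbol_xb n).conjugate]
  congr 3; funext ξ
  simp only [kappa, xb, cut]
  split_ifs
  · have h1 := (Real.sqrt_pos.2 (h.b_pos ξ)).ne'
    have h2 := (Real.sqrt_pos.2 (h.l_pos ξ)).ne'
    have e : (kf l b ξ)⁻¹ * sf l b ξ = ξ * bf b ξ := by
      rw [← h.df_mul_bf, sf, df, bf]
      have h3 := Real.mul_self_sqrt (h.b_pos ξ).le
      field_simp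
      rw [pow_two, h3, mul_comm]
    have e' : (((kf l b ξ)⁻¹ : ℝ) : ℂ) * (sf l b ξ : ℂ) = (ξ : ℂ) * (bf b ξ : ℂ) := by
      exact_mod_cast e
    simp only [dx, map_mul, Complex.conj_I, Complex.conj_ofReal]
    linear_combination Complex.I * e'
  · simp

lemma isSymbol_phase_proj (h : Admissible ρ r c₁ c₂ c₃ c₄ l b) (n : ℕ) :
    IsSymbol fun ξ => Complex.I * (phase l ξ : ℂ) * proj n ξ := by
  have : (fun ξ => Complex.I * (phase l ξ : ℂ) * proj n ξ) =
      cut n fun ξ => Complex.I * (phase l ξ : ℂ) := by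
    funext ξ; simp [proj, cut]
  rw [this]
  exact isSymbol_cut (continuous_const.mul (Complex.continuous_ofReal.comp
    h.phase_smooth.continuous)) (fun ξ => by simp [phase, h.l_even]) n

lemma phase_proj_eq (h : Admissible ρ r c₁ c₂ c₃ c₄ l b) (n : ℕ) (f : RealL2) :
    T (fun ξ => Complex.I * (phase l ξ : ℂ) * proj n ξ) f = T (xb b n) (T (kappa l b n) f) := by
  rw [T_T (h.isSymbol_xb n) (h.isSymbol_kappa n)]
  congr 2; funext ξ
  simp only [kappa, xb, proj, cut]
  split_ifs
  · have h1 := (Real.sqrt_pos.2 (h.b_pos ξ)).ne'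
    have h2 := (Real.sqrt_pos.2 (h.l_pos ξ)).ne'
    have e : bf b ξ * (kf l b ξ)⁻¹ = √(l ξ) := by
      rw [← h.df_mul_bf, df, bf]; field_simp
    rw [dx, mul_assoc _ (bf b ξ : ℂ), ← Complex.ofReal_mul, e, phase]
    push_cast; ring
  · simp

/-- Turns the momentum part of the energy balance into `∫ g(u) u_x`, to which `inner_nl_deriv`
applies. -/
lemma xb_opD (h : Admissible ρ r c₁ c₂ c₃ c₄ l b) (n : ℕ) (f : RealL2) :
    T (xb b n) (opD l f) = T (cut n dx) (opK l b f) := by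
  rw [opD, opK, T_T (h.isSymbol_xb n) h.isSymbol_d,
    T_T (isSymbol_cut continuous_dx dx_neg n) h.isSymbol_k]
  congr 2; funext ξ
  simp only [xb, cut]
  split_ifs
  · rw [← h.df_mul_bf]; push_cast; ring
  · simp

/-- For `V = U + W` and `V' = U - W` the right hand side is the quadratic part of
`energy_add_momentum`. -/
lemma quadH_eq (h : Admissible ρ r c₁ c₂ c₃ c₄ l b) (V V' : RealL2) :
    quadH l γ V V' = 1 / 2 * ‖(1 / 2 : ℝ) • (V - V') + γ • opD l ((1 / 2 : ℝ) • (V + V'))‖ ^ 2 +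
      quadI l γ ((1 / 2 : ℝ) • (V + V')) := by
  have e : ⟪V', opD l V⟫_ℝ = ⟪V, opD l V'⟫_ℝ := by
    rw [← h.inner_opD, real_inner_comm]
  rw [norm_add_sq_real, quadI, quadH]
  simp only [map_smul, norm_smul, mul_pow, inner_smul_left, inner_smul_right, map_add,
    inner_sub_left, inner_add_right, norm_sub_sq_real, norm_add_sq_real, Real.norm_eq_abs,
        sq_abs, e]
  simp
  ring

/-- The groups are unitary and commute with `L^{-1/2}`, so the linear flow drops out of the
quadratic energy, even with independent times in the two slots. -/
lemma quadH_grp (h : Admissible ρ r c₁ c₂ c₃ c₄ l b) (s t : ℝ) (V V' : RealL2) :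
    quadH l γ (grp (phase l) s V) (grp (phase l) t V') = quadH l γ V V' := by
  have e : ∀ t V, ⟪grp (phase l) t V, opD l (grp (phase l) t V)⟫_ℝ = ⟪V, opD l V⟫_ℝ := by
    intro t V
    rw [inner_grp_left h.isPhase, opD, grp_comm h.isPhase h.isSymbol_d,
      grp_neg_grp h.isPhase]
  rw [quadH, quadH, norm_grp h.isPhase, norm_grp h.isPhase, e, e]

/-- Cauchy–Schwarz with `‖L^{-1/2}‖ ≤ 1/c₁`; for `|γ| < c₁` the constant is positive, so the
quadratic energy controls the norm. -/
lemma quadH_ge (h : Admissible ρ r c₁ c₂ c₃ c₄ l b) (V V' : RealL2) :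
    1 / 4 * (1 - |γ| / c₁) * (‖V‖ ^ 2 + ‖V'‖ ^ 2) ≤ quadH l γ V V' := by
  have e : ∀ V, |γ * ⟪V, opD l V⟫_ℝ| ≤ |γ| / c₁ * ‖V‖ ^ 2 := by
    intro V
    rw [abs_mul]
    have h1 := (abs_real_inner_le_norm V (opD l V)).trans
      (mul_le_mul_of_nonneg_left (h.norm_opD_le V) (norm_nonneg V))
    calc |γ| * |⟪V, opD l V⟫_ℝ| ≤ |γ| * (‖V‖ * (c₁⁻¹ * ‖V‖)) :=
          mul_le_mul_of_nonneg_left h1 (abs_nonneg _)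
      _ = _ := by ring
  have h1 := abs_le.1 (e V)
  have h2 := abs_le.1 (e V')
  rw [quadH]
  linarith [h1.1, h2.2]

/-- Conservation of the augmented energy for the truncated equation. -/
lemma hasDerivAt_energy_cut (h : Admissible ρ r c₁ c₂ c₃ c₄ l b) (hp : 1 < p) (hR : 0 ≤ R)
    (n : ℕ) {y : ℝ → RealL2 × RealL2} (hy : ∀ t, HasDerivAt y (fieldCut l b p R n t (y t)) t)
    (t : ℝ) :
    HasDerivAt (fun t => quadH l γ (T (kappa l b n) (y t).1) (T (kappa l b n) (y t).2) +
      potential p R (disp l t (projPair n (y t)))) 0 t := by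
  set P := T (proj n)
  set κ := T (kappa l b n)
  set X := T (xb b n)
  set g := nl p R (disp l t (projPair n (y t))) with hg
  set a := κ (y t).1 with ha
  set a' := κ (y t).2 with ha'
  set V := grp (phase l) t a with hV
  set V' := grp (phase l) (-t) a' with hV'
  have hph := h.isPhase
  have hκ := h.isSymbol_kappa n
  have hX := h.isSymbol_xb n
  have dy1 : HasDerivAt (fun t => (y t).1) (P (grp (phase l) (-t) (opS l b g))) t :=
    (hasFDerivAt_fst (p := y t)).comp_hasDerivAt t (hy t)
  have dy2 : HasDerivAt (fun t => (y t).2) (P (-grp (phase l) t (opS l b g))) t :=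
    (hasFDerivAt_snd (p := y t)).comp_hasDerivAt t (hy t)
  have da : HasDerivAt (fun t => κ (y t).1) (grp (phase l) (-t) (κ (opS l b g))) t := by
    have := κ.hasFDerivAt.comp_hasDerivAt t dy1
    rw [h.kappa_proj n, ← grp_comm hph hκ] at this
    exact this
  have da' : HasDerivAt (fun t => κ (y t).2) (-grp (phase l) t (κ (opS l b g))) t := by
    have := κ.hasFDerivAt.comp_hasDerivAt t dy2
    rw [h.kappa_proj n, map_neg, ← grp_comm hph hκ] at this
    exact this
  have hDD : ∀ x z, ⟪x, opD l z⟫_ℝ = ⟪opD l x, z⟫_ℝ := fun x z => (h.inner_opD x z).symm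
  have i1 : ∀ z, ⟪a, grp (phase l) (-t) (κ (opS l b z))⟫_ℝ = -⟪X V, z⟫_ℝ := by
    intro z
    rw [real_inner_comm, inner_grp_left hph, neg_neg, real_inner_comm]
    exact h.inner_kappa_opS n V z
  have i2 : ∀ z, ⟪a', grp (phase l) t (κ (opS l b z))⟫_ℝ = -⟪X V', z⟫_ℝ := by
    intro z
    rw [real_inner_comm, inner_grp_left hph, real_inner_comm]
    exact h.inner_kappa_opS n V' z
  have j1 : ⟪opD l a, grp (phase l) (-t) (κ (opS l b g))⟫_ℝ = -⟪X (opD l V), g⟫_ℝ := by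
    rw [real_inner_comm, inner_grp_left hph, neg_neg, real_inner_comm, opD,
      grp_comm hph h.isSymbol_d]
    exact h.inner_kappa_opS n (opD l V) g
  have j2 : ⟪opD l a', grp (phase l) t (κ (opS l b g))⟫_ℝ = -⟪X (opD l V'), g⟫_ℝ := by
    rw [real_inner_comm, inner_grp_left hph, real_inner_comm, opD, grp_comm hph h.isSymbol_d]
    exact h.inner_kappa_opS n (opD l V') g
  have dD : HasDerivAt (fun t => opD l (κ (y t).1))
      (opD l (grp (phase l) (-t) (κ (opS l b g)))) t := (opD l).hasFDerivAt.comp_hasDerivAt t da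
  have dD' : HasDerivAt (fun t => opD l (κ (y t).2))
      (opD l (-grp (phase l) t (κ (opS l b g)))) t := (opD l).hasFDerivAt.comp_hasDerivAt t da'
  -- Only the forcing contributes. The energy part pairs `g` with `X (V - V') = 2 u_t`, the momentum
  -- part with `X L^{-1/2} (V + V') = 2 u_x`.
  have dquad : HasDerivAt (fun t => quadH l γ (κ (y t).1) (κ (y t).2))
      (-(1 / 2 * ⟪X (V - V'), g⟫_ℝ) - 1 / 2 * γ * ⟪X (opD l (V + V')), g⟫_ℝ) t := by
    have := ((da.norm_sq.add ((da.inner ℝ dD).const_mul γ)).add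
      (da'.norm_sq.sub ((da'.inner ℝ dD').const_mul γ))).const_mul (1 / 4 : ℝ)
    refine this.congr_deriv ?_
    simp only [map_neg, inner_neg_right, inner_neg_left, ← ha, ← ha']
    rw [real_inner_comm (opD l a), real_inner_comm (opD l a'), hDD a, hDD a', i1, i2, j1, j2]
    simp only [map_add, map_sub, inner_add_left, inner_sub_left]
    ring
  -- The forcing enters the two components with opposite signs and cancels in `u`, leaving the
  -- contribution of the linear flow, `u_t = w_x`.
  have du : HasDerivAt (fun t => disp l t (projPair n (y t))) ((1 / 2 : ℝ) • X (V - V')) t := by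
    have hPg : ∀ s f, grp (phase l) s (P f) = P (grp (phase l) s f) := fun s f =>
      grp_comm hph (isSymbol_proj n) s f
    have hP1 : ∀ s, ‖P.comp (grp (phase l) s)‖ ≤ 1 := fun s =>
      ContinuousLinearMap.opNorm_le_bound _ zero_le_one fun f => by
        simpa [norm_grp hph] using norm_T_le (isSymbol_proj n) (norm_proj_le n) (grp (phase l) s f)
    have hc : ∀ f, Continuous fun s => P.comp (grp (phase l) s) f := fun f =>
      P.continuous.comp (continuous_grp hph f)
    have hd : ∀ f s, HasDerivAt (fun s => P.comp (grp (phase l) s) f)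
        (X (grp (phase l) s (κ f))) s := fun f s => by
      have := hasDerivAt_grp_T hph (isSymbol_proj n) (h.isSymbol_phase_proj n) f s
      rw [h.phase_proj_eq, grp_comm hph hX] at this
      exact this.congr_of_eventuallyEq (Eventually.of_forall fun s => (hPg s f).symm)
    have d1 := hasDerivAt_strong hP1 (fun f => (hc f).continuousAt) dy1 (hd (y t).1 t)
    have d2 := hasDerivAt_strong (A := fun s => P.comp (grp (phase l) (-s))) (fun s => hP1 (-s))
      (fun f => ((hc f).comp continuous_neg).continuousAt) dy2
      ((hd (y t).2 (-t)).scomp t (hasDerivAt_neg t))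
    refine ((d1.add d2).const_smul (1 / 2 : ℝ)).congr_of_eventuallyEq
      (Eventually.of_forall fun s => ?_) |>.congr_deriv ?_
    · change (1 / 2 : ℝ) • (grp (phase l) s (P (y s).1) + grp (phase l) (-s) (P (y s).2)) = _
      rw [hPg, hPg]
      rfl
    · simp only [ContinuousLinearMap.comp_apply, map_neg, hPg, grp_grp_neg hph, grp_neg_grp hph]
      rw [map_sub]
      module
  have dpot := (hasFDerivAt_potential hp hR (disp l t (projPair n (y t)))).comp_hasDerivAt t du
  refine (dquad.add dpot).congr_deriv ?_
  have hu : opK l b ((1 / 2 : ℝ) • (V + V')) = disp l t (projPair n (y t)) := by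
    rw [map_smul, map_add, hV, hV', opK, ← grp_comm hph h.isSymbol_k, ← grp_comm hph h.isSymbol_k]
    change (1 / 2 : ℝ) • (grp (phase l) t (opK l b a) + grp (phase l) (-t) (opK l b a')) = _
    rw [ha, ha', h.opK_kappa, h.opK_kappa]
    rfl
  have hPu : P (disp l t (projPair n (y t))) = disp l t (projPair n (y t)) := by
    change P ((1 / 2 : ℝ) • (grp (phase l) t (P (y t).1) + grp (phase l) (-t) (P (y t).2))) =
      (1 / 2 : ℝ) • (grp (phase l) t (P (y t).1) + grp (phase l) (-t) (P (y t).2))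
    rw [map_smul, map_add, ← grp_comm hph (isSymbol_proj n), ← grp_comm hph (isSymbol_proj n),
      proj_proj, proj_proj]
  have hm := inner_nl_deriv hp hR n hPu
  rw [← hu, ← h.xb_opD n, hu, map_smul, map_smul, inner_smul_right, real_inner_comm] at hm
  have hm' : ⟪X (opD l (V + V')), g⟫_ℝ = 0 := by
    rcases mul_eq_zero.1 hm with h1 | h1
    · norm_num at h1
    · exact h1
  rw [hm', innerSL_apply_apply, inner_smul_right, real_inner_comm]
  ring

end Admissible

/-! ### The potential well -/

namespace Admissible

variable {ρ r c₁ c₂ c₃ c₄ : ℝ} {l b : ℝ → ℝ} {p R γ : ℝ}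

lemma continuous_quadH : Continuous fun V : RealL2 × RealL2 => quadH l γ V.1 V.2 := by
  unfold quadH
  have h1 : Continuous fun V : RealL2 × RealL2 => ⟪V.1, opD l V.1⟫_ℝ :=
    continuous_fst.inner ((opD l).continuous.comp continuous_fst)
  have h2 : Continuous fun V : RealL2 × RealL2 => ⟪V.2, opD l V.2⟫_ℝ :=
    continuous_snd.inner ((opD l).continuous.comp continuous_snd)
  fun_prop

lemma continuous_quadI : Continuous (quadI l γ) := by
  unfold quadI; fun_prop

lemma quadH_nonneg (h : Admissible ρ r c₁ c₂ c₃ c₄ l b) (hγ : |γ| < c₁) (V V' : RealL2) :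
    0 ≤ quadH l γ V V' := by
  refine le_trans ?_ (h.quadH_ge V V')
  have : |γ| / c₁ < 1 := (div_lt_one h.hc₁).2 hγ
  have : 0 < 1 - |γ| / c₁ := by linarith
  positivity

/-- Functions below the critical level are uniformly bounded. -/
lemma exists_level_bound (h : Admissible ρ r c₁ c₂ c₃ c₄ l b) (hp : 1 < p) (hγ : |γ| < c₁) (d : ℝ) :
    ∃ R, 0 ≤ R ∧ ∀ U, (p - 1) / (p + 1) * quadI l γ U < d → ∀ᵐ x, |opK l b U x| ≤ R := by
  obtain ⟨C, hC, hb⟩ := h.exists_sup_bound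
  have ha := h.one_sub_sq_pos hγ
  have hp1 : 0 < (p - 1) / (p + 1) := div_pos (by linarith) (by linarith)
  set a := (p - 1) / (p + 1) * (1 / 2 * (1 - (γ / c₁) ^ 2)) with ha'
  have hapos : 0 < a := by positivity
  refine ⟨C * √(d / a), by positivity, fun U hU => ?_⟩
  have h1 : ‖U‖ ≤ √(d / a) := by
    refine Real.le_sqrt_of_sq_le ?_
    rw [le_div_iff₀ hapos]
    have := mul_le_mul_of_nonneg_left (h.quadI_ge (γ := γ) U) hp1.le
    rw [← mul_assoc, ← ha'] at this
    linarith
  filter_upwards [hb U] with x hx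
  exact hx.trans (mul_le_mul_of_nonneg_left h1 hC)

/-- Below the critical level two things hold at once: `u` is bounded by `R`, so the truncated
potential is the true one, and `Q ≤ 2 I_γ`, so the energy controls the level. -/
lemma level_le_energy (h : Admissible ρ r c₁ c₂ c₃ c₄ l b) (hp : 1 < p) (hγ : |γ| < c₁)
    (hR : ∀ U, (p - 1) / (p + 1) * quadI l γ U < critEnergy l b ρ r p γ → ∀ᵐ x, |opK l b U x| ≤ R)
    {V V' : RealL2}
    (hV : (p - 1) / (p + 1) * quadI l γ ((1 / 2 : ℝ) • (V + V')) < critEnergy l b ρ r p γ) :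
    (p - 1) / (p + 1) * quadI l γ ((1 / 2 : ℝ) • (V + V')) ≤
      quadH l γ V V' + potential p R (opK l b ((1 / 2 : ℝ) • (V + V'))) := by
  rw [h.quadH_eq, potential_of_bounded hp (hR _ hV), ← sub_eq_add_neg]
  exact quadI_le_energy hp (h.Q_le_of_quadI_lt hp hγ hV)

/-- Below the critical level the potential is bounded below. -/
lemma neg_potential_le_of_level (h : Admissible ρ r c₁ c₂ c₃ c₄ l b) (hp : 1 < p) (hγ : |γ| < c₁)
    (hR : ∀ U, (p - 1) / (p + 1) * quadI l γ U < critEnergy l b ρ r p γ → ∀ᵐ x, |opK l b U x| ≤ R)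
    {U : RealL2} (hU : (p - 1) / (p + 1) * quadI l γ U < critEnergy l b ρ r p γ) :
    -potential p R (opK l b U) ≤ 2 / (p - 1) * critEnergy l b ρ r p γ := by
  have hp1 : 0 < p - 1 := by linarith
  rw [potential_of_bounded hp (hR _ hU), neg_neg]
  calc 1 / (p + 1) * Q p (opK l b U) ≤ 1 / (p + 1) * (2 * quadI l γ U) :=
        mul_le_mul_of_nonneg_left (h.Q_le_of_quadI_lt hp hγ hU) (by positivity)
    _ = 2 / (p - 1) * ((p - 1) / (p + 1) * quadI l γ U) := by field_simp
    _ ≤ _ := mul_le_mul_of_nonneg_left hU.le (by positivity)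

lemma opK_disp_kappa (h : Admissible ρ r c₁ c₂ c₃ c₄ l b) (n : ℕ) (t : ℝ) (z : RealL2 × RealL2) :
    opK l b (disp l t (T (kappa l b n) z.1, T (kappa l b n) z.2)) = disp l t (projPair n z) := by
  have e : ∀ t f, opK l b (grp (phase l) t (T (kappa l b n) f)) =
      grp (phase l) t (T (proj n) f) := fun t f => by
    rw [← h.opK_kappa, opK, grp_comm h.isPhase h.isSymbol_k]
  rw [disp, map_smul, map_add, e, e]
  rfl

lemma energy_cut_eq (h : Admissible ρ r c₁ c₂ c₃ c₄ l b) (hp : 1 < p) (hR : 0 ≤ R)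
    (n : ℕ) {y : ℝ → RealL2 × RealL2} (hy : ∀ t, HasDerivAt y (fieldCut l b p R n t (y t)) t)
    (s t : ℝ) :
    quadH l γ (T (kappa l b n) (y s).1) (T (kappa l b n) (y s).2) +
      potential p R (disp l s (projPair n (y s))) =
    quadH l γ (T (kappa l b n) (y t).1) (T (kappa l b n) (y t).2) +
      potential p R (disp l t (projPair n (y t))) :=
  is_const_of_deriv_eq_zero (fun t =>
      (h.hasDerivAt_energy_cut (γ := γ) hp hR n hy t).differentiableAt)
    (fun t => (h.hasDerivAt_energy_cut (γ := γ) hp hR n hy t).deriv) s t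

/-- Truncated solutions stay in the potential well. -/
lemma level_cut_le (h : Admissible ρ r c₁ c₂ c₃ c₄ l b) (hp : 1 < p) (hγ : |γ| < c₁) (hR0 : 0 ≤ R)
    (hR : ∀ U, (p - 1) / (p + 1) * quadI l γ U < critEnergy l b ρ r p γ → ∀ᵐ x, |opK l b U x| ≤ R)
    (n : ℕ) {y : ℝ → RealL2 × RealL2} (hy : ∀ t, HasDerivAt y (fieldCut l b p R n t (y t)) t)
    {t₀ e : ℝ} (he : quadH l γ (T (kappa l b n) (y t₀).1) (T (kappa l b n) (y t₀).2) +
      potential p R (disp l t₀ (projPair n (y t₀))) = e) (hed : e < critEnergy l b ρ r p γ)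
    (h0 : (p - 1) / (p + 1) * quadI l γ
      (disp l t₀ (T (kappa l b n) (y t₀).1, T (kappa l b n) (y t₀).2)) < critEnergy l b ρ r p γ)
    (t : ℝ) :
    (p - 1) / (p + 1) * quadI l γ
      (disp l t (T (kappa l b n) (y t).1, T (kappa l b n) (y t).2)) ≤ e := by
  have cy : Continuous y := continuous_iff_continuousAt.2 fun t => (hy t).continuousAt
  set L : ℝ → ℝ := fun t => (p - 1) / (p + 1) * quadI l γ
      (disp l t (T (kappa l b n) (y t).1, T (kappa l b n) (y t).2)) with hL
  have cL : Continuous L := continuous_const.mul (continuous_quadI.comp (h.continuous_disp_comp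
    (((T _).continuous.comp cy.fst).prodMk ((T _).continuous.comp cy.snd))))
  have key : ∀ t, L t < critEnergy l b ρ r p γ → L t ≤ e := by
    intro t ht
    have h1 := h.level_le_energy hp hγ hR (V := grp (phase l) t (T (kappa l b n) (y t).1))
      (V' := grp (phase l) (-t) (T (kappa l b n) (y t).2)) ht
    rw [h.quadH_grp] at h1
    refine h1.trans_eq (Eq.trans ?_ he)
    rw [h.energy_cut_eq hp hR0 n hy t₀ t, ← h.opK_disp_kappa]
    rfl
  -- Energy conservation identifies an open set of times with a closed one; it contains `t₀`, hence
  -- is all of `ℝ`.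
  have hs : {t | L t < critEnergy l b ρ r p γ} = {t | L t ≤ e} :=
    Set.ext fun t => ⟨key t, fun ht => lt_of_le_of_lt ht hed⟩
  have hc : IsClopen {t | L t < critEnergy l b ρ r p γ} :=
    ⟨hs ▸ isClosed_le cL continuous_const, isOpen_lt cL continuous_const⟩
  have hu := hc.eq_univ ⟨t₀, h0⟩
  exact key t (hu.symm ▸ mem_univ t : t ∈ {t | L t < critEnergy l b ρ r p γ})

/-! ### Weak lower semicontinuity -/

/-- Polarization, arranged so that the cross term is a fixed linear functional of `(V, V')` and
passes to weak limits. -/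
lemma quadH_sub (h : Admissible ρ r c₁ c₂ c₃ c₄ l b) (V V' W W' : RealL2) :
    quadH l γ (V - W) (V' - W') = quadH l γ V V' + quadH l γ W W' -
      1 / 2 * (⟪V, W + γ • opD l W⟫_ℝ + ⟪V', W' - γ • opD l W'⟫_ℝ) := by
  have e : ∀ V W, ⟪W, opD l V⟫_ℝ = ⟪V, opD l W⟫_ℝ := fun V W => by
    rw [← h.inner_opD, real_inner_comm]
  simp only [quadH, norm_sub_sq_real, map_sub, inner_sub_left, inner_sub_right, inner_add_right,
    inner_smul_right, e V W, e V' W']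
  ring

lemma quadI_sub (h : Admissible ρ r c₁ c₂ c₃ c₄ l b) (V W : RealL2) :
    quadI l γ (V - W) = quadI l γ V + quadI l γ W - ⟪V, W - γ ^ 2 • opD l (opD l W)⟫_ℝ := by
  rw [quadI, map_sub, norm_sub_sq_real, norm_sub_sq_real, inner_sub_right, inner_smul_right,
    ← h.inner_opD V (opD l W), quadI, quadI]
  ring

/-- Nonnegativity of the form at `V i - W` bounds `quadH` at `V i` below by an affine functional,
which converges weakly to the value at the limit. -/
lemma quadH_le_of_weak (h : Admissible ρ r c₁ c₂ c₃ c₄ l b) (hγ : |γ| < c₁) {ι : Type*}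
    {F : Filter ι} [F.NeBot] {V V' : ι → RealL2} {W W' : RealL2}
    (hV : ∀ ψ, Tendsto (fun i => ⟪V i, ψ⟫_ℝ) F (𝓝 ⟪W, ψ⟫_ℝ))
    (hV' : ∀ ψ, Tendsto (fun i => ⟪V' i, ψ⟫_ℝ) F (𝓝 ⟪W', ψ⟫_ℝ))
    {c : ι → ℝ} {c₀ : ℝ} (hc : Tendsto c F (𝓝 c₀)) (hle : ∀ᶠ i in F, quadH l γ (V i) (V' i) ≤ c i) :
    quadH l γ W W' ≤ c₀ := by
  have h1 := (((hV (W + γ • opD l W)).add (hV' (W' - γ • opD l W'))).const_mul (1 / 2)).sub_const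
    (quadH l γ W W')
  have h2 := le_of_tendsto_of_tendsto h1 hc (hle.mono fun i hi => by
    have := h.quadH_nonneg hγ (V i - W) (V' i - W')
    rw [h.quadH_sub] at this
    linarith)
  have h3 := h.quadH_sub (γ := γ) W W' W W'
  rw [sub_self, sub_self] at h3
  have h4 : quadH l γ 0 0 = 0 := by simp [quadH]
  linarith

lemma quadI_le_of_weak (h : Admissible ρ r c₁ c₂ c₃ c₄ l b) (hγ : |γ| < c₁) {ι : Type*}
    {F : Filter ι} [F.NeBot] {V : ι → RealL2} {W : RealL2}
    (hV : ∀ ψ, Tendsto (fun i => ⟪V i, ψ⟫_ℝ) F (𝓝 ⟪W, ψ⟫_ℝ))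
    {c : ι → ℝ} {c₀ : ℝ} (hc : Tendsto c F (𝓝 c₀)) (hle : ∀ᶠ i in F, quadI l γ (V i) ≤ c i) :
    quadI l γ W ≤ c₀ := by
  have h1 := (hV (W - γ ^ 2 • opD l (opD l W))).sub_const (quadI l γ W)
  have h2 := le_of_tendsto_of_tendsto h1 hc (hle.mono fun i hi => by
    have := h.quadI_nonneg hγ (V i - W)
    rw [h.quadI_sub] at this
    linarith)
  have h3 := h.quadI_sub (γ := γ) W W
  rw [sub_self] at h3
  have h4 : quadI l γ 0 = 0 := by simp [quadI]
  linarith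

/-! ### The energy inequality for the full equation -/

lemma tendsto_projPair_solution {z : ℕ → RealL2 × RealL2} {y : RealL2 × RealL2}
    (hz : Tendsto z atTop (𝓝 y)) : Tendsto (fun n => projPair n (z n)) atTop (𝓝 y) := by
  have h1 : Tendsto (fun n => projPair n (z n - y)) atTop (𝓝 0) := by
    refine squeeze_zero_norm (fun n => norm_projPair_apply_le n _) ?_
    have := (hz.sub_const y).norm
    simpa using this
  have := h1.add (tendsto_projPair y)
  simpa using this

/-- Solutions of the equation in the interaction picture, with data in the potential well, stay in
the well, and their augmented energy does not exceed the initial one. -/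
lemma exists_energy_le (h : Admissible ρ r c₁ c₂ c₃ c₄ l b) (hp : 1 < p) (hγ : |γ| < c₁)
    (hR0 : 0 ≤ R)
    (hR : ∀ U, (p - 1) / (p + 1) * quadI l γ U < critEnergy l b ρ r p γ → ∀ᵐ x, |opK l b U x| ≤ R)
    {y : ℝ → RealL2 × RealL2} (hy : ∀ t, HasDerivAt y (field l b p R t (y t)) t)
    {t₀ e : ℝ} {V V' : RealL2} (hV : opK l b V = grp (phase l) t₀ (y t₀).1)
    (hV' : opK l b V' = grp (phase l) (-t₀) (y t₀).2)
    (he : quadH l γ V V' + potential p R (opK l b ((1 / 2 : ℝ) • (V + V'))) = e)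
    (hed : e < critEnergy l b ρ r p γ)
    (h0 : (p - 1) / (p + 1) * quadI l γ ((1 / 2 : ℝ) • (V + V')) < critEnergy l b ρ r p γ) (t : ℝ) :
    ∃ W W', opK l b W = grp (phase l) t (y t).1 ∧ opK l b W' = grp (phase l) (-t) (y t).2 ∧
      (p - 1) / (p + 1) * quadI l γ ((1 / 2 : ℝ) • (W + W')) ≤ e ∧
      quadH l γ W W' + potential p R (opK l b ((1 / 2 : ℝ) • (W + W'))) ≤ e := by
  have hph := h.isPhase
  -- Truncated solutions with the same datum at `t₀`. Their energy sees the datum only through the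
  -- projections of `V` and `V'`, so it converges to `e`.
  choose z hz0 hz using fun n => h.exists_solution_cut hp hR0 n t₀ (y t₀)
  have hconv : ∀ t, Tendsto (fun n => z n t) atTop (𝓝 (y t)) :=
    h.tendsto_solution_cut hp hR0 hy hz0 hz
  set κ := fun n : ℕ => T (kappa l b n) with hκ
  have hκ0 : ∀ n, κ n (z n t₀).1 = grp (phase l) (-t₀) (T (proj n) V) := fun n => by
    rw [hz0, show (y t₀).1 = grp (phase l) (-t₀) (opK l b V) by rw [hV, grp_neg_grp hph], hκ,
      ← grp_comm hph (h.isSymbol_kappa n), h.kappa_opK]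
  have hκ0' : ∀ n, κ n (z n t₀).2 = grp (phase l) t₀ (T (proj n) V') := fun n => by
    rw [hz0, show (y t₀).2 = grp (phase l) t₀ (opK l b V') by rw [hV', grp_grp_neg hph], hκ,
      ← grp_comm hph (h.isSymbol_kappa n), h.kappa_opK]
  have hU0 : ∀ n, disp l t₀ (κ n (z n t₀).1, κ n (z n t₀).2) =
      (1 / 2 : ℝ) • (T (proj n) V + T (proj n) V') := fun n => by
    rw [hκ0, hκ0', disp, grp_grp_neg hph, grp_neg_grp hph]
  have hPV := (tendsto_proj V).prodMk_nhds (tendsto_proj V')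
  have hPU : Tendsto (fun n : ℕ => (1 / 2 : ℝ) • (T (proj n) V + T (proj n) V')) atTop
      (𝓝 ((1 / 2 : ℝ) • (V + V'))) := ((tendsto_proj V).add (tendsto_proj V')).const_smul _
  set en : ℕ → ℝ := fun n => quadH l γ (κ n (z n t₀).1) (κ n (z n t₀).2) +
    potential p R (disp l t₀ (projPair n (z n t₀))) with hen
  have hen_lim : Tendsto en atTop (𝓝 e) := by
    have h1 := ((continuous_quadH (l := l) (γ := γ)).tendsto (V, V')).comp hPV
    have h2 := (((continuous_potential hp hR0).comp (opK l b).continuous).tendsto _).comp hPU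
    rw [← he]
    refine (h1.add h2).congr fun n => ?_
    rw [hen]
    simp only [Function.comp]
    rw [← h.opK_disp_kappa]
    change _ = _ + potential p R (opK l b (disp l t₀ (κ n (z n t₀).1, κ n (z n t₀).2)))
    rw [hU0, hκ0, hκ0', h.quadH_grp]
  have ev1 : ∀ᶠ n in atTop, en n < critEnergy l b ρ r p γ := hen_lim.eventually (gt_mem_nhds hed)
  have ev2 : ∀ᶠ n in atTop, (p - 1) / (p + 1) * quadI l γ
      (disp l t₀ (κ n (z n t₀).1, κ n (z n t₀).2)) < critEnergy l b ρ r p γ := by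
    have := ((((continuous_quadI (l := l) (γ := γ)).tendsto _).comp hPU).const_mul
      ((p - 1) / (p + 1))).eventually (gt_mem_nhds h0)
    filter_upwards [this] with n hn
    rw [hU0]; exact hn
  set A : ℕ → RealL2 := fun n => grp (phase l) t (κ n (z n t).1) with hA
  set A' : ℕ → RealL2 := fun n => grp (phase l) (-t) (κ n (z n t).2) with hA'
  have hlev : ∀ᶠ n in atTop, (p - 1) / (p + 1) * quadI l γ ((1 / 2 : ℝ) • (A n + A' n)) ≤ en n := by
    filter_upwards [ev1, ev2] with n h1 h2
    exact h.level_cut_le hp hγ hR0 hR n (hz n) rfl h1 h2 t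
  have hKU : ∀ n, opK l b ((1 / 2 : ℝ) • (A n + A' n)) = disp l t (projPair n (z n t)) :=
    fun n => h.opK_disp_kappa n t (z n t)
  have hener : ∀ n, quadH l γ (A n) (A' n) =
      en n - potential p R (disp l t (projPair n (z n t))) := by
    intro n
    rw [hen, hA, hA', h.quadH_grp]
    have := h.energy_cut_eq (γ := γ) hp hR0 n (hz n) t₀ t
    linarith
  -- In the well `-potential` is at most the second summand, and the conserved energy is eventually
  -- below the first; together they bound the quadratic part uniformly in `n`.
  set M := critEnergy l b ρ r p γ + 2 / (p - 1) * critEnergy l b ρ r p γ with hM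
  have hbd : ∀ᶠ n in atTop, quadH l γ (A n) (A' n) ≤ M := by
    filter_upwards [ev1, hlev] with n h1 h2
    have h3 := h.neg_potential_le_of_level hp hγ hR (h2.trans_lt h1)
    rw [hKU] at h3
    rw [hener]; linarith
  have hδ : 0 < 1 / 4 * (1 - |γ| / c₁) := by
    have : |γ| / c₁ < 1 := (div_lt_one h.hc₁).2 hγ
    linarith
  have hnorm : ∀ᶠ n in atTop, ‖A n‖ ≤ √(M / (1 / 4 * (1 - |γ| / c₁))) ∧
      ‖A' n‖ ≤ √(M / (1 / 4 * (1 - |γ| / c₁))) := by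
    filter_upwards [hbd] with n hn
    have h1 := (h.quadH_ge (γ := γ) (A n) (A' n)).trans hn
    rw [mul_comm, ← le_div_iff₀ hδ] at h1
    exact ⟨Real.le_sqrt_of_sq_le (by nlinarith [sq_nonneg ‖A' n‖]),
      Real.le_sqrt_of_sq_le (by nlinarith [sq_nonneg ‖A n‖])⟩
  -- Weak limits in the energy variables are taken along an ultrafilter and identified through
  -- `opK`, under which the truncated solutions converge strongly in `L²`.
  have hle : (↑(hyperfilter ℕ) : Filter ℕ) ≤ atTop := Nat.hyperfilter_le_atTop
  obtain ⟨W, hW⟩ := exists_weak_limit (hyperfilter ℕ) (hle (hnorm.mono fun n hn => hn.1))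
  obtain ⟨W', hW'⟩ := exists_weak_limit (hyperfilter ℕ) (hle (hnorm.mono fun n hn => hn.2))
  have hP := tendsto_projPair_solution (hconv t)
  have weak_opK : ∀ {A : ℕ → RealL2} {W f : RealL2},
      (∀ ψ, Tendsto (fun n => ⟪A n, ψ⟫_ℝ) (hyperfilter ℕ) (𝓝 ⟪W, ψ⟫_ℝ)) →
      Tendsto (fun n => opK l b (A n)) atTop (𝓝 f) → opK l b W = f := by
    intro A W f h1 h2
    refine ext_inner_right ℝ fun ψ => ?_
    have h3 := h1 (opK l b ψ)
    rw [← h.inner_opK] at h3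
    refine tendsto_nhds_unique h3 ?_
    simp_rw [← h.inner_opK]
    exact (h2.mono_left hle).inner tendsto_const_nhds
  have hKA : ∀ n, opK l b (A n) = grp (phase l) t (projPair n (z n t)).1 := fun n => by
    rw [hA, opK, ← grp_comm hph h.isSymbol_k]
    exact congrArg _ (h.opK_kappa n _)
  have hKA' : ∀ n, opK l b (A' n) = grp (phase l) (-t) (projPair n (z n t)).2 := fun n => by
    rw [hA', opK, ← grp_comm hph h.isSymbol_k]
    exact congrArg _ (h.opK_kappa n _)
  have hKW : opK l b W = grp (phase l) t (y t).1 := weak_opK hW (by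
    simp_rw [hKA]
    exact ((grp (phase l) t).continuous.tendsto _).comp ((continuous_fst.tendsto _).comp hP))
  have hKW' : opK l b W' = grp (phase l) (-t) (y t).2 := weak_opK hW' (by
    simp_rw [hKA']
    exact ((grp (phase l) (-t)).continuous.tendsto _).comp ((continuous_snd.tendsto _).comp hP))
  have hUW : ∀ ψ, Tendsto (fun n => ⟪(1 / 2 : ℝ) • (A n + A' n), ψ⟫_ℝ) (hyperfilter ℕ)
      (𝓝 ⟪(1 / 2 : ℝ) • (W + W'), ψ⟫_ℝ) := by
    intro ψ
    simp only [inner_smul_left, inner_add_left]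
    exact ((hW ψ).add (hW' ψ)).const_mul _
  have hp1 : 0 < (p - 1) / (p + 1) := div_pos (by linarith) (by linarith)
  refine ⟨W, W', hKW, hKW', ?_, ?_⟩
  · have h1 := h.quadI_le_of_weak hγ hUW (c := fun n => ((p - 1) / (p + 1))⁻¹ * en n)
      ((hen_lim.mono_left hle).const_mul _) (hle (hlev.mono fun n hn => by
        rw [inv_mul_eq_div, le_div_iff₀ hp1, mul_comm]; exact hn))
    rwa [inv_mul_eq_div, le_div_iff₀ hp1, mul_comm] at h1
  · have hKU' : opK l b ((1 / 2 : ℝ) • (W + W')) = disp l t (y t) := by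
      rw [map_smul, map_add, hKW, hKW', disp]
    -- The potential is continuous on `L²` and converges; only the quadratic part can drop in the
    -- limit.
    have h1 := h.quadH_le_of_weak hγ hW hW'
      (c := fun n => en n - potential p R (disp l t (projPair n (z n t))))
      (c₀ := e - potential p R (disp l t (y t))) ?_ (Eventually.of_forall fun n => (hener n).le)
    · rw [hKU']; linarith
    · refine (hen_lim.sub (((continuous_potential hp hR0).tendsto _).comp ?_)).mono_left hle
      have h2 : Continuous (disp l t) := by unfold disp; fun_prop
      exact (h2.tendsto _).comp hP

end Admissible

/-! ### Conservation of the augmented energy and strong continuity -/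

namespace Admissible

variable {ρ r c₁ c₂ c₃ c₄ : ℝ} {l b : ℝ → ℝ} {p R γ : ℝ}

lemma denseRange_opK (h : Admissible ρ r c₁ c₂ c₃ c₄ l b) : DenseRange (opK l b) := fun f =>
  mem_closure_of_tendsto (tendsto_proj f)
    (Eventually.of_forall fun n => ⟨T (kappa l b n) f, h.opK_kappa n f⟩)

/-- The augmented energy is conserved. -/
lemma exists_energy_eq (h : Admissible ρ r c₁ c₂ c₃ c₄ l b) (hp : 1 < p) (hγ : |γ| < c₁)
    (hR0 : 0 ≤ R)
    (hR : ∀ U, (p - 1) / (p + 1) * quadI l γ U < critEnergy l b ρ r p γ → ∀ᵐ x, |opK l b U x| ≤ R)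
    {y : ℝ → RealL2 × RealL2} (hy : ∀ t, HasDerivAt y (field l b p R t (y t)) t)
    {t₀ e : ℝ} {V V' : RealL2} (hV : opK l b V = grp (phase l) t₀ (y t₀).1)
    (hV' : opK l b V' = grp (phase l) (-t₀) (y t₀).2)
    (he : quadH l γ V V' + potential p R (opK l b ((1 / 2 : ℝ) • (V + V'))) = e)
    (hed : e < critEnergy l b ρ r p γ)
    (h0 : (p - 1) / (p + 1) * quadI l γ ((1 / 2 : ℝ) • (V + V')) < critEnergy l b ρ r p γ) (t : ℝ) :
    ∃ W W', opK l b W = grp (phase l) t (y t).1 ∧ opK l b W' = grp (phase l) (-t) (y t).2 ∧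
      (p - 1) / (p + 1) * quadI l γ ((1 / 2 : ℝ) • (W + W')) ≤ e ∧
      quadH l γ W W' + potential p R (opK l b ((1 / 2 : ℝ) • (W + W'))) = e := by
  obtain ⟨W, W', h1, h2, h3, h4⟩ := h.exists_energy_le hp hγ hR0 hR hy hV hV' he hed h0 t
  refine ⟨W, W', h1, h2, h3, le_antisymm h4 ?_⟩
  -- The inequality holds for times of either sign, so it may be restarted at `t` and run back to
  -- `t₀`, where injectivity of `opK` recovers the original profile.
  obtain ⟨X, X', k1, k2, -, k4⟩ := h.exists_energy_le hp hγ hR0 hR hy h1 h2 rfl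
    (h4.trans_lt hed) (h3.trans_lt hed) t₀
  have e1 : X = V := h.comparable_k.T_injective (k1.trans hV.symm)
  have e2 : X' = V' := h.comparable_k.T_injective (k2.trans hV'.symm)
  rw [e1, e2, he] at k4
  exact k4

/-- Weak convergence together with convergence of the quadratic part of the energy implies strong
convergence. -/
lemma tendsto_of_quadH (h : Admissible ρ r c₁ c₂ c₃ c₄ l b) (hγ : |γ| < c₁) {ι : Type*}
    {F : Filter ι} {V V' : ι → RealL2} {W W' : RealL2}
    (hV : ∀ ψ, Tendsto (fun i => ⟪V i, ψ⟫_ℝ) F (𝓝 ⟪W, ψ⟫_ℝ))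
    (hV' : ∀ ψ, Tendsto (fun i => ⟪V' i, ψ⟫_ℝ) F (𝓝 ⟪W', ψ⟫_ℝ))
    (hq : Tendsto (fun i => quadH l γ (V i) (V' i)) F (𝓝 (quadH l γ W W'))) :
    Tendsto V F (𝓝 W) ∧ Tendsto V' F (𝓝 W') := by
  have hδ : 0 < 1 / 4 * (1 - |γ| / c₁) := by
    have : |γ| / c₁ < 1 := (div_lt_one h.hc₁).2 hγ
    linarith
  have h1 := (hq.add_const (quadH l γ W W')).sub
    (((hV (W + γ • opD l W)).add (hV' (W' - γ • opD l W'))).const_mul (1 / 2))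
  simp_rw [← h.quadH_sub] at h1
  rw [sub_self, sub_self] at h1
  have h4 : quadH l γ 0 0 = 0 := by simp [quadH]
  rw [h4] at h1
  have h2 : Tendsto (fun i => ‖V i - W‖ ^ 2 + ‖V' i - W'‖ ^ 2) F (𝓝 0) := by
    have h3 := h1.const_mul (1 / 4 * (1 - |γ| / c₁))⁻¹
    rw [mul_zero] at h3
    refine squeeze_zero (fun i => by positivity) (fun i => ?_) h3
    rw [inv_mul_eq_div, le_div_iff₀ hδ, mul_comm]
    exact h.quadH_ge _ _
  have key : ∀ (f : ι → RealL2), (∀ i, ‖f i‖ ^ 2 ≤ ‖V i - W‖ ^ 2 + ‖V' i - W'‖ ^ 2) →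
      Tendsto (fun i => ‖f i‖) F (𝓝 0) := fun f hf => by
    have h3 := (Real.continuous_sqrt.tendsto 0).comp
      (squeeze_zero (fun i => sq_nonneg ‖f i‖) hf h2)
    rw [Real.sqrt_zero] at h3
    refine h3.congr fun i => ?_
    simp [Real.sqrt_sq (norm_nonneg _)]
  exact ⟨tendsto_iff_norm_sub_tendsto_zero.2 (key _ fun i => by simp),
    tendsto_iff_norm_sub_tendsto_zero.2 (key _ fun i => by simp)⟩

/-- Continuity of `y` in `L²` only gives that of `opK (W t)`. The energy bound upgrades this to weak
continuity of `W`, and energy equality makes the quadratic part continuous, which gives strong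
continuity. -/
lemma exists_continuous_profile (h : Admissible ρ r c₁ c₂ c₃ c₄ l b) (hp : 1 < p) (hγ : |γ| < c₁)
    (hR0 : 0 ≤ R)
    (hR : ∀ U, (p - 1) / (p + 1) * quadI l γ U < critEnergy l b ρ r p γ → ∀ᵐ x, |opK l b U x| ≤ R)
    {y : ℝ → RealL2 × RealL2} (hy : ∀ t, HasDerivAt y (field l b p R t (y t)) t)
    {t₀ e : ℝ} {V V' : RealL2} (hV : opK l b V = grp (phase l) t₀ (y t₀).1)
    (hV' : opK l b V' = grp (phase l) (-t₀) (y t₀).2)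
    (he : quadH l γ V V' + potential p R (opK l b ((1 / 2 : ℝ) • (V + V'))) = e)
    (hed : e < critEnergy l b ρ r p γ)
    (h0 : (p - 1) / (p + 1) * quadI l γ ((1 / 2 : ℝ) • (V + V')) < critEnergy l b ρ r p γ) :
    ∃ W W' : ℝ → RealL2, Continuous W ∧ Continuous W' ∧
      ∀ t, opK l b (W t) = grp (phase l) t (y t).1 ∧ opK l b (W' t) = grp (phase l) (-t) (y t).2 ∧
        (p - 1) / (p + 1) * quadI l γ ((1 / 2 : ℝ) • (W t + W' t)) < critEnergy l b ρ r p γ := by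
  choose W W' h1 h2 h3 h4 using h.exists_energy_eq hp hγ hR0 hR hy hV hV' he hed h0
  have cy : Continuous y := continuous_iff_continuousAt.2 fun t => (hy t).continuousAt
  have c1 : Continuous fun t => opK l b (W t) := by
    simp_rw [h1]; exact continuous_grp_comp h.isPhase cy.fst
  have c2 : Continuous fun t => opK l b (W' t) := by
    simp_rw [h2]
    have := (continuous_grp_comp h.isPhase (cy.snd.comp continuous_neg)).comp continuous_neg
    simpa [Function.comp_def] using this
  have cu : Continuous fun t => opK l b ((1 / 2 : ℝ) • (W t + W' t)) := by
    simp_rw [map_smul, map_add]; exact (c1.add c2).const_smul (1 / 2 : ℝ)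
  have hq : ∀ t, quadH l γ (W t) (W' t) =
      e - potential p R (opK l b ((1 / 2 : ℝ) • (W t + W' t))) := fun t => by linarith [h4 t]
  have cq : Continuous fun t => quadH l γ (W t) (W' t) := by
    simp_rw [hq]; exact continuous_const.sub ((continuous_potential hp hR0).comp cu)
  have hδ : 0 < 1 / 4 * (1 - |γ| / c₁) := by
    have : |γ| / c₁ < 1 := (div_lt_one h.hc₁).2 hγ
    linarith
  set M := e + 2 / (p - 1) * critEnergy l b ρ r p γ with hM
  have hn : ∀ t, ‖W t‖ ≤ √(M / (1 / 4 * (1 - |γ| / c₁))) ∧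
      ‖W' t‖ ≤ √(M / (1 / 4 * (1 - |γ| / c₁))) := by
    intro t
    have k1 := h.quadH_ge (γ := γ) (W t) (W' t)
    have k2 := h.neg_potential_le_of_level hp hγ hR ((h3 t).trans_lt hed)
    have k3 : quadH l γ (W t) (W' t) ≤ M := by rw [hq]; linarith
    replace k1 := k1.trans k3
    rw [mul_comm, ← le_div_iff₀ hδ] at k1
    exact ⟨Real.le_sqrt_of_sq_le (by nlinarith [sq_nonneg ‖W' t‖]),
      Real.le_sqrt_of_sq_le (by nlinarith [sq_nonneg ‖W t‖])⟩
  have weak : ∀ {X : ℝ → RealL2}, (∀ t, ‖X t‖ ≤ √(M / (1 / 4 * (1 - |γ| / c₁)))) →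
      (Continuous fun t => opK l b (X t)) → ∀ t ψ,
      Tendsto (fun τ => ⟪X τ, ψ⟫_ℝ) (𝓝 t) (𝓝 ⟪X t, ψ⟫_ℝ) := fun {X} hX cX t ψ =>
    weak_limit_of_dense h.denseRange_opK (Eventually.of_forall hX) (fun φ => by
      simp_rw [← h.inner_opK]
      exact (cX.tendsto t).inner tendsto_const_nhds) ψ
  have strong := fun t => h.tendsto_of_quadH hγ (weak (fun t => (hn t).1) c1 t)
    (weak (fun t => (hn t).2) c2 t) (cq.tendsto t)
  exact ⟨W, W', continuous_iff_continuousAt.2 fun t => (strong t).1,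
    continuous_iff_continuousAt.2 fun t => (strong t).2,
    fun t => ⟨h1 t, h2 t, (h3 t).trans_lt hed⟩⟩

/-! ### Pairing with test functions -/

lemma hasDerivAt_grp_T_neg {om : ℝ → ℝ} (hom : IsPhase om) {m : ℝ → ℂ} (hm : IsSymbol m)
    (homm : IsSymbol fun ξ => Complex.I * (om ξ : ℂ) * m ξ) (f : RealL2) (t : ℝ) :
    HasDerivAt (fun s => grp om (-s) (T m f))
      (-grp om (-t) (T (fun ξ => Complex.I * (om ξ : ℂ) * m ξ) f)) t := by
  have := (hasDerivAt_grp_T hom hm homm f (-t)).scomp t (hasDerivAt_neg t)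
  rw [neg_one_smul] at this
  exact this

/-- Shifting the group onto the test vector leaves the interaction picture without any spatial
regularity of `y`; the hypothesis on the symbol puts that vector in the domain of the generator. -/
lemma hasDerivAt_inner_fst (h : Admissible ρ r c₁ c₂ c₃ c₄ l b)
    {y : ℝ → RealL2 × RealL2} (hy : ∀ t, HasDerivAt y (field l b p R t (y t)) t)
    {m : ℝ → ℂ} (hm : IsSymbol m) (ham : IsSymbol fun ξ => Complex.I * (phase l ξ : ℂ) * m ξ)
    (f : RealL2) (t : ℝ) :
    HasDerivAt (fun τ => ⟪grp (phase l) τ (y τ).1, T m f⟫_ℝ)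
      (⟪force l b p R t (y t), T m f⟫_ℝ -
        ⟪grp (phase l) t (y t).1, T (fun ξ => Complex.I * (phase l ξ : ℂ) * m ξ) f⟫_ℝ) t := by
  have hph := h.isPhase
  have d1 : HasDerivAt (fun t => (y t).1) (grp (phase l) (-t) (force l b p R t (y t))) t :=
    (hasFDerivAt_fst (p := y t)).comp_hasDerivAt t (hy t)
  simp_rw [inner_grp_left hph]
  refine (d1.inner ℝ (hasDerivAt_grp_T_neg hph hm ham f t)).congr_deriv ?_
  rw [inner_neg_right, inner_grp_left hph, neg_neg, grp_grp_neg hph]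
  ring

lemma hasDerivAt_inner_snd (h : Admissible ρ r c₁ c₂ c₃ c₄ l b)
    {y : ℝ → RealL2 × RealL2} (hy : ∀ t, HasDerivAt y (field l b p R t (y t)) t)
    {m : ℝ → ℂ} (hm : IsSymbol m) (ham : IsSymbol fun ξ => Complex.I * (phase l ξ : ℂ) * m ξ)
    (f : RealL2) (t : ℝ) :
    HasDerivAt (fun τ => ⟪grp (phase l) (-τ) (y τ).2, T m f⟫_ℝ)
      (-⟪force l b p R t (y t), T m f⟫_ℝ +
        ⟪grp (phase l) (-t) (y t).2, T (fun ξ => Complex.I * (phase l ξ : ℂ) * m ξ) f⟫_ℝ) t := by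
  have hph := h.isPhase
  have d1 : HasDerivAt (fun t => (y t).2) (-grp (phase l) t (force l b p R t (y t))) t :=
    (hasFDerivAt_snd (p := y t)).comp_hasDerivAt t (hy t)
  simp_rw [inner_grp_left hph, neg_neg]
  refine (d1.inner ℝ (hasDerivAt_grp_T hph hm ham f t)).congr_deriv ?_
  rw [inner_neg_left, inner_grp_left hph t, grp_neg_grp hph]
  ring

end Admissible

/-- Schwartz functions belong to all Sobolev spaces. -/
lemma memH_testL2 (s : ℝ) (ψ : 𝓢(ℝ, ℝ)) : MemH s (testL2 ψ) := by
  rw [MemH, sobolevNorm_eq]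
  refine ENNReal.mul_lt_top scale_ne_top.lt_top ?_
  set φ : 𝓢(ℝ, ℂ) := 𝓕 (ψ.postcompCLM Complex.ofRealCLM : 𝓢(ℝ, ℂ)) with hφ
  have hg : Function.HasTemperateGrowth fun η : ℝ => ((weight s (2 * Real.pi * η) : ℝ) : ℂ) := by
    have h1 := (Function.hasTemperateGrowth_one_add_norm_sq_rpow ℝ (s / 2)).comp
      ((Function.HasTemperateGrowth.const (2 * Real.pi)).mul Function.HasTemperateGrowth.id')
    have h2 := Function.HasTemperateGrowth.comp Function.Complex.hasTemperateGrowth_ofReal h1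
    refine (congrArg Function.HasTemperateGrowth (funext fun η => ?_)).mp h2
    simp only [Function.comp, weight, Real.norm_eq_abs, sq_abs]
    rfl
  have h1 := (SchwartzMap.smulLeftCLM ℂ (fun η : ℝ => ((weight s (2 * Real.pi * η) : ℝ) : ℂ))
      φ).memLp 2 volume
  refine lt_of_eq_of_lt (eLpNorm_congr_ae ?_) h1.2
  filter_upwards [coeFn_hat_testL2 ψ] with η h2
  rw [h2, SchwartzMap.smulLeftCLM_apply_apply hg, smul_eq_mul]

/-! ### Symbols of test functions -/

lemma comparable_weight {s : ℝ} (hs : 0 ≤ s) : Comparable s (weight (-s)) 1 1 := by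
  have e : ∀ ξ, weight s ξ * weight (-s) ξ = 1 := fun ξ => by
    rw [weight, weight, ← Real.rpow_add (by positivity), neg_div, add_neg_cancel, Real.rpow_zero]
  refine ⟨hs, ?_, fun ξ => by simp [weight], one_pos, fun ξ => (e ξ).ge, fun ξ => (e ξ).le⟩
  unfold weight; fun_prop

lemma testDeriv_eq {m : ℝ → ℂ} (hm : IsSymbol m) (hdm : IsSymbol fun ξ => dx ξ * m ξ)
    {f : RealL2} {ψ : 𝓢(ℝ, ℝ)} (e : testL2 ψ = T m f) :
    testDeriv ψ = T (fun ξ => dx ξ * m ξ) f := by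
  refine ext_hat ?_
  filter_upwards [hat_T hdm f, coeFn_hat_testDeriv ψ, hat_T hm f] with η h3 h4 h5
  rw [h3, h4, e, h5, dx]; ring

lemma multiplier_testDeriv_eq {l : ℝ → ℝ} (hl : ∀ ξ, l (-ξ) = l ξ) {m : ℝ → ℂ} (hm : IsSymbol m)
    (hdm : IsSymbol fun ξ => dx ξ * m ξ) (hldm : IsSymbol fun ξ => (l ξ : ℂ) * (dx ξ * m ξ))
    {f : RealL2} {ψ : 𝓢(ℝ, ℝ)} (e : testL2 ψ = T m f) :
    multiplier l (testDeriv ψ) = T (fun ξ => (l ξ : ℂ) * (dx ξ * m ξ)) f := by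
  rw [testDeriv_eq hm hdm e, multiplier_eq_op, op_T (by simp [hl]) hdm hldm]

/-- Symbols that absorb all the operators of the equation. -/
structure IsTestSymbol (l b : ℝ → ℝ) (m : ℝ → ℂ) : Prop where
  one : IsSymbol m
  d : IsSymbol fun ξ => dx ξ * m ξ
  sqrt : IsSymbol fun ξ => (√(l ξ) : ℂ) * m ξ
  phase : IsSymbol fun ξ => Complex.I * (phase l ξ : ℂ) * m ξ
  ld : IsSymbol fun ξ => (l ξ : ℂ) * (dx ξ * m ξ)
  bd : IsSymbol fun ξ => (b ξ : ℂ) * (dx ξ * m ξ)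

namespace Admissible

variable {ρ r c₁ c₂ c₃ c₄ : ℝ} {l b : ℝ → ℝ} {p R γ : ℝ}

/-- Every operator in the equation has order at most `ρ + 1`, the order of `L ∂_x`, so a single
growth condition covers all fields. -/
lemma isTestSymbol_of (h : Admissible ρ r c₁ c₂ c₃ c₄ l b) {m : ℝ → ℂ}
    (hm : ∀ g : ℝ → ℂ, Continuous g → (∀ ξ, g (-ξ) = conj (g ξ)) →
      (∃ C, 0 ≤ C ∧ ∀ ξ, ‖g ξ‖ ≤ C * weight (ρ + 1) ξ) → IsSymbol fun ξ => g ξ * m ξ) :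
    IsTestSymbol l b m := by
  have hJ : ∀ ξ : ℝ, (1 : ℝ) ≤ 1 + ξ ^ 2 := fun ξ => by nlinarith [sq_nonneg ξ]
  have hρ := h.hρ
  have w1 : ∀ ξ, |ξ| ≤ weight 1 ξ := fun ξ => by
    rw [weight, ← Real.sqrt_eq_rpow]; exact Real.abs_le_sqrt (by linarith)
  have wm : ∀ {s s' : ℝ}, s ≤ s' → ∀ ξ, weight s ξ ≤ weight s' ξ := fun hs ξ =>
    Real.rpow_le_rpow_of_exponent_le (hJ ξ) (by linarith)
  have wa : ∀ s s' ξ, weight s ξ * weight s' ξ = weight (s + s') ξ := fun s s' ξ => by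
    rw [weight, weight, weight, ← Real.rpow_add (by linarith [hJ ξ])]; congr 1; ring
  have hl : ∀ ξ, l ξ ≤ c₂ ^ 2 * weight ρ ξ := fun ξ => (h.hl ξ).2
  have hs : ∀ ξ, √(l ξ) ≤ c₂ * weight (ρ / 2) ξ := fun ξ => by
    refine Real.sqrt_le_iff.2 ⟨mul_nonneg h.hc₂.le (weight_pos _ _).le, (hl ξ).trans_eq ?_⟩
    rw [mul_pow, pow_two (weight _ _), wa, add_halves]
  have hb : ∀ ξ, b ξ ≤ c₄ ^ 2 := fun ξ => by
    refine (h.hb ξ).2.trans (mul_le_of_le_one_right (sq_nonneg _) ?_)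
    exact Real.rpow_le_one_of_one_le_of_nonpos (hJ ξ) (by linarith [h.hr])
  have cs := Complex.continuous_ofReal.comp h.sqrt_l_smooth.continuous
  have cl := Complex.continuous_ofReal.comp h.l_smooth.continuous
  have cb := Complex.continuous_ofReal.comp h.b_smooth.continuous
  have cp := Complex.continuous_ofReal.comp h.phase_smooth.continuous
  have nd : ∀ ξ, ‖dx ξ‖ = |ξ| := fun ξ => by simp [dx]
  refine ⟨?_, ?_, ?_, ?_, ?_, ?_⟩
  · simpa using hm (fun _ => 1) continuous_const (by simp) ⟨1, zero_le_one, fun ξ => by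
      simpa using one_le_weight (by linarith) ξ⟩
  · exact hm dx continuous_dx dx_neg ⟨1, zero_le_one, fun ξ => by
      rw [nd, one_mul]; exact (w1 ξ).trans (wm (by linarith) ξ)⟩
  · refine hm (fun ξ => (√(l ξ) : ℂ)) cs (by simp [h.l_even]) ⟨c₂, h.hc₂.le, fun ξ => ?_⟩
    rw [Complex.norm_real, Real.norm_of_nonneg (Real.sqrt_nonneg _)]
    exact (hs ξ).trans (mul_le_mul_of_nonneg_left (wm (by linarith) ξ) h.hc₂.le)
  · refine hm (fun ξ => Complex.I * (NonlocalWave.phase l ξ : ℂ)) (continuous_const.mul cp)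
      (by simp [NonlocalWave.phase, h.l_even]) ⟨c₂, h.hc₂.le, fun ξ => ?_⟩
    rw [norm_mul, Complex.norm_I, one_mul, Complex.norm_real, NonlocalWave.phase, norm_mul,
      Real.norm_of_nonneg (Real.sqrt_nonneg _), Real.norm_eq_abs]
    calc |ξ| * √(l ξ) ≤ weight 1 ξ * (c₂ * weight (ρ / 2) ξ) :=
          mul_le_mul (w1 ξ) (hs ξ) (Real.sqrt_nonneg _) (weight_pos _ _).le
      _ = c₂ * weight (1 + ρ / 2) ξ := by rw [← wa]; ring
      _ ≤ _ := mul_le_mul_of_nonneg_left (wm (by linarith) ξ) h.hc₂.le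
  · simp_rw [← mul_assoc]
    refine hm (fun ξ => (l ξ : ℂ) * dx ξ) (cl.mul continuous_dx)
      (by simp [h.l_even, dx]) ⟨c₂ ^ 2, sq_nonneg _, fun ξ => ?_⟩
    rw [norm_mul, nd, Complex.norm_real, Real.norm_of_nonneg (h.l_pos ξ).le]
    calc l ξ * |ξ| ≤ (c₂ ^ 2 * weight ρ ξ) * weight 1 ξ :=
          mul_le_mul (hl ξ) (w1 ξ) (abs_nonneg _) (mul_nonneg (sq_nonneg _) (weight_pos _ _).le)
      _ = _ := by rw [mul_assoc, wa]
  · simp_rw [← mul_assoc]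
    refine hm (fun ξ => (b ξ : ℂ) * dx ξ) (cb.mul continuous_dx)
      (by simp [h.b_even, dx]) ⟨c₄ ^ 2, sq_nonneg _, fun ξ => ?_⟩
    rw [norm_mul, nd, Complex.norm_real, Real.norm_of_nonneg (h.b_pos ξ).le]
    exact mul_le_mul (hb ξ) ((w1 ξ).trans (wm (by linarith) ξ)) (abs_nonneg _) (sq_nonneg _)

/-- A test function lies in `H^{ρ+1}` and so factors through the symbol `(1 + ξ²)^{-(ρ+1)/2}`, which
makes all operators of the weak form bounded on it. -/
lemma exists_testL2_eq (h : Admissible ρ r c₁ c₂ c₃ c₄ l b) :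
    ∃ m, IsTestSymbol l b m ∧ ∀ ψ : 𝓢(ℝ, ℝ), ∃ f, testL2 ψ = T m f := by
  have hs : 0 ≤ ρ + 1 := by linarith [h.hρ]
  refine ⟨fun ξ => (weight (-(ρ + 1)) ξ : ℂ), h.isTestSymbol_of fun g hg herm hC => ?_, fun ψ => ?_⟩
  · obtain ⟨C, hC0, hC⟩ := hC
    have hk := comparable_weight hs
    refine ⟨hg.measurable.mul (Complex.measurable_ofReal.comp hk.meas),
      fun ξ => by rw [herm, hk.even]; simp, C, fun ξ => ?_⟩
    rw [norm_mul, Complex.norm_real, Real.norm_of_nonneg (weight_pos _ _).le]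
    refine (mul_le_mul_of_nonneg_right (hC ξ) (weight_pos _ _).le).trans ?_
    rw [mul_assoc]
    exact mul_le_of_le_one_right hC0 (hk.upper ξ)
  · obtain ⟨f, hf⟩ := (comparable_weight hs).exists_eq_T (memH_testL2 (ρ + 1) ψ)
    exact ⟨f, hf.symm⟩

/-! ### Operator identities on test functions -/

lemma phase_mul_df (h : Admissible ρ r c₁ c₂ c₃ c₄ l b) (ξ : ℝ) :
    (df l ξ : ℂ) * (Complex.I * (phase l ξ : ℂ)) = dx ξ := by
  have h2 := (Real.sqrt_pos.2 (h.l_pos ξ)).ne'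
  have e : df l ξ * phase l ξ = ξ := by rw [df, phase]; field_simp
  have e' : (df l ξ : ℂ) * (phase l ξ : ℂ) = (ξ : ℂ) := by exact_mod_cast e
  rw [dx]; linear_combination Complex.I * e'

lemma inner_opD_phase (h : Admissible ρ r c₁ c₂ c₃ c₄ l b) {m : ℝ → ℂ} (hm : IsTestSymbol l b m)
    (w f : RealL2) : ⟪opD l w, T (fun ξ => Complex.I * (phase l ξ : ℂ) * m ξ) f⟫_ℝ =
      ⟪w, T (fun ξ => dx ξ * m ξ) f⟫_ℝ := by
  rw [h.inner_opD, opD, T_T h.isSymbol_d hm.phase]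
  congr 3; funext ξ
  rw [← mul_assoc, h.phase_mul_df]

lemma inner_opD_sqrt (h : Admissible ρ r c₁ c₂ c₃ c₄ l b) {m : ℝ → ℂ} (hm : IsTestSymbol l b m)
    (w f : RealL2) : ⟪opD l w, T (fun ξ => (√(l ξ) : ℂ) * m ξ) f⟫_ℝ = ⟪w, T m f⟫_ℝ := by
  rw [h.inner_opD, opD, T_T h.isSymbol_d hm.sqrt]
  congr 3; funext ξ
  have h2 := (Real.sqrt_pos.2 (h.l_pos ξ)).ne'
  rw [← mul_assoc, ← Complex.ofReal_mul, df, inv_mul_cancel₀ h2]; simp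

lemma phase_sqrt (h : Admissible ρ r c₁ c₂ c₃ c₄ l b) (m : ℝ → ℂ) (ξ : ℝ) :
    Complex.I * (phase l ξ : ℂ) * ((√(l ξ) : ℂ) * m ξ) = (l ξ : ℂ) * (dx ξ * m ξ) := by
  have e' : (√(l ξ) : ℂ) * (√(l ξ) : ℂ) = (l ξ : ℂ) := by
    exact_mod_cast Real.mul_self_sqrt (h.l_pos ξ).le
  rw [phase, dx]; push_cast
  linear_combination Complex.I * (ξ : ℂ) * m ξ * e'

lemma inner_opS_sqrt (h : Admissible ρ r c₁ c₂ c₃ c₄ l b) {m : ℝ → ℂ} (hm : IsTestSymbol l b m)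
    (v f : RealL2) : ⟪opS l b v, T (fun ξ => (√(l ξ) : ℂ) * m ξ) f⟫_ℝ =
      -⟪v, T (fun ξ => (b ξ : ℂ) * (dx ξ * m ξ)) f⟫_ℝ := by
  rw [opS, inner_T_left h.isSymbol_s, T_T h.isSymbol_s.conjugate hm.sqrt, ← inner_neg_right,
    ← T_neg hm.bd]
  congr 3; funext ξ
  have h2 := (Real.sqrt_pos.2 (h.l_pos ξ)).ne'
  have e : sf l b ξ * √(l ξ) = ξ * b ξ := by rw [sf]; field_simp
  have e' : (sf l b ξ : ℂ) * (√(l ξ) : ℂ) = (ξ : ℂ) * (b ξ : ℂ) := by exact_mod_cast e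
  simp only [map_mul, Complex.conj_I, Complex.conj_ofReal, dx]
  linear_combination -Complex.I * m ξ * e'

/-! ### The equations in weak form -/

/-- Half the sum of the two component equations: the forcing cancels, and `L^{-1/2}` meets `L^{1/2}
∂_x`. -/
lemma hasDerivAt_inner_u (h : Admissible ρ r c₁ c₂ c₃ c₄ l b)
    {y : ℝ → RealL2 × RealL2} (hy : ∀ t, HasDerivAt y (field l b p R t (y t)) t)
    {u w : ℝ → RealL2} (h1 : ∀ t, grp (phase l) t (y t).1 = u t + opD l (w t))
    (h2 : ∀ t, grp (phase l) (-t) (y t).2 = u t - opD l (w t))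
    {m : ℝ → ℂ} (hm : IsTestSymbol l b m) (f : RealL2) (t : ℝ) :
    HasDerivAt (fun τ => ⟪u τ, T m f⟫_ℝ) (-⟪w t, T (fun ξ => dx ξ * m ξ) f⟫_ℝ) t := by
  have d := ((h.hasDerivAt_inner_fst hy hm.one hm.phase f t).add
    (h.hasDerivAt_inner_snd hy hm.one hm.phase f t)).const_mul (1 / 2)
  refine (d.congr_of_eventuallyEq (Eventually.of_forall fun τ => ?_)).congr_deriv ?_
  · simp only [Pi.add_apply, h1, h2, inner_add_left, inner_sub_left]; ring
  · rw [← h.inner_opD_phase hm, h1, h2, inner_add_left, inner_sub_left]; ring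

/-- Half the difference of the component equations, tested with `L^{1/2}` of the test vector because
the difference of the components is `2 L^{-1/2} w`. -/
lemma hasDerivAt_inner_w (h : Admissible ρ r c₁ c₂ c₃ c₄ l b)
    {y : ℝ → RealL2 × RealL2} (hy : ∀ t, HasDerivAt y (field l b p R t (y t)) t)
    {u w : ℝ → RealL2} (h1 : ∀ t, grp (phase l) t (y t).1 = u t + opD l (w t))
    (h2 : ∀ t, grp (phase l) (-t) (y t).2 = u t - opD l (w t))
    {m : ℝ → ℂ} (hm : IsTestSymbol l b m) (f : RealL2) (t : ℝ) :
    HasDerivAt (fun τ => ⟪w τ, T m f⟫_ℝ) (-⟪u t, T (fun ξ => (l ξ : ℂ) * (dx ξ * m ξ)) f⟫_ℝ -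
      ⟪nl p R (u t), T (fun ξ => (b ξ : ℂ) * (dx ξ * m ξ)) f⟫_ℝ) t := by
  have hps : (fun ξ => Complex.I * (phase l ξ : ℂ) * ((√(l ξ) : ℂ) * m ξ)) =
      fun ξ => (l ξ : ℂ) * (dx ξ * m ξ) := funext (h.phase_sqrt m)
  have hs : IsSymbol fun ξ => Complex.I * (phase l ξ : ℂ) * ((√(l ξ) : ℂ) * m ξ) := hps ▸ hm.ld
  have d := ((h.hasDerivAt_inner_fst hy hm.sqrt hs f t).sub
    (h.hasDerivAt_inner_snd hy hm.sqrt hs f t)).const_mul (1 / 2)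
  have hu : disp l t (y t) = u t := by
    rw [disp, h1, h2]; module
  refine (d.congr_of_eventuallyEq (Eventually.of_forall fun τ => ?_)).congr_deriv ?_
  · simp only [Pi.sub_apply, h1, h2, inner_add_left, inner_sub_left, h.inner_opD_sqrt hm]; ring
  · rw [hps, force, hu, h.inner_opS_sqrt hm, h1, h2, inner_add_left, inner_sub_left]; ring

lemma isSolution_of_field (h : Admissible ρ r c₁ c₂ c₃ c₄ l b) (hp : 1 < p) (hR : 0 ≤ R)
    {y : ℝ → RealL2 × RealL2} (hy : ∀ t, HasDerivAt y (field l b p R t (y t)) t)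
    {V V' : ℝ → RealL2} (cV : Continuous V) (cV' : Continuous V')
    (hV : ∀ t, opK l b (V t) = grp (phase l) t (y t).1)
    (hV' : ∀ t, opK l b (V' t) = grp (phase l) (-t) (y t).2)
    (hb : ∀ t, ∀ᵐ x, |opK l b ((1 / 2 : ℝ) • (V t + V' t)) x| ≤ R) :
    IsSolution l b ρ r p (opK l b ((1 / 2 : ℝ) • (V 0 + V' 0)))
      (opB b ((1 / 2 : ℝ) • (V 0 - V' 0))) (Ici 0)
      (fun t => opK l b ((1 / 2 : ℝ) • (V t + V' t)))
      (fun t => opB b ((1 / 2 : ℝ) • (V t - V' t))) := by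
  set u := fun t => opK l b ((1 / 2 : ℝ) • (V t + V' t)) with hu
  set w := fun t => opB b ((1 / 2 : ℝ) • (V t - V' t)) with hw
  have h1 : ∀ t, grp (phase l) t (y t).1 = u t + opD l (w t) := fun t => by
    rw [← hV, hu, hw]
    simp only
    rw [h.opD_opB, ← map_add]; congr 1; module
  have h2 : ∀ t, grp (phase l) (-t) (y t).2 = u t - opD l (w t) := fun t => by
    rw [← hV', hu, hw]
    simp only
    rw [h.opD_opB, ← map_sub]; congr 1; module
  obtain ⟨m, hm, hψ⟩ := h.exists_testL2_eq
  refine ⟨h.comparable_k.continuousInH_iff.2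
    ⟨fun t => (1 / 2 : ℝ) • (V t + V' t), ((cV.add cV').const_smul (1 / 2 : ℝ)).continuousOn,
      fun t _ => rfl⟩, h.comparable_b.continuousInH_iff.2
    ⟨fun t => (1 / 2 : ℝ) • (V t - V' t), ((cV.sub cV').const_smul (1 / 2 : ℝ)).continuousOn,
      fun t _ => rfl⟩, rfl, rfl, fun ψ t _ _ => ?_, fun ψ t _ _ => ?_⟩
  · obtain ⟨f, hf⟩ := hψ ψ
    simp_rw [← real_inner_eq_integral]
    rw [testDeriv_eq hm.one hm.d hf, hf]
    exact h.hasDerivAt_inner_u hy h1 h2 hm f t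
  · obtain ⟨f, hf⟩ := hψ ψ
    have e : ∫ x, g p (u t x) * multiplier b (testDeriv ψ) x =
        ⟪nl p R (u t), multiplier b (testDeriv ψ)⟫_ℝ := by
      rw [real_inner_eq_integral]
      refine integral_congr_ae ?_
      filter_upwards [coeFn_nl_of_bounded hp hR (hb t)] with x hx
      rw [hx]
    rw [e]
    simp_rw [← real_inner_eq_integral]
    rw [multiplier_testDeriv_eq h.l_even hm.one hm.d hm.ld hf,
      multiplier_testDeriv_eq h.b_even hm.one hm.d hm.bd hf, hf]
    exact h.hasDerivAt_inner_w hy h1 h2 hm f t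

/-- Global existence for data in the potential well. -/
lemma exists_global (h : Admissible ρ r c₁ c₂ c₃ c₄ l b) (hp : 1 < p) (hγ : |γ| < c₁)
    {U₀ W₀ : RealL2} (hE : 1 / 2 * ‖W₀ + γ • opD l U₀‖ ^ 2 + quadI l γ U₀ -
      1 / (p + 1) * Q p (opK l b U₀) < critEnergy l b ρ r p γ)
    (hQ : Q p (opK l b U₀) ≤ 2 * quadI l γ U₀) :
    ∃ R, 0 ≤ R ∧ ∃ (y : ℝ → RealL2 × RealL2) (u w : ℝ → RealL2),
      (∀ t, HasDerivAt y (field l b p R t (y t)) t) ∧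
      IsSolution l b ρ r p (opK l b U₀) (opB b W₀) (Ici 0) u w ∧
      ∀ t, (∀ᵐ x, |u t x| ≤ R) ∧ grp (phase l) t (y t).1 = u t + opD l (w t) ∧
        grp (phase l) (-t) (y t).2 = u t - opD l (w t) := by
  -- The truncation height depends only on the critical level, so it is fixed before the solution is
  -- constructed.
  obtain ⟨R, hR0, hR⟩ := h.exists_level_bound hp hγ (critEnergy l b ρ r p γ)
  have hL := (quadI_le_energy hp hQ (W := W₀)).trans_lt hE
  set V := U₀ + W₀ with hVdef
  set V' := U₀ - W₀ with hVdef'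
  have eU : (1 / 2 : ℝ) • (V + V') = U₀ := by rw [hVdef, hVdef']; module
  have eW : (1 / 2 : ℝ) • (V - V') = W₀ := by rw [hVdef, hVdef']; module
  obtain ⟨y, hy0, hy⟩ := h.exists_solution hp hR0 0 (opK l b V, opK l b V')
  have k1 : opK l b V = grp (phase l) 0 (y 0).1 := by rw [hy0, grp_zero]
  have k2 : opK l b V' = grp (phase l) (-0) (y 0).2 := by rw [hy0, neg_zero, grp_zero]
  obtain ⟨X, X', cX, cX', hX⟩ := h.exists_continuous_profile hp hγ hR0 hR hy k1 k2 rfl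
    (by rw [h.quadH_eq, eU, eW, potential_of_bounded hp (hR _ hL), ← sub_eq_add_neg]; exact hE)
    (by rw [eU]; exact hL)
  have e1 : X 0 = V := h.comparable_k.T_injective ((hX 0).1.trans k1.symm)
  have e2 : X' 0 = V' := h.comparable_k.T_injective ((hX 0).2.1.trans k2.symm)
  have hs := h.isSolution_of_field hp hR0 hy cX cX' (fun t => (hX t).1) (fun t => (hX t).2.1)
    (fun t => hR _ (hX t).2.2)
  rw [e1, e2, eU, eW] at hs
  refine ⟨R, hR0, y, _, _, hy, hs, fun t => ⟨hR _ (hX t).2.2, ?_, ?_⟩⟩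
  · rw [← (hX t).1, h.opD_opB, ← map_add]; congr 1; module
  · rw [← (hX t).2.1, h.opD_opB, ← map_sub]; congr 1; module

end Admissible

/-! ### Uniqueness -/

/-- Product rule for a continuous, weakly differentiable curve paired with a differentiable one. -/
lemma hasDerivAt_inner_of_weak {H : Type*} [NormedAddCommGroup H] [InnerProductSpace ℝ H]
    {z θ : ℝ → H} {θ' : H} {d t : ℝ} (hz : ContinuousAt z t)
    (hd : HasDerivAt (fun τ => ⟪z τ, θ t⟫_ℝ) d t) (hθ : HasDerivAt θ θ' t) :
    HasDerivAt (fun τ => ⟪z τ, θ τ⟫_ℝ) (d + ⟪z t, θ'⟫_ℝ) t := by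
  have h2 : HasDerivAt (fun τ => ⟪z τ, θ τ - θ t⟫_ℝ) ⟪z t, θ'⟫_ℝ t := by
    rw [hasDerivAt_iff_tendsto_slope] at hθ ⊢
    have := (hz.tendsto.mono_left (inf_le_left : 𝓝[≠] t ≤ 𝓝 t)).inner (𝕜 := ℝ) hθ
    refine this.congr fun τ => ?_
    rw [slope_def_module, slope_def_module, inner_smul_right]
    simp
  refine (hd.add h2).congr_of_eventuallyEq (Eventually.of_forall fun τ => ?_)
  simp [inner_sub_right]

lemma contDiff_osc {om : ℝ → ℝ} (hom : ContDiff ℝ ∞ om) (t : ℝ) : ContDiff ℝ ∞ (osc om t) := by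
  unfold osc
  exact Complex.contDiff_exp.comp
    (contDiff_const.mul (Complex.ofRealCLM.contDiff.comp (contDiff_const.mul hom)))

namespace Admissible

variable {ρ r c₁ c₂ c₃ c₄ : ℝ} {l b : ℝ → ℝ} {p R γ : ℝ}

lemma opD_injective (h : Admissible ρ r c₁ c₂ c₃ c₄ l b) : Function.Injective (opD l) := by
  intro f g e
  refine ext_hat ?_
  filter_upwards [hat_T h.isSymbol_d f, hat_T h.isSymbol_d g] with η h1 h2
  have h3 : hat (T (fun ξ => (df l ξ : ℂ)) f) = hat (T (fun ξ => (df l ξ : ℂ)) g) := congrArg hat e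
  rw [h3, h2] at h1
  exact (mul_left_cancel₀ (by exact_mod_cast (h.df_pos _).ne') h1).symm

lemma isTestSymbol_mul_chi (h : Admissible ρ r c₁ c₂ c₃ c₄ l b) {m : ℝ → ℂ} (hm : Continuous m)
    (hh : ∀ ξ, m (-ξ) = conj (m ξ)) (n : ℕ) : IsTestSymbol l b fun ξ => m ξ * chi n ξ :=
  h.isTestSymbol_of fun g hg herm _ => by
    simpa only [mul_assoc] using isSymbol_mul_chi (m := fun ξ => g ξ * m ξ) (hg.mul hm)
      (fun ξ => by rw [herm, hh, map_mul]) n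

/-- The first order system for `u` and `L^{-1/2} w`, tested with band-limited functions. -/
lemma hasDerivAt_weak_pair (h : Admissible ρ r c₁ c₂ c₃ c₄ l b) {u w : ℝ → RealL2} {t : ℝ}
    (du : ∀ ψ, HasDerivAt (fun τ => ⟪u τ, testL2 ψ⟫_ℝ) (-⟪w t, testDeriv ψ⟫_ℝ) t)
    (dw : ∀ ψ, HasDerivAt (fun τ => ⟪w τ, testL2 ψ⟫_ℝ)
      (-⟪u t, multiplier l (testDeriv ψ)⟫_ℝ -
        ⟪nl p R (u t), multiplier b (testDeriv ψ)⟫_ℝ) t)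
    {m : ℝ → ℂ} (hm : ContDiff ℝ ∞ m) (hh : ∀ ξ, m (-ξ) = conj (m ξ)) (n : ℕ) (ψ : 𝓢(ℝ, ℝ)) :
    HasDerivAt (fun τ => ⟪u τ, T (fun ξ => m ξ * chi n ξ) (testL2 ψ)⟫_ℝ)
      (-⟪opD l (w t),
        T (fun ξ => Complex.I * (phase l ξ : ℂ) * (m ξ * chi n ξ)) (testL2 ψ)⟫_ℝ) t ∧
    HasDerivAt (fun τ => ⟪opD l (w τ), T (fun ξ => m ξ * chi n ξ) (testL2 ψ)⟫_ℝ)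
      (-⟪u t, T (fun ξ => Complex.I * (phase l ξ : ℂ) * (m ξ * chi n ξ)) (testL2 ψ)⟫_ℝ +
        ⟪opS l b (nl p R (u t)), T (fun ξ => m ξ * chi n ξ) (testL2 ψ)⟫_ℝ) t := by
  have hM := h.isTestSymbol_mul_chi hm.continuous hh n
  have cd : ContDiff ℝ ∞ fun ξ => (df l ξ : ℂ) := Complex.ofRealCLM.contDiff.comp h.df_smooth
  -- The second equation is tested with `L^{-1/2}` of the test function, to become an equation for
  -- `L^{-1/2} w`; smoothness of `l` and the cutoff keep that function Schwartz.
  have hM' := h.isTestSymbol_mul_chi (m := fun ξ => (df l ξ : ℂ) * m ξ)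
    (cd.continuous.mul hm.continuous) (fun ξ => by simp [hh, df, h.l_even]) n
  have hs : ∀ {m : ℝ → ℂ}, ContDiff ℝ ∞ m → IsTestSymbol l b (fun ξ => m ξ * chi n ξ) →
      ∃ ψ', testL2 ψ' = T (fun ξ => m ξ * chi n ξ) (testL2 ψ) := fun hm hM =>
    exists_schwartz_T hM.one (hm.mul (contDiff_chi n)) (hasCompactSupport_chi n).mul_left ψ
  obtain ⟨φ, hφ⟩ := hs hm hM
  obtain ⟨φ', hφ'⟩ := hs (m := fun ξ => (df l ξ : ℂ) * m ξ) (cd.mul hm) hM'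
  have e1 : (fun ξ => (l ξ : ℂ) * (dx ξ * ((df l ξ : ℂ) * m ξ * chi n ξ))) =
      fun ξ => Complex.I * (phase l ξ : ℂ) * (m ξ * chi n ξ) := by
    funext ξ
    have h2 := (Real.sqrt_pos.2 (h.l_pos ξ)).ne'
    have e : l ξ * (ξ * df l ξ) = phase l ξ := by
      have := Real.mul_self_sqrt (h.l_pos ξ).le
      rw [df, phase]; field_simp; rw [pow_two, this, mul_comm]
    rw [← e, dx]; push_cast; ring
  have e2 : (fun ξ => (√(l ξ) : ℂ) * ((df l ξ : ℂ) * m ξ * chi n ξ)) =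
      fun ξ => m ξ * chi n ξ := by
    funext ξ
    have h2 := (Real.sqrt_pos.2 (h.l_pos ξ)).ne'
    have e : (√(l ξ) : ℂ) * (df l ξ : ℂ) = 1 := by
      rw [← Complex.ofReal_mul, df, mul_inv_cancel₀ h2]; simp
    linear_combination m ξ * chi n ξ * e
  constructor
  · have := du φ
    rw [testDeriv_eq hM.one hM.d hφ, ← h.inner_opD_phase hM, hφ] at this
    exact this
  · have := dw φ'
    rw [multiplier_testDeriv_eq h.l_even hM'.one hM'.d hM'.ld hφ',
      multiplier_testDeriv_eq h.b_even hM'.one hM'.d hM'.bd hφ', sub_eq_add_neg,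
      ← h.inner_opS_sqrt hM', e1, e2, hφ'] at this
    refine this.congr_of_eventuallyEq (Eventually.of_forall fun τ => ?_)
    simp only
    rw [← h.inner_opD_sqrt hM', e2]

/-- The interaction picture variables of a weak solution satisfy the equation weakly. -/
lemma hasDerivAt_inner_field (h : Admissible ρ r c₁ c₂ c₃ c₄ l b) {u w : ℝ → RealL2} {t : ℝ}
    (cu : Continuous u) (cw : Continuous w)
    (du : ∀ ψ, HasDerivAt (fun τ => ⟪u τ, testL2 ψ⟫_ℝ) (-⟪w t, testDeriv ψ⟫_ℝ) t)
    (dw : ∀ ψ, HasDerivAt (fun τ => ⟪w τ, testL2 ψ⟫_ℝ)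
      (-⟪u t, multiplier l (testDeriv ψ)⟫_ℝ -
        ⟪nl p R (u t), multiplier b (testDeriv ψ)⟫_ℝ) t) (n : ℕ) (ψ : 𝓢(ℝ, ℝ)) :
    HasDerivAt (fun τ => ⟪grp (phase l) (-τ) (u τ + opD l (w τ)), T (chi n) (testL2 ψ)⟫_ℝ)
      ⟪grp (phase l) (-t) (opS l b (nl p R (u t))), T (chi n) (testL2 ψ)⟫_ℝ t ∧
    HasDerivAt (fun τ => ⟪grp (phase l) τ (u τ - opD l (w τ)), T (chi n) (testL2 ψ)⟫_ℝ)
      ⟪-grp (phase l) t (opS l b (nl p R (u t))), T (chi n) (testL2 ψ)⟫_ℝ t := by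
  have hph := h.isPhase
  have cD : Continuous fun τ => opD l (w τ) := (opD l).continuous.comp cw
  have hgen : IsSymbol fun ξ => Complex.I * (phase l ξ : ℂ) * chi n ξ :=
    isSymbol_mul_chi (m := fun ξ => Complex.I * (phase l ξ : ℂ)) (continuous_const.mul
      (Complex.continuous_ofReal.comp h.phase_smooth.continuous)) (by simp [phase, h.l_even]) n
  have e1 : ∀ s, grp (phase l) s (T (chi n) (testL2 ψ)) =
      T (fun ξ => osc (phase l) s ξ * chi n ξ) (testL2 ψ) := fun s =>
    T_T (hph.isSymbol s) (isSymbol_chi n) _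
  have e2 : ∀ s, grp (phase l) s (T (fun ξ => Complex.I * (phase l ξ : ℂ) * chi n ξ) (testL2 ψ)) =
      T (fun ξ => Complex.I * (phase l ξ : ℂ) * (osc (phase l) s ξ * chi n ξ)) (testL2 ψ) := by
    intro s
    rw [grp, T_T (hph.isSymbol s) hgen]
    congr 2; funext ξ; ring
  -- The group maps band-limited Schwartz functions to admissible test functions since the phase is
  -- smooth. The generator terms then cancel against the time derivative of the moving test
  -- function.
  have key := fun s => h.hasDerivAt_weak_pair du dw (contDiff_osc h.phase_smooth s)
    (hph.isSymbol s).herm n ψ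
  constructor
  · simp_rw [inner_grp_left hph, neg_neg]
    have hd := (key t).1.add (key t).2
    simp only [← e1, ← e2] at hd
    have := hasDerivAt_inner_of_weak (z := fun τ => u τ + opD l (w τ))
      (θ := fun τ => grp (phase l) τ (T (chi n) (testL2 ψ))) (cu.add cD).continuousAt
      (hd.congr_of_eventuallyEq (Eventually.of_forall fun τ => by simp [inner_add_left]))
      (hasDerivAt_grp_T hph (isSymbol_chi n) hgen (testL2 ψ) t)
    refine this.congr_deriv ?_
    rw [inner_add_left]; ring
  · simp_rw [inner_neg_left, inner_grp_left hph]
    have hd := (key (-t)).1.sub (key (-t)).2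
    simp only [← e1, ← e2] at hd
    have := hasDerivAt_inner_of_weak (z := fun τ => u τ - opD l (w τ))
      (θ := fun τ => grp (phase l) (-τ) (T (chi n) (testL2 ψ))) (cu.sub cD).continuousAt
      (hd.congr_of_eventuallyEq (Eventually.of_forall fun τ => by simp [inner_sub_left]))
      (hasDerivAt_grp_T_neg hph (isSymbol_chi n) hgen (testL2 ψ) t)
    refine this.congr_deriv ?_
    rw [inner_neg_right, inner_sub_left]; ring

/-- Let `z` be the interaction picture variables of the weak solution and `G` the time integral of
`field` along `z`. Tested with band-limited functions, `z - G` has zero derivative, so `z = G`;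
hence `z` is differentiable in norm, solves the Lipschitz equation and equals `y`. -/
lemma eq_of_weak (h : Admissible ρ r c₁ c₂ c₃ c₄ l b) (hp : 1 < p) (hR : 0 ≤ R) {t₁ : ℝ}
    {u w : ℝ → RealL2} (cu : Continuous u) (cw : Continuous w)
    (du : ∀ ψ, ∀ t ∈ Ioo 0 t₁,
      HasDerivAt (fun τ => ⟪u τ, testL2 ψ⟫_ℝ) (-⟪w t, testDeriv ψ⟫_ℝ) t)
    (dw : ∀ ψ, ∀ t ∈ Ioo 0 t₁, HasDerivAt (fun τ => ⟪w τ, testL2 ψ⟫_ℝ)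
      (-⟪u t, multiplier l (testDeriv ψ)⟫_ℝ -
        ⟪nl p R (u t), multiplier b (testDeriv ψ)⟫_ℝ) t)
    {y : ℝ → RealL2 × RealL2} (hy : ∀ t, HasDerivAt y (field l b p R t (y t)) t)
    (hy0 : y 0 = (u 0 + opD l (w 0), u 0 - opD l (w 0))) {t : ℝ} (ht : t ∈ Icc 0 t₁) :
    grp (phase l) t (y t).1 = u t + opD l (w t) ∧
      grp (phase l) (-t) (y t).2 = u t - opD l (w t) := by
  have hph := h.isPhase
  have cD : Continuous fun τ => opD l (w τ) := (opD l).continuous.comp cw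
  set z : ℝ → RealL2 × RealL2 := fun t =>
    (grp (phase l) (-t) (u t + opD l (w t)), grp (phase l) t (u t - opD l (w t))) with hz
  have cz : Continuous z := by
    refine Continuous.prodMk ?_ (continuous_grp_comp hph (cu.sub cD))
    have := (continuous_grp_comp hph ((cu.add cD).comp continuous_neg)).comp continuous_neg
    simpa [Function.comp_def] using this
  have hdisp : ∀ t, disp l t (z t) = u t := fun t => by
    rw [disp, hz]
    simp only
    rw [grp_grp_neg hph, grp_neg_grp hph]
    module
  set F : ℝ → RealL2 × RealL2 := fun t => field l b p R t (z t) with hF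
  have cF : Continuous F := h.continuous_field_comp hp hR cz
  set G : ℝ → RealL2 × RealL2 := fun t => z 0 + ∫ s in (0 : ℝ)..t, F s with hG
  have dG : ∀ t, HasDerivAt G (F t) t := fun t =>
    (cF.integral_hasStrictDerivAt 0 t).hasDerivAt.const_add (z 0)
  have cG : Continuous G := continuous_iff_continuousAt.2 fun t => (dG t).continuousAt
  have G0 : G 0 = z 0 := by simp [hG]
  have const : ∀ q : ℝ → ℝ, Continuous q → q 0 = 0 → (∀ s ∈ Ioo 0 t₁, HasDerivAt q 0 s) →
      ∀ s ∈ Icc 0 t₁, q s = 0 := by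
    intro q cq q0 dq s hs
    rcases hs.1.eq_or_lt with h0 | h0
    · rw [← h0, q0]
    · obtain ⟨c, -, hc⟩ := exists_hasDerivAt_eq_slope q (fun _ => 0) h0 cq.continuousOn
        fun x hx => dq x ⟨hx.1, hx.2.trans_le hs.2⟩
      rw [q0, sub_zero, sub_zero, eq_comm, div_eq_zero_iff] at hc
      exact hc.resolve_right h0.ne'
  have hzG : ∀ s ∈ Icc 0 t₁, z s = G s := by
    intro s hs
    refine Prod.ext (sub_eq_zero.1 (eq_zero_of_inner_chi fun n ψ => ?_))
      (sub_eq_zero.1 (eq_zero_of_inner_chi fun n ψ => ?_))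
    · refine const (fun s => ⟪(z s).1 - (G s).1, T (chi n) (testL2 ψ)⟫_ℝ)
        ((cz.fst.sub cG.fst).inner continuous_const) (by simp [G0]) (fun x hx => ?_) s hs
      have h1 := (h.hasDerivAt_inner_field cu cw (fun ψ => du ψ x hx) (fun ψ => dw ψ x hx) n ψ).1
      have h2 : HasDerivAt (fun s => (G s).1) (F x).1 x :=
        (hasFDerivAt_fst (p := G x)).comp_hasDerivAt x (dG x)
      have h3 := h1.sub (h2.inner ℝ (hasDerivAt_const x (T (chi n) (testL2 ψ))))
      refine (h3.congr_of_eventuallyEq (Eventually.of_forall fun s => ?_)).congr_deriv ?_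
      · simp [inner_sub_left, hz]
      · rw [hF]; simp only [field, force]; rw [hdisp]; simp
    · refine const (fun s => ⟪(z s).2 - (G s).2, T (chi n) (testL2 ψ)⟫_ℝ)
        ((cz.snd.sub cG.snd).inner continuous_const) (by simp [G0]) (fun x hx => ?_) s hs
      have h1 := (h.hasDerivAt_inner_field cu cw (fun ψ => du ψ x hx) (fun ψ => dw ψ x hx) n ψ).2
      have h2 : HasDerivAt (fun s => (G s).2) (F x).2 x :=
        (hasFDerivAt_snd (p := G x)).comp_hasDerivAt x (dG x)
      have h3 := h1.sub (h2.inner ℝ (hasDerivAt_const x (T (chi n) (testL2 ψ))))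
      refine (h3.congr_of_eventuallyEq (Eventually.of_forall fun s => ?_)).congr_deriv ?_
      · simp [inner_sub_left, hz]
      · rw [hF]; simp only [field, force]; rw [hdisp]; simp
  have huniq : EqOn G y (Icc 0 t₁) := by
    refine ODE_solution_unique (v := field l b p R) (K := fieldLip l b p R)
      (h.lipschitz_field hp hR) cG.continuousOn (fun s hs => ?_)
      (fun s _ => (hy s).continuousAt.continuousWithinAt) (fun s _ => (hy s).hasDerivWithinAt) ?_
    · have := (dG s).hasDerivWithinAt (s := Ici s)
      simp only [hF] at this
      rwa [show z s = G s from hzG s ⟨hs.1, hs.2.le⟩] at this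
    · rw [G0, hy0, hz]; simp [grp_zero]
  rw [← huniq ht, ← hzG t ht, hz]
  simp only
  rw [grp_grp_neg hph, grp_neg_grp hph]
  exact ⟨rfl, rfl⟩

/-- Uniqueness against a bounded solution given by the interaction picture. -/
lemma unique_of_field (h : Admissible ρ r c₁ c₂ c₃ c₄ l b) (hp : 1 < p) (hR : 0 ≤ R)
    {u₀ w₀ : RealL2} {y : ℝ → RealL2 × RealL2} {u w : ℝ → RealL2}
    (hy : ∀ t, HasDerivAt y (field l b p R t (y t)) t)
    (hub : ∀ t, ∀ᵐ x, |u t x| ≤ R) (h1 : ∀ t, grp (phase l) t (y t).1 = u t + opD l (w t))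
    (h2 : ∀ t, grp (phase l) (-t) (y t).2 = u t - opD l (w t)) (hu0 : u 0 = u₀) (hw0 : w 0 = w₀)
    {S : ℝ} {u' w' : ℝ → RealL2} (hs : IsSolution l b ρ r p u₀ w₀ (Ico 0 S) u' w')
    {t : ℝ} (ht : t ∈ Ico 0 S) : u' t = u t ∧ w' t = w t := by
  obtain ⟨U, cU, hU⟩ := h.comparable_k.continuousInH_iff.1 hs.cont_u
  obtain ⟨W, cW, hW⟩ := h.comparable_b.continuousInH_iff.1 hs.cont_w
  have hsub : Icc 0 t ⊆ Ico 0 S := fun s hs => ⟨hs.1, hs.2.trans_lt ht.2⟩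
  obtain ⟨C', hC'⟩ := isCompact_Icc.exists_bound_of_continuousOn (cU.mono hsub)
  obtain ⟨C, hC, hb⟩ := h.exists_sup_bound
  -- `C * C'` bounds the competing solution on `[0, t]`, so `R'` covers both. Raising the height
  -- does not change the equation for `y`, because `u` is bounded by `R`.
  set R' := max R (C * C') with hR'
  have hR'0 : 0 ≤ R' := hR.trans (le_max_left _ _)
  -- Freezing time outside `[0, t]` makes the curves continuous on all of `ℝ` and changes nothing
  -- near interior times.
  set π : ℝ → ℝ := fun τ => max 0 (min t τ) with hπ
  have cπ : Continuous π := by fun_prop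
  have mπ : ∀ τ, π τ ∈ Icc 0 t := fun τ => ⟨le_max_left _ _, max_le ht.1 (min_le_left _ _)⟩
  have eπ : ∀ τ ∈ Icc 0 t, π τ = τ := fun τ hτ => by
    rw [hπ]; simp only; rw [min_eq_right hτ.2, max_eq_right hτ.1]
  have cu : Continuous fun τ => u' (π τ) := by
    have : Continuous fun τ => opK l b (U (π τ)) :=
      (opK l b).continuous.comp (cU.comp_continuous cπ fun τ => hsub (mπ τ))
    exact this.congr fun τ => hU _ (hsub (mπ τ))
  have cw : Continuous fun τ => w' (π τ) := by
    have : Continuous fun τ => opB b (W (π τ)) :=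
      (opB b).continuous.comp (cW.comp_continuous cπ fun τ => hsub (mπ τ))
    exact this.congr fun τ => hW _ (hsub (mπ τ))
  have hbd : ∀ s ∈ Icc 0 t, ∀ᵐ x, |u' s x| ≤ R' := fun s hs => by
    rw [← hU s (hsub hs)]
    filter_upwards [hb (U s)] with x hx
    exact hx.trans ((mul_le_mul_of_nonneg_left (hC' s hs) hC).trans (le_max_right _ _))
  have ev : ∀ s ∈ Ioo 0 t, ∀ᶠ τ in 𝓝 s, π τ = τ := fun s hs =>
    mem_of_superset (Icc_mem_nhds hs.1 hs.2) eπ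
  have hy' : ∀ s, HasDerivAt y (field l b p R' s (y s)) s := fun s => by
    have e : disp l s (y s) = u s := by rw [disp, h1, h2]; module
    have := hy s
    rwa [field, force, e, nl_eq_nl hp hR (le_max_left R (C * C')) (hub s), ← e] at this
  have z0 : π 0 = 0 := eπ 0 ⟨le_rfl, ht.1⟩
  have key := h.eq_of_weak hp hR'0 (t₁ := t) cu cw (fun ψ s hs' => ?_) (fun ψ s hs' => ?_) hy'
    ?_ (t := t) ⟨ht.1, le_rfl⟩
  · rw [h1, h2, eπ t ⟨ht.1, le_rfl⟩] at key
    have eu : u' t = u t := by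
      have := congrArg₂ (· + ·) key.1 key.2
      simp only [add_add_sub_cancel, ← two_smul ℝ] at this
      exact (smul_right_injective _ (two_ne_zero (α := ℝ)) this).symm
    have ew := key.1
    rw [eu] at ew
    exact ⟨eu, (h.opD_injective (add_left_cancel ew)).symm⟩
  · have := hs.eq_u ψ s (hsub ⟨hs'.1.le, hs'.2.le⟩) hs'.1
    simp_rw [← real_inner_eq_integral] at this
    rw [eπ s ⟨hs'.1.le, hs'.2.le⟩]
    exact this.congr_of_eventuallyEq ((ev s hs').mono fun τ hτ => by simp only [hτ])
  · have := hs.eq_w ψ s (hsub ⟨hs'.1.le, hs'.2.le⟩) hs'.1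
    have e : ∫ x, g p (u' s x) * multiplier b (testDeriv ψ) x =
        ⟪nl p R' (u' s), multiplier b (testDeriv ψ)⟫_ℝ := by
      rw [real_inner_eq_integral]
      refine integral_congr_ae ?_
      filter_upwards [coeFn_nl_of_bounded hp hR'0 (hbd s ⟨hs'.1.le, hs'.2.le⟩)] with x hx
      rw [hx]
    rw [e] at this
    simp_rw [← real_inner_eq_integral] at this
    rw [eπ s ⟨hs'.1.le, hs'.2.le⟩]
    exact this.congr_of_eventuallyEq ((ev s hs').mono fun τ hτ => by simp only [hτ])
  · rw [z0, hs.init_u, hs.init_w, ← hu0, ← hw0, ← h1, ← h2, grp_zero, neg_zero, grp_zero]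

end Admissible

end NonlocalWave

end

/-! ### The global existence theorem and the comparison with `γ = 0` -/

open NonlocalWave in
theorem theorem4p3
    (ρ r p c₁ c₂ c₃ c₄ γ : ℝ) (l b : ℝ → ℝ)
    (hρ : 0 ≤ ρ) (hr : 0 ≤ r) (hrρ : 1 ≤ r + ρ / 2) (hne : (ρ, r) ≠ (0, 1)) (hp : 1 < p)
    (hc₁ : 0 < c₁) (hc₂ : 0 < c₂) (hc₃ : 0 < c₃) (hc₄ : 0 < c₄)
    (hl_smooth : ContDiff ℝ (⊤ : ℕ∞) l) (hb_smooth : ContDiff ℝ (⊤ : ℕ∞) b)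
    (hl_even : ∀ ξ, l (-ξ) = l ξ) (hb_even : ∀ ξ, b (-ξ) = b ξ)
    (hl : ∀ ξ, c₁ ^ 2 * (1 + ξ ^ 2) ^ (ρ / 2) ≤ l ξ ∧ l ξ ≤ c₂ ^ 2 * (1 + ξ ^ 2) ^ (ρ / 2))
    (hb : ∀ ξ, c₃ ^ 2 * (1 + ξ ^ 2) ^ (-(r / 2)) ≤ b ξ ∧ b ξ ≤ c₄ ^ 2 * (1 + ξ ^ 2) ^ (-(r / 2)))
    (hγ : |γ| < c₁)
    (u₀ w₀ : RealL2) (hdata : (u₀, w₀) ∈ SigmaPlus l b ρ r p γ) :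
    (∃ u w : ℝ → RealL2,
      IsSolution l b ρ r p u₀ w₀ (Set.Ici 0) u w ∧
      ∀ T : ℝ, 0 < T → ∀ u' w' : ℝ → RealL2,
        IsSolution l b ρ r p u₀ w₀ (Set.Ico 0 T) u' w' →
        ∀ t ∈ Set.Ico 0 T, u' t = u t ∧ w' t = w t) ∧
    (critEnergy l b ρ r p γ - γ * momentum b u₀ w₀ ≤ critEnergy l b ρ r p 0 →
      (u₀, w₀) ∈ SigmaPlus l b ρ r p 0) := by
  have h : Admissible ρ r c₁ c₂ c₃ c₄ l b := ⟨hρ, hr, hrρ, hne, hc₁, hc₂, hc₃, hc₄, hl_smooth,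
    hb_smooth, hl_even, hb_even, hl, hb⟩
  obtain ⟨hmem, hE, hI⟩ := hdata
  simp only at hE hI
  refine ⟨?_, fun hd => ⟨hmem, ?_, ?_⟩⟩
  · obtain ⟨U, W, rfl, rfl⟩ := h.mem_energySpace.1 hmem
    rw [h.energy_add_momentum] at hE
    rw [h.Iaug_opK] at hI
    obtain ⟨R, hR, y, u, w, hy, hs, hu⟩ := h.exists_global hp hγ hE (by linarith)
    exact ⟨u, w, hs, fun S _ u' w' hs' t ht => h.unique_of_field hp hR hy (fun t => (hu t).1)
      (fun t => (hu t).2.1) (fun t => (hu t).2.2) hs.init_u hs.init_w hs' ht⟩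
  · simp only
    linarith
  -- This is the amount by which `I_0` exceeds `I_γ`.
  · have h1 : 0 ≤ γ ^ 2 / 2 * ∫ x, (invSqrtB b u₀ x) ^ 2 :=
      mul_nonneg (by positivity) (MeasureTheory.integral_nonneg fun _ => sq_nonneg _)
    simp only [Iaug] at hI ⊢
    linarith
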